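/- Let $n\ge 2$ and $\kappa\in\mathbb R$. Let $\mathbb S$ be the unit sphere of $\mathbb R^n$ with its surface measure, and let $\nabla_\omega$, $\nabla_\omega\cdot$ and $\Delta_\omega$ be the tangential gradient, the divergence and the Laplace--Beltrami operator on $\mathbb S$. For $\Omega\in\mathbb S$ put $$L_{\kappa\Omega}(f)=-\Delta_\omega f+\kappa\,\nabla_\omega\cdot\big((\mathrm{Id}-\omega\otimes\omega)\Omega\, f\big),\qquad j_f=\int_{\mathbb S}\omega f(\omega)\,\mathrm d\omega ,$$ and let the set of generalized collisional invariants associated to $\kappa$ and $\Omega$ be $$\mathcal C_{\kappa\Omega}=\Big\{\psi\in H^1(\mathbb S)\ \Big|\ \int_{\mathbb S}L_{\kappa\Omega}(f)\,\psi\,\mathrm d\omega=0\ \text{ for all } f\in C^\infty(\mathbb S) \text{ with } (\mathrm{Id}-\Omega\otimes\Omega)j_f=0\Big\},$$ where functions that agree almost everywhere are identified. Let $$V=\{g \mid (n-2)(\sin\theta)^{\frac n2-2}g\in L^2(0,\pi),\ (\sin\theta)^{\frac n2-1}g\in H^1_0(0,\pi)\},$$ $$\widetilde L_\kappa^*g(\theta)=-\sin^{2-n}\theta\,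 e^{-\kappa\cos\theta}\tfrac{\mathrm d}{\mathrm d\theta}\big(\sin^{n-2}\theta\, e^{\kappa\cos\theta}g'(\theta)\big)+\tfrac{n-2}{\sin^2\theta}\,g(\theta).$$ 1. The elliptic problem $\widetilde L^*_\kappa g=\sin\theta$ has a unique solution $g_\kappa$ in $V$, in the variational sense: for all $\varphi\in V$, $$\int_0^\pi \sin^{n-2}\theta\,e^{\kappa\cos\theta}\Big(g_\kappa'\varphi'+\tfrac{n-2}{\sin^2\theta}\,g_\kappa\varphi\Big)\mathrm d\theta=\int_0^\pi \sin^{n-2}\theta\,e^{\kappa\cos\theta}\,\sin\theta\,\varphi\,\mathrm d\theta .$$ (Elements of $V$ are represented by functions that are continuous on $(0,\pi)$.) Moreover $g_\kappa>0$ on $(0,\pi)$; consequently $h_\kappa(\mu)=(1-\mu^2)^{-1/2}g_\kappa(\arccos\mu)$ is positive on $(-1,1)$. The functions $g_\kappa$ and $h_\kappa$ depend only on $n$ and $\kappa$. 2. If $n=2$ and $\kappa\neq0$, then for $\theta\in[0,\pi]$ $$g_\kappa(\theta)=\frac{\theta}{\kappa}-\frac{\pi}{\kappa}\,\frac{\int_0^\theta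 e^{-\kappa\cos\varphi}\,\mathrm d\varphi}{\int_0^\pi e^{-\kappa\cos\varphi}\,\mathrm d\varphi},$$ and if $n=2$ and $\kappa=0$, then $g_0(\theta)=\sin\theta$. 3. For every $\Omega\in\mathbb S$, the elements of $\mathcal C_{\kappa\Omega}$ are exactly the functions $\psi$ of the form $$\psi(\omega)=C+h_\kappa(\omega\cdot\Omega)\,A\cdot\omega\quad\text{for almost every }\omega\in\mathbb S,\qquad C\in\mathbb R,\ A\in\mathbb R^n,\ A\cdot\Omega=0 .$$ In particular, $\mathcal C_{\kappa\Omega}$ is a vector space of dimension $n$. -/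

import Mathlib

open MeasureTheory Set Filter Topology

noncomputable section

/-- The Euclidean space `ℝⁿ`. -/
abbrev Euc (n : ℕ) : Type := EuclideanSpace ℝ (Fin n)

/-- The unit sphere of `ℝⁿ`. -/
abbrev Sph (n : ℕ) : Type := Metric.sphere (0 : Euc n) 1

/-- The surface measure of the unit sphere. -/
abbrev surfaceMeasure (n : ℕ) : Measure (Sph n) := (volume : Measure (Euc n)).toSphere

/-- The extension of a function on the unit sphere to a function on `ℝⁿ ∖ {0}` that is homogeneous
of degree zero, `x ↦ f (x / |x|)` (with the value `0` at the origin, which plays no role). -/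
def sphExt {n : ℕ} {F : Type*} [Zero F] (f : Sph n → F) (x : Euc n) : F :=
  open Classical in
  if hx : x ≠ 0 then
    f ⟨‖x‖⁻¹ • x, by simp [norm_smul, hx]⟩
  else 0

/-- Functions of class `C^∞` on the unit sphere. -/
def SphSmooth {n : ℕ} (f : Sph n → ℝ) : Prop :=
  ContDiffOn ℝ ((⊤ : ℕ∞) : WithTop ℕ∞) (sphExt f) {0}ᶜ

/-- The tangential gradient `∇_ω f`. -/
def sphGrad {n : ℕ} (f : Sph n → ℝ) (ω : Sph n) : Euc n :=
  gradient (sphExt f) (ω : Euc n)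

/-- The divergence `∇_ω · X` on the unit sphere of a tangential vector field `X`
(`X ω` is orthogonal to `ω`). -/
def sphDiv {n : ℕ} (X : Sph n → Euc n) (ω : Sph n) : ℝ :=
  LinearMap.trace ℝ (Euc n) (fderiv ℝ (sphExt X) (ω : Euc n)).toLinearMap

/-- The Laplace-Beltrami operator `Δ_ω` of the unit sphere. -/
def sphLaplacian {n : ℕ} (f : Sph n → ℝ) : Sph n → ℝ :=
  sphDiv (sphGrad f)

/-- The orthogonal projection `(Id - ω ⊗ ω) v = v - (v · ω) ω`, for a unit vector `ω`. -/
def tangProj {n : ℕ} (ω : Sph n) (v : Euc n) : Euc n :=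
  v - (inner ℝ v (ω : Euc n)) • (ω : Euc n)

/-- The operator `L_{κΩ} f = - Δ_ω f + κ ∇_ω · ((Id - ω ⊗ ω) Ω f)`. -/
def opL {n : ℕ} (κ : ℝ) (Ω : Sph n) (f : Sph n → ℝ) (ω : Sph n) : ℝ :=
  - sphLaplacian f ω + κ * sphDiv (fun ω' => f ω' • tangProj ω' (Ω : Euc n)) ω

/-- The flux `j_f = ∫ ω f(ω) dω`. -/
def flux {n : ℕ} (f : Sph n → ℝ) : Euc n :=
  ∫ ω, f ω • (ω : Euc n) ∂(surfaceMeasure n)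

/-- The Sobolev space `H¹` of the unit sphere, as the completion of `C^∞` for the `H¹` norm: `ψ` is
the limit in `L²` of smooth functions whose tangential gradients converge in `L²`. -/
def MemH1Sph {n : ℕ} (ψ : Sph n → ℝ) : Prop :=
  MemLp ψ 2 (surfaceMeasure n) ∧
  ∃ (u : ℕ → Sph n → ℝ) (G : Sph n → Euc n),
    (∀ k, SphSmooth (u k)) ∧ MemLp G 2 (surfaceMeasure n) ∧
    Tendsto (fun k => eLpNorm (fun ω => u k ω - ψ ω) 2 (surfaceMeasure n)) atTop (𝓝 0) ∧
    Tendsto (fun k => eLpNorm (fun ω => sphGrad (u k) ω - G ω) 2 (surfaceMeasure n)) atTop (𝓝 0)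

/-- The set `C_{κΩ}` of generalized collisional invariants, as a set of `H¹` functions on the unit
sphere, identified when they agree almost everywhere. -/
def genCollInvariants (n : ℕ) (κ : ℝ) (Ω : Sph n) : Set (Lp ℝ 2 (surfaceMeasure n)) :=
  {ψ | MemH1Sph (ψ : Sph n → ℝ) ∧
    ∀ f : Sph n → ℝ, SphSmooth f → tangProj Ω (flux f) = 0 →
      ∫ ω, opL κ Ω f ω * ψ ω ∂(surfaceMeasure n) = 0}

/-- The space `H¹₀(a, b)`, each class being represented by its continuous representative: the
absolutely continuous functions on `[a, b]` that vanish at both ends and have their derivative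
in `L²`. -/
def MemH10 (a b : ℝ) (u : ℝ → ℝ) : Prop :=
  AbsolutelyContinuousOnInterval u a b ∧
  MemLp (deriv u) 2 (volume.restrict (Ioo a b)) ∧ u a = 0 ∧ u b = 0

/-- The weighted `H¹₀` space
`V = {g | (n - 2) (sin θ)^(n/2 - 2) g ∈ L²(0, π), (sin θ)^(n/2 - 1) g ∈ H¹₀(0, π)}`. -/
def MemV (n : ℕ) (g : ℝ → ℝ) : Prop :=
  MemLp (fun θ => ((n : ℝ) - 2) * Real.sin θ ^ ((n : ℝ) / 2 - 2) * g θ) 2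
    (volume.restrict (Ioo 0 Real.pi)) ∧
  MemH10 0 Real.pi (fun θ => Real.sin θ ^ ((n : ℝ) / 2 - 1) * g θ)

/-- The weight `(sin θ)^(n-2) exp (κ cos θ)`, for `n ≥ 2`. -/
def ellWeight (n : ℕ) (κ θ : ℝ) : ℝ :=
  Real.sin θ ^ (n - 2) * Real.exp (κ * Real.cos θ)

/-- `g ∈ V` is a (variational) solution of the elliptic problem `L̃*_κ g = sin θ` on `(0, π)`, where,
with the weight `w(θ) = (sin θ)^(n-2) exp (κ cos θ)`,
`L̃*_κ g = - w⁻¹ (w g')' + (n - 2) (sin θ)⁻² g`. -/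
def IsEllipticSolution (n : ℕ) (κ : ℝ) (g : ℝ → ℝ) : Prop :=
  MemV n g ∧ ∀ φ : ℝ → ℝ, MemV n φ →
    ∫ θ in (0 : ℝ)..Real.pi, ellWeight n κ θ *
        (deriv g θ * deriv φ θ + ((n : ℝ) - 2) / Real.sin θ ^ 2 * g θ * φ θ) =
      ∫ θ in (0 : ℝ)..Real.pi, ellWeight n κ θ * (Real.sin θ * φ θ)

/-- The function `h` on `(-1, 1)` with `g θ = h (cos θ) sin θ`, that is
`h μ = (1 - μ²)^(-1/2) g (arccos μ)`. -/
def hOf (g : ℝ → ℝ) (μ : ℝ) : ℝ :=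
  (1 - μ ^ 2) ^ (-(1 / 2) : ℝ) * g (Real.arccos μ)

end

/-!
The equation `L̃*_κ g = sin θ` is singular at `θ = 0` and `θ = π`. In terms of `h`, where
`g θ = sin θ h (cos θ)`, it becomes the radial equation
`(1 - μ²) h'' - (n + 1) μ h' - (n - 1) h + κ (1 - μ²) h' - κ μ h = -1`,
with regular singular points at `μ = ±1`. Power series give solutions which are smooth up to one end
and beyond. The solutions coming from the two ends are matched at `μ = 0`: the two linear matching
conditions can be solved, because a solution of the homogeneous equation that is smooth up to both
ends would be a solution in `V` of the homogeneous variational problem, and the bilinear form of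
this problem is positive definite on `V`. So there is a solution `h` that is smooth on a
neighbourhood of `[-1, 1]` (`exists_solvesRadial`). An integration by parts shows that
`sin θ h (cos θ)` is the variational solution (`integral_ellIntegrand_angular`), definiteness of the
form gives uniqueness in `V` (`IsEllipticSolution.eqOn`), and positivity is a minimum principle
(`angular_pos`). In dimension two the equation can be integrated explicitly.

On the sphere, `L_κΩ f` is minus the divergence of `∇_ω f - κ f (Id - ω ⊗ ω) Ω`, and, with
`f = exp (κ ω · Ω) φ`, this field is `exp (κ ω · Ω) ∇_ω φ`. By the divergence theorem
(`integral_sphDiv_eq_zero`, deduced from the one on `ℝⁿ` by polar coordinates), the condition on a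
generalized collisional invariant `ψ` is a condition on its weak gradient only. The radial equation
says that `ψ_A = h (ω · Ω) A · ω` with `A ⟂ Ω` satisfies
`∇_ω · (exp (κ ω · Ω) ∇_ω ψ_A) = -exp (κ ω · Ω) A · ω`; hence `∫ L_κΩ (f) ψ_A = A · j_f`
(`integral_opL_mul_invariantOf`), which vanishes if `(Id - Ω ⊗ Ω) j_f = 0`. Conversely, if `ψ` is a
generalized collisional invariant, then the linear form `f ↦ ∫ L_κΩ (f) ψ` on `C^∞` vanishes on the
kernel of `f ↦ (Id - Ω ⊗ Ω) j_f`, which has finite rank, so that it is `f ↦ A · j_f` for some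
`A ⟂ Ω`. Then `χ = ψ - ψ_A` satisfies `∫ L_κΩ (f) χ = 0` for all smooth `f`, and the choice
`f = exp (κ ω · Ω) u` with `u` tending to `χ` in `H¹` shows that the weak gradient of `χ` is zero.

It remains to see that such a `χ` is constant (`exists_ae_eq_const_of_integral_mul_sphDiv`). When
`χ` has mean zero, the fields `(v · ω) ^ d (Id - ω ⊗ ω) v` yield a recurrence by which all the
moments `∫ χ (v · ω) ^ d` vanish; therefore `∫ χ exp (v · ω) = 0` for all `v`, and the exponentials
span a dense space of continuous functions by the Stone–Weierstrass theorem.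
-/

noncomputable section

/-! ### Power series on an interval -/

/-- The power series with coefficients `a` converges absolutely on `(-R, R)`. -/
def ConvergesBelow (R : ℝ) (a : ℕ → ℝ) : Prop :=
  ∀ r, 0 ≤ r → r < R → Summable fun k => |a k| * r ^ k

/-- The sum of the power series with coefficients `a`. -/
def powerSum (a : ℕ → ℝ) (x : ℝ) : ℝ := ∑' k, a k * x ^ k

/-- The coefficients of the derivative of the power series with coefficients `a`. -/
def derivCoeff (a : ℕ → ℝ) (k : ℕ) : ℝ := (k + 1) * a (k + 1)

/-- The coefficients of `x` times the power series with coefficients `a`. -/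
def shiftCoeff (a : ℕ → ℝ) : ℕ → ℝ
  | 0 => 0
  | k + 1 => a k

/-- Abel's lemma: bounded terms at every radius below `R` give absolute convergence below `R`. -/
lemma convergesBelow_of_bounded {R : ℝ} {a : ℕ → ℝ}
    (h : ∀ r, 0 < r → r < R → ∃ C, ∀ k, |a k| * r ^ k ≤ C) : ConvergesBelow R a := by
  intro r hr0 hrR
  obtain ⟨ρ, hρ, hρR⟩ := exists_between hrR
  have hρ0 : 0 < ρ := hr0.trans_lt hρ
  obtain ⟨C, hC⟩ := h ρ hρ0 hρR
  have hq : r / ρ < 1 := (div_lt_one hρ0).2 hρ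
  refine Summable.of_nonneg_of_le (fun k => by positivity) (fun k => ?_)
    ((summable_geometric_of_lt_one (by positivity) hq).mul_left C)
  have : |a k| * r ^ k = |a k| * ρ ^ k * (r / ρ) ^ k := by
    rw [div_pow]; field_simp
  rw [this]
  exact mul_le_mul_of_nonneg_right (hC k) (by positivity)

namespace ConvergesBelow

variable {R : ℝ} {a : ℕ → ℝ}

lemma bounded (h : ConvergesBelow R a) {r : ℝ} (hr0 : 0 ≤ r) (hrR : r < R) :
    ∃ C, ∀ k, |a k| * r ^ k ≤ C :=
  ⟨_, fun k => (h r hr0 hrR).le_tsum k (fun _ _ => by positivity)⟩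

lemma derivCoeff (h : ConvergesBelow R a) : ConvergesBelow R (derivCoeff a) := by
  intro r hr0 hrR
  obtain ⟨ρ, hρ, hρR⟩ := exists_between hrR
  have hρ0 : 0 < ρ := hr0.trans_lt hρ
  obtain ⟨C, hC⟩ := h.bounded hρ0.le hρR
  have hq : ‖r / ρ‖ < 1 := by
    rw [Real.norm_of_nonneg (by positivity)]; exact (div_lt_one hρ0).2 hρ
  have hs : Summable fun k : ℕ => C / ρ * ((k : ℝ) * (r / ρ) ^ k + (r / ρ) ^ k) := by
    have h1 := summable_pow_mul_geometric_of_norm_lt_one 1 hq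
    simp only [pow_one] at h1
    exact (h1.add (summable_geometric_of_norm_lt_one hq)).mul_left _
  refine Summable.of_nonneg_of_le (fun k => by positivity) (fun k => ?_) hs
  have : |_root_.derivCoeff a k| * r ^ k
      = |a (k + 1)| * ρ ^ (k + 1) * ((k + 1) / ρ * (r / ρ) ^ k) := by
    rw [_root_.derivCoeff, abs_mul, abs_of_nonneg (by positivity : (0 : ℝ) ≤ k + 1), div_pow,
      pow_succ]
    field_simp
  rw [this]
  calc _ ≤ C * ((k + 1) / ρ * (r / ρ) ^ k) :=
        mul_le_mul_of_nonneg_right (hC (k + 1)) (by positivity)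
    _ = _ := by ring

lemma summable (h : ConvergesBelow R a) {x : ℝ} (hx : |x| < R) :
    Summable fun k => a k * x ^ k := by
  refine Summable.of_norm ?_
  simpa [abs_mul, abs_pow] using h |x| (abs_nonneg x) hx

lemma hasSum (h : ConvergesBelow R a) {x : ℝ} (hx : |x| < R) :
    HasSum (fun k => a k * x ^ k) (powerSum a x) := (h.summable hx).hasSum

lemma hasSum_shift (h : ConvergesBelow R a) {x : ℝ} (hx : |x| < R) :
    HasSum (fun k => shiftCoeff a k * x ^ k) (x * powerSum a x) := by
  have h1 : HasSum (fun k => shiftCoeff a (k + 1) * x ^ (k + 1)) (x * powerSum a x) := by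
    refine ((h.hasSum hx).mul_left x).congr_fun ?_
    intro k
    simp only [shiftCoeff]
    ring
  simpa [shiftCoeff] using (hasSum_nat_add_iff' (f := fun k => shiftCoeff a k * x ^ k) 1).1
    (by simpa [shiftCoeff] using h1)

lemma shiftCoeff (h : ConvergesBelow R a) : ConvergesBelow R (shiftCoeff a) := by
  refine convergesBelow_of_bounded fun r hr0 hrR => ?_
  obtain ⟨C, hC⟩ := h.bounded hr0.le hrR
  refine ⟨max 0 (r * C), fun k => ?_⟩
  cases k with
  | zero => simp [_root_.shiftCoeff]
  | succ k =>
    refine le_max_of_le_right ?_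
    simp only [_root_.shiftCoeff]
    calc _ = r * (|a k| * r ^ k) := by ring
      _ ≤ _ := by gcongr; exact hC k

lemma hasDerivAt (h : ConvergesBelow R a) {x : ℝ} (hx : |x| < R) :
    HasDerivAt (powerSum a) (powerSum (_root_.derivCoeff a) x) x := by
  obtain ⟨ρ, hρ, hρR⟩ := exists_between hx
  have hρ0 : 0 < ρ := (abs_nonneg x).trans_lt hρ
  have hu : Summable fun k : ℕ => (k : ℝ) * |a k| * ρ ^ (k - 1) := by
    rw [← summable_nat_add_iff 1]
    refine (h.derivCoeff ρ hρ0.le hρR).congr fun k => ?_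
    rw [_root_.derivCoeff, abs_mul, abs_of_nonneg (by positivity : (0 : ℝ) ≤ k + 1)]
    simp
  have key := hasDerivAt_tsum_of_isPreconnected (𝕜 := ℝ) (g := fun k y => a k * y ^ k)
    (g' := fun k y => a k * (k * y ^ (k - 1))) (t := Ioo (-ρ) ρ) (y₀ := 0) (y := x) hu isOpen_Ioo
    (convex_Ioo _ _).isPreconnected (fun k y _ => (hasDerivAt_pow k y).const_mul (a k))
    (fun k y hy => by
      have hy' : |y| ≤ ρ := abs_le.2 ⟨hy.1.le, hy.2.le⟩
      rw [Real.norm_eq_abs, abs_mul, abs_mul, abs_pow, Nat.abs_cast]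
      calc |a k| * (k * |y| ^ (k - 1)) ≤ |a k| * (k * ρ ^ (k - 1)) := by gcongr
        _ = _ := by ring)
    ⟨by linarith, hρ0⟩ (h.summable (by simpa using (abs_nonneg x).trans_lt hx)) (abs_lt.1 hρ)
  have h2 : ∑' k : ℕ, a k * (k * x ^ (k - 1)) = powerSum (_root_.derivCoeff a) x := by
    have hs : HasSum (fun k : ℕ => a (k + 1) * (((k + 1 : ℕ) : ℝ) * x ^ (k + 1 - 1)))
        (powerSum (_root_.derivCoeff a) x) := by
      refine (h.derivCoeff.hasSum hx).congr_fun ?_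
      intro k
      simp [_root_.derivCoeff]
      ring
    have := (hasSum_nat_add_iff' (f := fun k : ℕ => a k * (k * x ^ (k - 1))) 1).1
      (by simpa using hs)
    exact this.tsum_eq
  rw [← h2]
  exact key

lemma contDiffOn (h : ConvergesBelow R a) :
    ContDiffOn ℝ ((⊤ : ℕ∞) : WithTop ℕ∞) (powerSum a) (Ioo (-R) R) := by
  rw [contDiffOn_infty]
  intro m
  induction m generalizing a with
  | zero =>
    exact contDiffOn_zero.2 fun x hx =>
      (h.hasDerivAt (abs_lt.2 hx)).continuousAt.continuousWithinAt
  | succ m ih =>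
    push_cast
    rw [contDiffOn_succ_iff_deriv_of_isOpen isOpen_Ioo]
    refine ⟨fun x hx => (h.hasDerivAt (abs_lt.2 hx)).differentiableAt.differentiableWithinAt,
      by simp, ?_⟩
    exact (ih h.derivCoeff).congr fun x hx => (h.hasDerivAt (abs_lt.2 hx)).deriv

end ConvergesBelow

/-! ### The differential equation for `h` -/

/-- The function `h` solves at `μ` the equation satisfied by `h` when `h (ω · Ω) A · ω` solves
`L*_κΩ ψ = c A · ω`. -/
def SolvesRadial (n : ℕ) (κ c : ℝ) (h : ℝ → ℝ) (μ : ℝ) : Prop :=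
  (1 - μ ^ 2) * deriv (deriv h) μ - (n + 1) * μ * deriv h μ - (n - 1) * h μ
    + κ * (1 - μ ^ 2) * deriv h μ - κ * μ * h μ = -c

/-- The coefficients, in powers of `1 + μ`, of the solution of the equation for `h` that is
regular at `μ = -1` and takes there the value `s`. -/
def frobeniusCoeff (n : ℕ) (κ c s : ℝ) : ℕ → ℝ
  | 0 => s
  | 1 => ((n - 1 - κ) * s - c) / (n + 1)
  | k + 2 =>
    (((k + 1) * k + (n + 1) * (k + 1) + (n - 1) - 2 * κ * (k + 1) - κ)
        * frobeniusCoeff n κ c s (k + 1) + κ * (k + 1) * frobeniusCoeff n κ c s k)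
      / ((k + 2) * (2 * k + n + 3))

lemma exists_bound_of_le_max {b : ℕ → ℝ} {N : ℕ}
    (h : ∀ k, N ≤ k → b (k + 2) ≤ max (b (k + 1)) (b k)) : ∃ C, ∀ k, b k ≤ C := by
  have key : ∀ j, b (N + j) ≤ max (b N) (b (N + 1)) ∧ b (N + j + 1) ≤ max (b N) (b (N + 1)) := by
    intro j
    induction j with
    | zero => simp
    | succ j ih =>
      refine ⟨ih.2, (h (N + j) (by omega)).trans (max_le ih.2 ih.1)⟩
  obtain ⟨C, hC⟩ := ((Finset.range N).image b).bddAbove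
  refine ⟨max C (max (b N) (b (N + 1))), fun k => ?_⟩
  rcases lt_or_ge k N with hk | hk
  · exact le_max_of_le_left (hC (by simpa using ⟨k, hk, rfl⟩))
  · obtain ⟨j, rfl⟩ := Nat.exists_eq_add_of_le hk
    exact le_max_of_le_right (key j).1

/-- For `r < 2` and large `k` the recurrence gives
`|a (k + 2)| r ^ (k + 2) ≤ max (|a (k + 1)| r ^ (k + 1)) (|a k| r ^ k)`, since its leading
coefficient tends to `1 / 2`. -/
lemma convergesBelow_frobeniusCoeff (n : ℕ) (κ c s : ℝ) (hn : 1 ≤ n) :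
    ConvergesBelow 2 (frobeniusCoeff n κ c s) := by
  refine convergesBelow_of_bounded fun r hr0 hr2 => ?_
  have hn' : (1 : ℝ) ≤ n := by exact_mod_cast hn
  -- `M` is such that the coefficient of `a (k + 1)` is at most `(k + 1) (k + M)` in absolute value.
  set M : ℝ := 2 * n + 3 * |κ| with hM
  obtain ⟨N, hN⟩ := exists_nat_gt ((r * M + |κ| * r ^ 2) / (2 - r))
  refine exists_bound_of_le_max (N := N) fun k hk => ?_
  set a := frobeniusCoeff n κ c s
  have hk' : r * M + |κ| * r ^ 2 ≤ k * (2 - r) := by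
    rw [div_lt_iff₀ (by linarith)] at hN
    have : (N : ℝ) ≤ k := by exact_mod_cast hk
    nlinarith
  set m := max (|a (k + 1)| * r ^ (k + 1)) (|a k| * r ^ k) with hm
  have hm1 : |a (k + 1)| * r ^ (k + 1) ≤ m := le_max_left _ _
  have hm0 : |a k| * r ^ k ≤ m := le_max_right _ _
  have hmn : 0 ≤ m := le_trans (by positivity) hm0
  have hD : (0 : ℝ) < (k + 2) * (2 * k + n + 3) := by positivity
  have hrec : a (k + 2) = (((k + 1) * k + (n + 1) * (k + 1) + (n - 1) - 2 * κ * (k + 1) - κ)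
        * a (k + 1) + κ * (k + 1) * a k) / ((k + 2) * (2 * k + n + 3)) := by
    simp only [a, frobeniusCoeff]
  set Q : ℝ := (k + 1) * k + (n + 1) * (k + 1) + (n - 1) - 2 * κ * (k + 1) - κ with hQ
  have hQb : |Q| ≤ (k + 1) * (k + M) := by
    have h1 := abs_nonneg κ
    have h2 := le_abs_self κ
    have h3 := neg_abs_le κ
    have hk0 : (0 : ℝ) ≤ k := by positivity
    rw [abs_le]
    constructor <;> rw [hQ, hM] <;> nlinarith [mul_nonneg hk0 h1, mul_nonneg hk0 (sub_nonneg.2 h2),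
      mul_nonneg hk0 (sub_nonneg.2 h3), mul_nonneg hk0 (sub_nonneg.2 hn'), mul_nonneg hk0 hk0]
  rw [hrec, abs_div, abs_of_pos hD, div_mul_eq_mul_div, div_le_iff₀ hD]
  calc |Q * a (k + 1) + κ * (k + 1) * a k| * r ^ (k + 2)
      ≤ (|Q| * |a (k + 1)| + |κ| * (k + 1) * |a k|) * r ^ (k + 2) := by
        gcongr
        refine (abs_add_le _ _).trans (le_of_eq ?_)
        rw [abs_mul, abs_mul, abs_mul, abs_of_nonneg (by positivity : (0 : ℝ) ≤ (k : ℝ) + 1)]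
    _ = |Q| * r * (|a (k + 1)| * r ^ (k + 1)) + |κ| * (k + 1) * r ^ 2 * (|a k| * r ^ k) := by ring
    _ ≤ |Q| * r * m + |κ| * (k + 1) * r ^ 2 * m := by gcongr
    _ ≤ (k + 1) * (k + M) * r * m + |κ| * (k + 1) * r ^ 2 * m := by gcongr
    _ = m * ((k + 1) * (k * r + (r * M + |κ| * r ^ 2))) := by ring
    _ ≤ m * ((k + 1) * (k * r + k * (2 - r))) := by gcongr
    _ ≤ m * ((k + 2) * (2 * k + n + 3)) := by
        refine mul_le_mul_of_nonneg_left ?_ hmn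
        have hk0 : (0 : ℝ) ≤ k := by positivity
        nlinarith

/-- The solution of the equation for `h` that is regular at `μ = -1`. -/
def leftSolution (n : ℕ) (κ c s μ : ℝ) : ℝ := powerSum (frobeniusCoeff n κ c s) (1 + μ)

lemma hasDerivAt_powerSum_one_add {a : ℕ → ℝ} (ha : ConvergesBelow 2 a) {μ : ℝ}
    (hμ : μ ∈ Ioo (-3 : ℝ) 1) :
    HasDerivAt (fun μ => powerSum a (1 + μ)) (powerSum (derivCoeff a) (1 + μ)) μ := by
  have := (ha.hasDerivAt (x := 1 + μ) (abs_lt.2 ⟨by linarith [hμ.1], by linarith [hμ.2]⟩))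
  simpa using this.comp_const_add 1 μ

lemma contDiffOn_leftSolution (n : ℕ) (κ c s : ℝ) (hn : 1 ≤ n) :
    ContDiffOn ℝ ((⊤ : ℕ∞) : WithTop ℕ∞) (leftSolution n κ c s) (Ioo (-3) 1) := by
  refine (convergesBelow_frobeniusCoeff n κ c s hn).contDiffOn.comp
    (contDiff_const.add contDiff_id).contDiffOn fun μ hμ => ?_
  exact ⟨by linarith [hμ.1], by linarith [hμ.2]⟩

lemma leftSolution_neg_one (n : ℕ) (κ c s : ℝ) : leftSolution n κ c s (-1) = s := by
  rw [leftSolution, powerSum, tsum_eq_single 0]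
  · simp [frobeniusCoeff]
  · intro k hk
    simp [hk]

lemma solvesRadial_leftSolution (n : ℕ) (κ c s : ℝ) (hn : 1 ≤ n) {μ : ℝ}
    (hμ : μ ∈ Ioo (-3 : ℝ) 1) : SolvesRadial n κ c (leftSolution n κ c s) μ := by
  set a := frobeniusCoeff n κ c s with ha
  have h0 : ConvergesBelow 2 a := convergesBelow_frobeniusCoeff n κ c s hn
  have h1 := h0.derivCoeff
  have h2 := h1.derivCoeff
  set x := 1 + μ with hx
  have hx2 : |x| < 2 := abs_lt.2 ⟨by linarith [hμ.1], by linarith [hμ.2]⟩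
  have d1 : ∀ y ∈ Ioo (-3 : ℝ) 1,
      deriv (leftSolution n κ c s) y = powerSum (derivCoeff a) (1 + y) :=
    fun y hy => (hasDerivAt_powerSum_one_add h0 hy).deriv
  have d2 : deriv (deriv (leftSolution n κ c s)) μ = powerSum (derivCoeff (derivCoeff a)) x := by
    have : deriv (leftSolution n κ c s) =ᶠ[𝓝 μ] fun y => powerSum (derivCoeff a) (1 + y) :=
      Filter.eventuallyEq_of_mem (isOpen_Ioo.mem_nhds hμ) d1
    rw [this.deriv_eq]
    exact (hasDerivAt_powerSum_one_add h1 hμ).deriv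
  have s0 := h1.shiftCoeff
  have s1 := h2.shiftCoeff
  have e0 := h0.hasSum hx2
  have e1 := h1.hasSum hx2
  have e0' := h0.hasSum_shift hx2
  have e1' := h1.hasSum_shift hx2
  have e2' := h2.hasSum_shift hx2
  have e1'' := s0.hasSum_shift hx2
  have e2'' := s1.hasSum_shift hx2
  rw [show powerSum (shiftCoeff (derivCoeff a)) x = _ from e1'.tsum_eq] at e1''
  rw [show powerSum (shiftCoeff (derivCoeff (derivCoeff a))) x = _ from e2'.tsum_eq] at e2''
  -- The equation in the variable `x = 1 + μ`, where `1 - μ² = 2 x - x²`, term by term.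
  have total := ((((((((e2'.mul_left 2).sub e2'').sub (e1'.mul_left (n + 1 : ℝ))).add
    (e1.mul_left (n + 1 : ℝ))).sub (e0.mul_left (n - 1 : ℝ))).add (e1'.mul_left (2 * κ))).sub
    (e1''.mul_left κ)).sub (e0'.mul_left κ)).add (e0.mul_left κ)
  have hsing := hasSum_single (f := fun k : ℕ => (if k = 0 then -c else 0) * x ^ k) 0
    (fun k hk => by simp [hk])
  have huniq := total.unique (hsing.congr_fun (fun k => ?_))
  · simp only [SolvesRadial]
    rw [d2, d1 μ hμ, ← hx]
    have hl : leftSolution n κ c s μ = powerSum a x := rfl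
    rw [hl]
    simp only [if_true, pow_zero, mul_one] at huniq
    have : μ = x - 1 := by rw [hx]; ring
    rw [this]
    linear_combination huniq
  · have hn0 : (0 : ℝ) < (n : ℝ) + 1 := by positivity
    rcases k with _ | _ | k
    · simp only [shiftCoeff, derivCoeff, ha, frobeniusCoeff]
      push_cast
      field_simp
      simp
      ring
    · have h2' : ((n : ℝ) + 3) ≠ 0 := by positivity
      simp only [shiftCoeff, derivCoeff, ha, frobeniusCoeff]
      push_cast
      simp
      field_simp
      ring
    · have hr : (((k + 1 : ℕ) : ℝ) + 2) * (2 * ((k + 1 : ℕ) : ℝ) + n + 3) * a (k + 1 + 2) =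
          (((((k + 1 : ℕ) : ℝ) + 1) * ((k + 1 : ℕ) : ℝ) + (n + 1) * (((k + 1 : ℕ) : ℝ) + 1)
            + (n - 1) - 2 * κ * (((k + 1 : ℕ) : ℝ) + 1) - κ)
        * a (k + 1 + 1) + κ * (((k + 1 : ℕ) : ℝ) + 1) * a (k + 1)) := by
        have : (((k + 1 : ℕ) : ℝ) + 2) * (2 * ((k + 1 : ℕ) : ℝ) + n + 3) ≠ 0 := by positivity
        rw [show a (k + 1 + 2) = _ from rfl, ha, frobeniusCoeff]
        field_simp
      simp only [shiftCoeff, derivCoeff]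
      push_cast at hr ⊢
      simp only [show k + 1 + 1 = k + 2 from rfl, show k + 2 + 1 = k + 3 from rfl] at hr ⊢
      simp
      linear_combination (exp := 1) x ^ (k + 2) * hr

/-! ### The weighted space `V` -/

lemma AbsolutelyContinuousOnInterval.congr {f g : ℝ → ℝ} {a b : ℝ}
    (hf : AbsolutelyContinuousOnInterval f a b) (hfg : EqOn f g (uIcc a b)) :
    AbsolutelyContinuousOnInterval g a b := by
  rw [absolutelyContinuousOnInterval_iff] at hf ⊢
  intro ε hε
  obtain ⟨δ, hδ, h⟩ := hf ε hε
  refine ⟨δ, hδ, fun E hE hE' => ?_⟩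
  convert h E hE hE' using 1
  refine Finset.sum_congr rfl fun i hi => ?_
  rw [hfg (hE.1 i hi).1, hfg (hE.1 i hi).2]

lemma ContinuousOn.memLp_Ioo {f : ℝ → ℝ} {a b : ℝ} (hf : ContinuousOn f (Icc a b)) :
    MemLp f 2 (volume.restrict (Ioo a b)) := by
  obtain ⟨C, hC⟩ := isCompact_Icc.exists_bound_of_continuousOn hf
  refine MemLp.of_bound ((hf.mono Ioo_subset_Icc_self).aestronglyMeasurable measurableSet_Ioo) C ?_
  filter_upwards [ae_restrict_mem measurableSet_Ioo] with x hx using hC x (Ioo_subset_Icc_self hx)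

lemma sin_pos_of_mem {θ : ℝ} (hθ : θ ∈ Ioo 0 Real.pi) : 0 < Real.sin θ :=
  Real.sin_pos_of_pos_of_lt_pi hθ.1 hθ.2

namespace MemV

variable {n : ℕ} {φ ψ : ℝ → ℝ}

/-- On `(0, π)`, where the weight is smooth and positive, an element of `V` is locally absolutely
continuous. -/
lemma absolutelyContinuous (h : MemV n φ) {α β : ℝ} (hα : α ∈ Ioo 0 Real.pi)
    (hβ : β ∈ Ioo 0 Real.pi) : AbsolutelyContinuousOnInterval φ α β := by
  have hsub : uIcc α β ⊆ Ioo 0 Real.pi := ordConnected_Ioo.uIcc_subset hα hβ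
  have h1 : AbsolutelyContinuousOnInterval
      (fun θ => Real.sin θ ^ ((n : ℝ) / 2 - 1) * φ θ) α β := by
    refine h.2.1.mono ?_
    rw [uIcc_of_le Real.pi_pos.le]
    exact hsub.trans Ioo_subset_Icc_self
  have h2 : AbsolutelyContinuousOnInterval
      (fun θ => Real.sin θ ^ (-((n : ℝ) / 2 - 1))) α β := by
    refine ContDiffOn.absolutelyContinuousOnInterval ?_
    exact Real.contDiff_sin.contDiffOn.rpow_const_of_ne
      fun x hx => (sin_pos_of_mem (hsub hx)).ne'
  refine (h2.fun_mul h1).congr fun θ hθ => ?_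
  have hs := sin_pos_of_mem (hsub hθ)
  simp only
  rw [← mul_assoc, ← Real.rpow_add hs]
  simp

lemma ae_differentiableAt (h : MemV n φ) :
    ∀ᵐ θ ∂volume.restrict (Ioo 0 Real.pi), DifferentiableAt ℝ φ θ ∧
      deriv (fun θ => Real.sin θ ^ ((n : ℝ) / 2 - 1) * φ θ) θ =
        ((n : ℝ) / 2 - 1) * Real.sin θ ^ ((n : ℝ) / 2 - 2) * Real.cos θ * φ θ
          + Real.sin θ ^ ((n : ℝ) / 2 - 1) * deriv φ θ := by
  rw [ae_restrict_iff' measurableSet_Ioo]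
  filter_upwards [h.2.1.boundedVariationOn.ae_differentiableAt_of_mem_uIcc] with θ hθ hmem
  have hs := sin_pos_of_mem hmem
  have hu := hθ (by rw [uIcc_of_le Real.pi_pos.le]; exact Ioo_subset_Icc_self hmem)
  have hd : DifferentiableAt ℝ φ θ := by
    have h1 : DifferentiableAt ℝ (fun θ => Real.sin θ ^ (-((n : ℝ) / 2 - 1)) *
        (Real.sin θ ^ ((n : ℝ) / 2 - 1) * φ θ)) θ :=
      (Real.differentiableAt_sin.rpow_const (Or.inl hs.ne')).mul hu
    refine h1.congr_of_eventuallyEq ?_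
    filter_upwards [isOpen_Ioo.mem_nhds hmem] with t ht
    rw [← mul_assoc, ← Real.rpow_add (sin_pos_of_mem ht)]
    simp
  refine ⟨hd, ?_⟩
  have h2 := ((Real.hasDerivAt_sin θ).rpow_const (p := (n : ℝ) / 2 - 1) (Or.inl hs.ne')).mul
    hd.hasDerivAt
  rw [show (fun θ => Real.sin θ ^ ((n : ℝ) / 2 - 1) * φ θ)
    = (fun θ => Real.sin θ ^ ((n : ℝ) / 2 - 1)) * φ from rfl, h2.deriv]
  rw [show (n : ℝ) / 2 - 1 - 1 = (n : ℝ) / 2 - 2 by ring]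
  ring

/-- The weighted derivative differs from the derivative of `(sin θ) ^ (n / 2 - 1) φ` by
`cos θ / 2` times the zero order term in the definition of `V`. -/
lemma memLp_deriv (h : MemV n φ) :
    MemLp (fun θ => Real.sin θ ^ ((n : ℝ) / 2 - 1) * deriv φ θ) 2
      (volume.restrict (Ioo 0 Real.pi)) := by
  have h1 : MemLp (fun θ => (2⁻¹ * Real.cos θ) *
      (((n : ℝ) - 2) * Real.sin θ ^ ((n : ℝ) / 2 - 2) * φ θ)) 2
      (volume.restrict (Ioo 0 Real.pi)) := by
    refine h.1.of_le ((by fun_prop : Continuous fun θ => 2⁻¹ * Real.cos θ).aestronglyMeasurable.mul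
      h.1.1) (Eventually.of_forall fun θ => ?_)
    rw [norm_mul]
    refine mul_le_of_le_one_left (norm_nonneg _) ?_
    rw [Real.norm_eq_abs, abs_mul]
    have := Real.abs_cos_le_one θ
    norm_num
    linarith
  refine (h.2.2.1.sub h1).ae_eq ?_
  filter_upwards [h.ae_differentiableAt] with θ hθ
  simp only [Pi.sub_apply]
  rw [hθ.2]
  ring

lemma sub (h : MemV n φ) (h' : MemV n ψ) : MemV n (fun θ => φ θ - ψ θ) := by
  refine ⟨(h.1.sub h'.1).ae_eq (Eventually.of_forall fun θ => ?_), ?_, ?_, ?_, ?_⟩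
  · simp only [Pi.sub_apply]; ring
  · refine (h.2.1.sub h'.2.1).congr fun θ _ => ?_
    simp only [Pi.sub_apply]; ring
  · refine (h.2.2.1.sub h'.2.2.1).ae_eq ?_
    have hI : ∀ᵐ θ ∂volume.restrict (Ioo 0 Real.pi), θ ∈ Ioo 0 Real.pi :=
      ae_restrict_mem measurableSet_Ioo
    have e1 := ae_restrict_of_ae (s := Ioo 0 Real.pi)
      h.2.1.boundedVariationOn.ae_differentiableAt_of_mem_uIcc
    have e2 := ae_restrict_of_ae (s := Ioo 0 Real.pi)
      h'.2.1.boundedVariationOn.ae_differentiableAt_of_mem_uIcc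
    filter_upwards [hI, e1, e2] with θ hθ h1 h2
    have hm : θ ∈ uIcc 0 Real.pi := by
      rw [uIcc_of_le Real.pi_pos.le]; exact Ioo_subset_Icc_self hθ
    simp only [Pi.sub_apply]
    rw [← deriv_sub (h1 hm) (h2 hm)]
    congr 1
    ext t
    simp only [Pi.sub_apply]; ring
  · have := h.2.2.2.1; have := h'.2.2.2.1; simp only at *; linarith
  · have := h.2.2.2.2; have := h'.2.2.2.2; simp only at *; linarith

end MemV

/-- The integrand of the bilinear form of the elliptic problem. -/
def ellIntegrand (n : ℕ) (κ : ℝ) (g φ : ℝ → ℝ) (θ : ℝ) : ℝ :=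
  ellWeight n κ θ * (deriv g θ * deriv φ θ + ((n : ℝ) - 2) / Real.sin θ ^ 2 * g θ * φ θ)

/-- The bilinear form is an `L²` product of the functions occurring in the norm of `V`. -/
lemma ellIntegrand_eq {n : ℕ} (hn : 2 ≤ n) (κ : ℝ) (g φ : ℝ → ℝ) {θ : ℝ}
    (hθ : θ ∈ Ioo 0 Real.pi) : ellIntegrand n κ g φ θ = Real.exp (κ * Real.cos θ) *
      ((Real.sin θ ^ ((n : ℝ) / 2 - 1) * deriv g θ) * (Real.sin θ ^ ((n : ℝ) / 2 - 1) * deriv φ θ)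
      + ((n : ℝ) - 2)⁻¹ * ((((n : ℝ) - 2) * Real.sin θ ^ ((n : ℝ) / 2 - 2) * g θ) *
        (((n : ℝ) - 2) * Real.sin θ ^ ((n : ℝ) / 2 - 2) * φ θ))) := by
  have hs := sin_pos_of_mem hθ
  have h1 : Real.sin θ ^ (n - 2) =
      Real.sin θ ^ ((n : ℝ) / 2 - 1) * Real.sin θ ^ ((n : ℝ) / 2 - 1) := by
    rw [← Real.rpow_add hs, ← Real.rpow_natCast]
    congr 1
    rw [Nat.cast_sub hn]; push_cast; ring
  have h2 : Real.sin θ ^ ((n : ℝ) / 2 - 1) = Real.sin θ ^ ((n : ℝ) / 2 - 2) * Real.sin θ := by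
    rw [← Real.rpow_add_one hs.ne']; congr 1; ring
  have h3 : ((n : ℝ) - 2)⁻¹ * (((n : ℝ) - 2) * ((n : ℝ) - 2)) = (n : ℝ) - 2 := by
    by_cases h : (n : ℝ) - 2 = 0
    · simp [h]
    · field_simp
  rw [ellIntegrand, ellWeight, h1]
  have h4 : Real.sin θ ^ ((n : ℝ) / 2 - 1) * Real.sin θ ^ ((n : ℝ) / 2 - 1) / Real.sin θ ^ 2
      = Real.sin θ ^ ((n : ℝ) / 2 - 2) * Real.sin θ ^ ((n : ℝ) / 2 - 2) := by
    rw [h2]; field_simp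
  set S := Real.sin θ ^ ((n : ℝ) / 2 - 1)
  set T := Real.sin θ ^ ((n : ℝ) / 2 - 2)
  calc _ = Real.exp (κ * Real.cos θ) * (S * deriv g θ * (S * deriv φ θ)
        + ((n : ℝ) - 2) * (S * S / Real.sin θ ^ 2) * g θ * φ θ) := by field_simp
    _ = _ := by
      rw [h4]
      linear_combination (- Real.exp (κ * Real.cos θ) * T * T * g θ * φ θ) * h3

lemma intervalIntegrable_iff_Ioo {f : ℝ → ℝ} :
    IntervalIntegrable f volume 0 Real.pi ↔ Integrable f (volume.restrict (Ioo 0 Real.pi)) := by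
  rw [intervalIntegrable_iff_integrableOn_Ioo_of_le Real.pi_pos.le, IntegrableOn]

lemma intervalIntegrable_ellIntegrand {n : ℕ} (hn : 2 ≤ n) (κ : ℝ) {g φ : ℝ → ℝ}
    (hg : MemV n g) (hφ : MemV n φ) :
    IntervalIntegrable (ellIntegrand n κ g φ) volume 0 Real.pi := by
  rw [intervalIntegrable_iff_Ioo]
  have h1 := (hg.memLp_deriv.integrable_mul hφ.memLp_deriv).add
    ((hg.1.integrable_mul hφ.1).const_mul ((n : ℝ) - 2)⁻¹)
  have h2 := h1.bdd_mul (c := Real.exp |κ|) (f := fun θ => Real.exp (κ * Real.cos θ))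
    (by fun_prop) (Eventually.of_forall fun θ => by
      rw [Real.norm_eq_abs, Real.abs_exp, Real.exp_le_exp]
      calc κ * Real.cos θ ≤ |κ * Real.cos θ| := le_abs_self _
        _ = |κ| * |Real.cos θ| := abs_mul _ _
        _ ≤ |κ| * 1 := by gcongr; exact Real.abs_cos_le_one θ
        _ = |κ| := mul_one _)
  refine h2.congr ?_
  filter_upwards [ae_restrict_mem measurableSet_Ioo] with θ hθ
  rw [ellIntegrand_eq hn κ g φ hθ]
  rfl

/-- The source term is integrable against elements of `V`. -/
lemma MemV.intervalIntegrable_weight_mul {n : ℕ} (hn : 2 ≤ n) (κ : ℝ) {φ : ℝ → ℝ}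
    (hφ : MemV n φ) :
    IntervalIntegrable (fun θ => ellWeight n κ θ * (Real.sin θ * φ θ)) volume 0 Real.pi := by
  rw [intervalIntegrable_iff_Ioo]
  have ha : 0 ≤ (n : ℝ) / 2 - 1 := by
    have : (2 : ℝ) ≤ n := by exact_mod_cast hn
    linarith
  have hc : ContinuousOn (fun θ => Real.exp (κ * Real.cos θ) * Real.sin θ *
      (Real.sin θ ^ ((n : ℝ) / 2 - 1) * (Real.sin θ ^ ((n : ℝ) / 2 - 1) * φ θ)))
      (Icc 0 Real.pi) := by
    have h1 := hφ.2.1.continuousOn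
    rw [uIcc_of_le Real.pi_pos.le] at h1
    have h2 : Continuous fun θ => Real.sin θ ^ ((n : ℝ) / 2 - 1) :=
      Real.continuous_sin.rpow_const fun x => Or.inr ha
    exact ContinuousOn.mul (by fun_prop) (h2.continuousOn.mul h1)
  refine ((hc.integrableOn_Icc (μ := volume)).mono_set Ioo_subset_Icc_self).congr ?_
  filter_upwards [ae_restrict_mem measurableSet_Ioo] with θ hθ
  have hs := sin_pos_of_mem hθ
  have h1 : Real.sin θ ^ (n - 2) =
      Real.sin θ ^ ((n : ℝ) / 2 - 1) * Real.sin θ ^ ((n : ℝ) / 2 - 1) := by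
    rw [← Real.rpow_add hs, ← Real.rpow_natCast]
    congr 1
    rw [Nat.cast_sub hn]; push_cast; ring
  rw [ellWeight, h1]
  ring

/-- The bilinear form is definite: for `n = 2` a function of zero energy is constant and vanishes at
the ends, for `n ≥ 3` the zero order term is positive. -/
lemma MemV.eqOn_zero {n : ℕ} (hn : 2 ≤ n) (κ : ℝ) {d : ℝ → ℝ} (hd : MemV n d)
    (h0 : ∫ θ in (0 : ℝ)..Real.pi, ellIntegrand n κ d d θ = 0) : EqOn d 0 (Ioo 0 Real.pi) := by
  have hn2 : (0 : ℝ) ≤ (n : ℝ) - 2 := by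
    have : (2 : ℝ) ≤ n := by exact_mod_cast hn
    linarith
  have hnonneg : 0 ≤ᵐ[volume.restrict (Ioo 0 Real.pi)] ellIntegrand n κ d d := by
    filter_upwards [ae_restrict_mem measurableSet_Ioo] with θ hθ
    rw [ellIntegrand_eq hn κ d d hθ]
    simp only [Pi.zero_apply]
    refine mul_nonneg (Real.exp_pos _).le (add_nonneg (mul_self_nonneg _)
      (mul_nonneg (inv_nonneg.2 hn2) (mul_self_nonneg _)))
  rw [intervalIntegral.integral_of_le Real.pi_pos.le, integral_Ioc_eq_integral_Ioo,
    integral_eq_zero_iff_of_nonneg_ae hnonneg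
      (intervalIntegrable_iff_Ioo.1 (intervalIntegrable_ellIntegrand hn κ hd hd))] at h0
  have hz : ∀ᵐ θ ∂volume.restrict (Ioo 0 Real.pi),
      deriv d θ = 0 ∧ ((n : ℝ) - 2) * d θ = 0 := by
    filter_upwards [h0, ae_restrict_mem measurableSet_Ioo] with θ h hθ
    have hs := sin_pos_of_mem hθ
    have hw : 0 < ellWeight n κ θ := mul_pos (pow_pos hs _) (Real.exp_pos _)
    simp only [ellIntegrand, Pi.zero_apply, mul_eq_zero, hw.ne', false_or] at h
    have h1 : 0 ≤ ((n : ℝ) - 2) / Real.sin θ ^ 2 * d θ * d θ := by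
      rw [mul_assoc]; exact mul_nonneg (by positivity) (mul_self_nonneg _)
    have h2 := mul_self_nonneg (deriv d θ)
    have h3 : deriv d θ * deriv d θ = 0 := by linarith
    have h4 : ((n : ℝ) - 2) / Real.sin θ ^ 2 * d θ * d θ = 0 := by linarith
    refine ⟨by simpa using h3, ?_⟩
    simp only [mul_eq_zero, div_eq_zero_iff] at h4 ⊢
    rcases h4 with ((h4 | h4) | h4) | h4
    · exact Or.inl h4
    · exact absurd h4 (by positivity)
    · exact Or.inr h4
    · exact Or.inr h4
  have hhalf : Real.pi / 2 ∈ Ioo 0 Real.pi := ⟨by positivity, by linarith [Real.pi_pos]⟩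
  have hconst : ∀ θ ∈ Ioo 0 Real.pi, d θ = d (Real.pi / 2) := by
    intro θ hθ
    have hsub : uIcc (Real.pi / 2) θ ⊆ Ioo 0 Real.pi := ordConnected_Ioo.uIcc_subset hhalf hθ
    have hae : ∀ᵐ x, x ∈ uIcc (Real.pi / 2) θ → HasDerivAt d 0 x := by
      have e1 := (ae_restrict_iff' measurableSet_Ioo).1 hz
      have e2 := (ae_restrict_iff' measurableSet_Ioo).1 hd.ae_differentiableAt
      filter_upwards [e1, e2] with x h1 h2 hx
      rw [← (h1 (hsub hx)).1]
      exact (h2 (hsub hx)).1.hasDerivAt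
    obtain ⟨C, hC⟩ := (hd.absolutelyContinuous hhalf hθ).const_of_ae_hasDerivAt_zero hae
    rw [hC θ right_mem_uIcc, hC _ left_mem_uIcc]
  suffices d (Real.pi / 2) = 0 from fun θ hθ => (hconst θ hθ).trans this
  rcases hn.eq_or_lt with h2 | h2
  · subst h2
    have hc := hd.2.1.continuousOn
    rw [uIcc_of_le Real.pi_pos.le, ← closure_Ioo Real.pi_pos.ne] at hc
    have he : EqOn (fun θ => Real.sin θ ^ (((2 : ℕ) : ℝ) / 2 - 1) * d θ)
        (fun _ => d (Real.pi / 2)) (Ioo 0 Real.pi) := by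
      intro θ hθ
      simp [hconst θ hθ]
    have := he.of_subset_closure hc continuousOn_const subset_closure subset_rfl
      (show (0 : ℝ) ∈ closure (Ioo 0 Real.pi) by
        rw [closure_Ioo Real.pi_pos.ne]; exact ⟨le_rfl, Real.pi_pos.le⟩)
    exact this.symm.trans hd.2.2.2.1
  · have hpos : volume.restrict (Ioo 0 Real.pi) ≠ 0 := by
      rw [Ne, Measure.restrict_eq_zero]
      simp [Real.pi_pos]
    have : NeBot (ae (volume.restrict (Ioo 0 Real.pi))) := ae_neBot.2 hpos
    obtain ⟨θ, h1, h2'⟩ := (hz.and (ae_restrict_mem measurableSet_Ioo)).exists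
    have hn3 : (n : ℝ) - 2 ≠ 0 := by
      have : (2 : ℝ) < n := by exact_mod_cast h2
      linarith
    rw [← hconst θ h2']
    simpa [hn3] using h1.2

/-! ### Smooth solutions are variational solutions -/

/-- The function of the angle attached to `h`. -/
def angular (h : ℝ → ℝ) (θ : ℝ) : ℝ := Real.sin θ * h (Real.cos θ)

lemma contDiff_comp_cos {h : ℝ → ℝ} (hh : ContDiffOn ℝ ((⊤ : ℕ∞) : WithTop ℕ∞) h (Ioo (-3) 3)) :
    ContDiff ℝ ((⊤ : ℕ∞) : WithTop ℕ∞) fun θ => h (Real.cos θ) :=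
  hh.comp_contDiff Real.contDiff_cos fun θ =>
    ⟨by linarith [Real.neg_one_le_cos θ], by linarith [Real.cos_le_one θ]⟩

lemma contDiff_angular {h : ℝ → ℝ} (hh : ContDiffOn ℝ ((⊤ : ℕ∞) : WithTop ℕ∞) h (Ioo (-3) 3)) :
    ContDiff ℝ ((⊤ : ℕ∞) : WithTop ℕ∞) (angular h) :=
  Real.contDiff_sin.mul (contDiff_comp_cos hh)

lemma contDiffOn_deriv {h : ℝ → ℝ} (hh : ContDiffOn ℝ ((⊤ : ℕ∞) : WithTop ℕ∞) h (Ioo (-3) 3)) :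
    ContDiffOn ℝ ((⊤ : ℕ∞) : WithTop ℕ∞) (deriv h) (Ioo (-3) 3) :=
  ((contDiffOn_infty_iff_deriv_of_isOpen isOpen_Ioo).1 hh).2

lemma ContDiffOn.hasDerivAt_of_mem_Ioo {h : ℝ → ℝ} {a b μ : ℝ}
    (hh : ContDiffOn ℝ ((⊤ : ℕ∞) : WithTop ℕ∞) h (Ioo a b)) (hμ : μ ∈ Ioo a b) :
    HasDerivAt h (deriv h μ) μ :=
  ((hh.contDiffAt (isOpen_Ioo.mem_nhds hμ)).differentiableAt (by simp)).hasDerivAt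

lemma memV_angular {n : ℕ} (hn : 2 ≤ n) {h : ℝ → ℝ}
    (hh : ContDiffOn ℝ ((⊤ : ℕ∞) : WithTop ℕ∞) h (Ioo (-3) 3)) : MemV n (angular h) := by
  have hn2 : (2 : ℝ) ≤ n := by exact_mod_cast hn
  have ha : 0 ≤ (n : ℝ) / 2 - 1 := by linarith
  have hcos := contDiff_comp_cos hh
  have hu : (fun θ => Real.sin θ ^ ((n : ℝ) / 2 - 1) * angular h θ)
      = fun θ => Real.sin θ ^ ((n : ℝ) / 2) * h (Real.cos θ) := by
    ext θ
    by_cases hs : Real.sin θ = 0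
    · have : (n : ℝ) / 2 ≠ 0 := by positivity
      simp [angular, hs, Real.zero_rpow this]
    · rw [angular, ← mul_assoc, ← Real.rpow_add_one hs, sub_add_cancel]
  have hu1 : ContDiff ℝ 1 (fun θ => Real.sin θ ^ ((n : ℝ) / 2) * h (Real.cos θ)) := by
    refine ContDiff.mul ?_ (hcos.of_le (by simp))
    exact (Real.contDiff_rpow_const_of_le (n := 1) (by push_cast; linarith)).comp Real.contDiff_sin
  refine ⟨?_, ?_, ?_, ?_, ?_⟩
  · have hc : Continuous fun θ => ((n : ℝ) - 2) * Real.sin θ ^ ((n : ℝ) / 2 - 1)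
        * h (Real.cos θ) := by
      have h2 : Continuous fun θ => Real.sin θ ^ ((n : ℝ) / 2 - 1) :=
        Real.continuous_sin.rpow_const fun x => Or.inr ha
      exact (continuous_const.mul h2).mul hcos.continuous
    refine hc.continuousOn.memLp_Ioo.ae_eq ?_
    filter_upwards [ae_restrict_mem measurableSet_Ioo] with θ hθ
    have hs := sin_pos_of_mem hθ
    rw [angular, show (n : ℝ) / 2 - 1 = (n : ℝ) / 2 - 2 + 1 by ring, Real.rpow_add_one hs.ne']
    ring
  · rw [hu]; exact hu1.contDiffOn.absolutelyContinuousOnInterval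
  · rw [hu]; exact (hu1.continuous_deriv le_rfl).continuousOn.memLp_Ioo
  · simp [angular]
  · simp [angular]

lemma hasDerivAt_angular {h : ℝ → ℝ}
    (hh : ContDiffOn ℝ ((⊤ : ℕ∞) : WithTop ℕ∞) h (Ioo (-3) 3)) (θ : ℝ) :
    HasDerivAt (angular h)
      (Real.cos θ * h (Real.cos θ) - Real.sin θ ^ 2 * deriv h (Real.cos θ)) θ := by
  have hm : Real.cos θ ∈ Ioo (-3 : ℝ) 3 :=
    ⟨by linarith [Real.neg_one_le_cos θ], by linarith [Real.cos_le_one θ]⟩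
  have h1 := (Real.hasDerivAt_sin θ).mul
    ((hh.hasDerivAt_of_mem_Ioo hm).comp θ (Real.hasDerivAt_cos θ))
  refine h1.congr_deriv ?_
  simp only [Function.comp]
  ring

/-- In the variable `θ`, the equation for `h` reads
`(w g')' = w ((n - 2) (sin θ)⁻² g - c sin θ)`. -/
lemma hasDerivAt_weight_mul_deriv {n : ℕ} (hn : 2 ≤ n) {κ c : ℝ} {h : ℝ → ℝ}
    (hh : ContDiffOn ℝ ((⊤ : ℕ∞) : WithTop ℕ∞) h (Ioo (-3) 3))
    (hsol : ∀ μ ∈ Ioo (-1 : ℝ) 1, SolvesRadial n κ c h μ) {θ : ℝ} (hθ : θ ∈ Ioo 0 Real.pi) :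
    HasDerivAt (fun θ => ellWeight n κ θ * deriv (angular h) θ)
      (ellWeight n κ θ *
        (((n : ℝ) - 2) / Real.sin θ ^ 2 * angular h θ - c * Real.sin θ)) θ := by
  have hs := sin_pos_of_mem hθ
  have hm : Real.cos θ ∈ Ioo (-3 : ℝ) 3 :=
    ⟨by linarith [Real.neg_one_le_cos θ], by linarith [Real.cos_le_one θ]⟩
  have hm1 : Real.cos θ ∈ Ioo (-1 : ℝ) 1 := by
    have := Real.sin_sq_add_cos_sq θ
    constructor <;> nlinarith
  have hode := hsol _ hm1
  have hd : deriv (angular h) = fun θ =>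
      Real.cos θ * h (Real.cos θ) - Real.sin θ ^ 2 * deriv h (Real.cos θ) :=
    funext fun θ => (hasDerivAt_angular hh θ).deriv
  rw [hd]
  have hpow : HasDerivAt (fun θ => Real.sin θ ^ (n - 2))
      (((n : ℝ) - 2) * Real.sin θ ^ (n - 2) / Real.sin θ * Real.cos θ) θ := by
    refine ((Real.hasDerivAt_sin θ).pow (n - 2)).congr_deriv ?_
    rcases Nat.eq_zero_or_pos (n - 2) with h0 | h0
    · have : n = 2 := by omega
      subst this; simp
    · obtain ⟨m, hm⟩ : ∃ m, n - 2 = m + 1 := ⟨n - 3, by omega⟩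
      have : (n : ℝ) - 2 = m + 1 := by
        have : n = m + 3 := by omega
        rw [this]; push_cast; ring
      rw [this, hm]
      simp only [Nat.add_sub_cancel]
      push_cast
      field_simp
      ring
  have hexp : HasDerivAt (fun θ => Real.exp (κ * Real.cos θ))
      (Real.exp (κ * Real.cos θ) * (κ * -Real.sin θ)) θ :=
    ((Real.hasDerivAt_cos θ).const_mul κ).exp
  have hc := Real.hasDerivAt_cos θ
  have h0' := (hh.hasDerivAt_of_mem_Ioo hm).comp θ hc
  have h1' := ((contDiffOn_deriv hh).hasDerivAt_of_mem_Ioo hm).comp θ hc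
  have htot := (hpow.mul hexp).mul
    ((hc.mul h0').sub (((Real.hasDerivAt_sin θ).pow 2).mul h1'))
  refine htot.congr_deriv ?_
  simp only [Function.comp, Pi.mul_apply, Pi.sub_apply, Pi.pow_apply, ellWeight, angular]
  simp only [SolvesRadial] at hode
  have hcs : Real.cos θ ^ 2 = 1 - Real.sin θ ^ 2 := Real.cos_sq' θ
  field_simp
  push_cast
  linear_combination Real.sin θ ^ 2 * hode + (((n : ℝ) - 2) * h (Real.cos θ) +
    Real.sin θ ^ 2 * deriv (deriv h) (Real.cos θ)
    + κ * Real.sin θ ^ 2 * deriv h (Real.cos θ)) * hcs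

/-- Integration by parts: a smooth solution of the equation for `h` gives a variational solution.
The boundary terms vanish because elements of `V`, multiplied by `(sin θ) ^ (n / 2 - 1)`, do. -/
lemma integral_ellIntegrand_angular {n : ℕ} (hn : 2 ≤ n) {κ c : ℝ} {h : ℝ → ℝ}
    (hh : ContDiffOn ℝ ((⊤ : ℕ∞) : WithTop ℕ∞) h (Ioo (-3) 3))
    (hsol : ∀ μ ∈ Ioo (-1 : ℝ) 1, SolvesRadial n κ c h μ) {φ : ℝ → ℝ} (hφ : MemV n φ) :
    ∫ θ in (0 : ℝ)..Real.pi, ellIntegrand n κ (angular h) φ θ =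
      c * ∫ θ in (0 : ℝ)..Real.pi, ellWeight n κ θ * (Real.sin θ * φ θ) := by
  have hn2 : (2 : ℝ) ≤ n := by exact_mod_cast hn
  have ha : 0 ≤ (n : ℝ) / 2 - 1 := by linarith
  have hg := memV_angular hn hh
  have I1 := intervalIntegrable_ellIntegrand hn κ hg hφ
  have I2 := (hφ.intervalIntegrable_weight_mul hn κ).const_mul c
  rw [← intervalIntegral.integral_const_mul, ← sub_eq_zero, ← intervalIntegral.integral_sub I1 I2]
  set D : ℝ → ℝ := fun θ => ellIntegrand n κ (angular h) φ θ -
    c * (ellWeight n κ θ * (Real.sin θ * φ θ)) with hD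
  have ID : IntervalIntegrable D volume 0 Real.pi := I1.sub I2
  -- Inside `(0, π)`, `D` is the derivative of `P φ`; the continuous extension of `P φ` to `[0, π]`
  -- is `F`, which is zero at both ends.
  set P : ℝ → ℝ := fun θ => ellWeight n κ θ * deriv (angular h) θ with hP
  have hPs : ContDiff ℝ 1 P := by
    have h1 : ContDiff ℝ 1 (deriv (angular h)) :=
      ((contDiff_infty_iff_deriv.1 (contDiff_angular hh)).2).of_le (by simp)
    have h2 : ContDiff ℝ 1 (ellWeight n κ) :=
      (Real.contDiff_sin.pow _).mul ((contDiff_const.mul Real.contDiff_cos).exp)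
    exact h2.mul h1
  set F : ℝ → ℝ := fun θ => Real.sin θ ^ ((n : ℝ) / 2 - 1) * Real.exp (κ * Real.cos θ) *
    deriv (angular h) θ * (Real.sin θ ^ ((n : ℝ) / 2 - 1) * φ θ) with hF
  have hFc : ContinuousOn F (Icc 0 Real.pi) := by
    have h1 := hφ.2.1.continuousOn
    rw [uIcc_of_le Real.pi_pos.le] at h1
    have h2 : Continuous fun θ => Real.sin θ ^ ((n : ℝ) / 2 - 1) :=
      Real.continuous_sin.rpow_const fun x => Or.inr ha
    have h3 : Continuous (deriv (angular h)) :=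
      ((contDiff_infty_iff_deriv.1 (contDiff_angular hh)).2).continuous
    exact ContinuousOn.mul (by fun_prop) h1
  have hFP : ∀ θ ∈ Ioo 0 Real.pi, F θ = P θ * φ θ := by
    intro θ hθ
    have hs := sin_pos_of_mem hθ
    have h1 : Real.sin θ ^ (n - 2) =
        Real.sin θ ^ ((n : ℝ) / 2 - 1) * Real.sin θ ^ ((n : ℝ) / 2 - 1) := by
      rw [← Real.rpow_add hs, ← Real.rpow_natCast]
      congr 1
      rw [Nat.cast_sub hn]; push_cast; ring
    simp only [hF, hP, ellWeight, h1]
    ring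
  have hhalf : Real.pi / 2 ∈ Ioo 0 Real.pi := ⟨by positivity, by linarith [Real.pi_pos]⟩
  have hprim : ∀ θ ∈ Ioo 0 Real.pi,
      ∫ t in (Real.pi / 2)..θ, D t = F θ - F (Real.pi / 2) := by
    intro θ hθ
    have hsub : uIcc (Real.pi / 2) θ ⊆ Ioo 0 Real.pi := ordConnected_Ioo.uIcc_subset hhalf hθ
    rw [hFP θ hθ, hFP _ hhalf, ← AbsolutelyContinuousOnInterval.integral_deriv_mul_eq_sub
      hPs.contDiffOn.absolutelyContinuousOnInterval (hφ.absolutelyContinuous hhalf hθ)]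
    refine intervalIntegral.integral_congr fun t ht => ?_
    simp only [hD, ellIntegrand]
    rw [(hasDerivAt_weight_mul_deriv hn hh hsol (hsub ht)).deriv, hP]
    ring
  have hIc : ContinuousOn (fun θ => ∫ t in (Real.pi / 2)..θ, D t) (Icc 0 Real.pi) := by
    have := intervalIntegral.continuousOn_primitive_interval' ID
      (a := Real.pi / 2) (by rw [uIcc_of_le Real.pi_pos.le]; exact Ioo_subset_Icc_self hhalf)
    rwa [uIcc_of_le Real.pi_pos.le] at this
  have hext : EqOn (fun θ => ∫ t in (Real.pi / 2)..θ, D t) (fun θ => F θ - F (Real.pi / 2))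
      (Icc 0 Real.pi) := by
    have hcl : Icc 0 Real.pi ⊆ closure (Ioo 0 Real.pi) := by rw [closure_Ioo Real.pi_pos.ne]
    exact EqOn.of_subset_closure (fun θ hθ => hprim θ hθ) hIc (hFc.sub continuousOn_const)
      Ioo_subset_Icc_self hcl
  have e0 := hext (left_mem_Icc.2 Real.pi_pos.le)
  have e1 := hext (right_mem_Icc.2 Real.pi_pos.le)
  have F0 : F 0 = 0 := by
    have := hφ.2.2.2.1
    simp only [hF] at this ⊢
    rw [this, mul_zero]
  have F1 : F Real.pi = 0 := by
    have := hφ.2.2.2.2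
    simp only [hF] at this ⊢
    rw [this, mul_zero]
  simp only [F0, F1] at e0 e1
  have hs1 : IntervalIntegrable D volume 0 (Real.pi / 2) :=
    ID.mono_set (by
      rw [uIcc_of_le Real.pi_pos.le, uIcc_of_le hhalf.1.le]
      exact Icc_subset_Icc le_rfl hhalf.2.le)
  have hs2 : IntervalIntegrable D volume (Real.pi / 2) Real.pi :=
    ID.mono_set (by
      rw [uIcc_of_le Real.pi_pos.le, uIcc_of_le hhalf.2.le]
      exact Icc_subset_Icc hhalf.1.le le_rfl)
  rw [← intervalIntegral.integral_add_adjacent_intervals hs1 hs2, e1,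
    intervalIntegral.integral_symm, e0]
  ring

/-- The homogeneous equation for `h` has no nonzero solution that is smooth up to both ends. -/
lemma eq_zero_of_solvesRadial_zero {n : ℕ} (hn : 2 ≤ n) {κ : ℝ} {h : ℝ → ℝ}
    (hh : ContDiffOn ℝ ((⊤ : ℕ∞) : WithTop ℕ∞) h (Ioo (-3) 3))
    (hsol : ∀ μ ∈ Ioo (-1 : ℝ) 1, SolvesRadial n κ 0 h μ) : EqOn h 0 (Icc (-1) 1) := by
  have hV := memV_angular hn hh
  have h0 := hV.eqOn_zero hn κ (by rw [integral_ellIntegrand_angular hn hh hsol hV, zero_mul])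
  have h1 : EqOn h 0 (Ioo (-1) 1) := by
    intro μ hμ
    have hm : Real.arccos μ ∈ Ioo 0 Real.pi :=
      ⟨Real.arccos_pos.2 hμ.2, Real.arccos_lt_pi.2 hμ.1⟩
    have := h0 hm
    rw [angular, Real.cos_arccos hμ.1.le hμ.2.le] at this
    simpa [(sin_pos_of_mem hm).ne'] using this
  refine h1.of_subset_closure (hh.continuousOn.mono ?_) continuousOn_const Ioo_subset_Icc_self
    (by rw [closure_Ioo (by norm_num)])
  exact Icc_subset_Ioo (by norm_num) (by norm_num)

/-! ### Existence of a solution smooth up to both ends -/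

lemma SolvesRadial.congr {n : ℕ} {κ c : ℝ} {u v : ℝ → ℝ} {μ : ℝ} (h : SolvesRadial n κ c u μ)
    (huv : u =ᶠ[𝓝 μ] v) : SolvesRadial n κ c v μ := by
  simp only [SolvesRadial] at h ⊢
  rwa [← huv.deriv.deriv_eq, ← huv.deriv_eq, ← huv.eq_of_nhds]

lemma SolvesRadial.linearCombination {n : ℕ} {κ c c' : ℝ} {u v : ℝ → ℝ} {a b : ℝ}
    (hu : ContDiffOn ℝ ((⊤ : ℕ∞) : WithTop ℕ∞) u (Ioo a b))
    (hv : ContDiffOn ℝ ((⊤ : ℕ∞) : WithTop ℕ∞) v (Ioo a b)) {μ : ℝ} (hμ : μ ∈ Ioo a b)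
    (h : SolvesRadial n κ c u μ) (h' : SolvesRadial n κ c' v μ) (α β : ℝ) :
    SolvesRadial n κ (α * c + β * c') (fun x => α * u x + β * v x) μ := by
  have d1 : ∀ y ∈ Ioo a b,
      deriv (fun x => α * u x + β * v x) y = α * deriv u y + β * deriv v y := fun y hy =>
    (((hu.hasDerivAt_of_mem_Ioo hy).const_mul α).add
      ((hv.hasDerivAt_of_mem_Ioo hy).const_mul β)).deriv
  have hu' := ((contDiffOn_infty_iff_deriv_of_isOpen isOpen_Ioo).1 hu).2
  have hv' := ((contDiffOn_infty_iff_deriv_of_isOpen isOpen_Ioo).1 hv).2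
  have d2 : deriv (deriv fun x => α * u x + β * v x) μ
      = α * deriv (deriv u) μ + β * deriv (deriv v) μ := by
    rw [(eventuallyEq_of_mem (isOpen_Ioo.mem_nhds hμ) d1).deriv_eq]
    exact (((hu'.hasDerivAt_of_mem_Ioo hμ).const_mul α).add
      ((hv'.hasDerivAt_of_mem_Ioo hμ).const_mul β)).deriv
  simp only [SolvesRadial] at h h' ⊢
  rw [d1 μ hμ, d2]
  linear_combination α * h + β * h'

/-- The second order equation for `h` is regular inside `(-1, 1)`, where a solution is determined
by its Cauchy data. -/
lemma SolvesRadial.eqOn {n : ℕ} {κ c : ℝ} {u v : ℝ → ℝ}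
    (hu : ContDiffOn ℝ ((⊤ : ℕ∞) : WithTop ℕ∞) u (Ioo (-1) 1))
    (hv : ContDiffOn ℝ ((⊤ : ℕ∞) : WithTop ℕ∞) v (Ioo (-1) 1))
    (su : ∀ μ ∈ Ioo (-1 : ℝ) 1, SolvesRadial n κ c u μ)
    (sv : ∀ μ ∈ Ioo (-1 : ℝ) 1, SolvesRadial n κ c v μ)
    (h0 : u 0 = v 0) (h1 : deriv u 0 = deriv v 0) : EqOn u v (Ioo (-1) 1) := by
  intro μ hμ
  obtain ⟨r, hr, hr1⟩ := exists_between (abs_lt.2 hμ)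
  have hr0 : 0 < r := (abs_nonneg μ).trans_lt hr
  have hsub : Ioo (-r) r ⊆ Ioo (-1) 1 := Ioo_subset_Ioo (by linarith) hr1.le
  -- The equation as a first order system, which is Lipschitz on `(-r, r)` because `r < 1`.
  set F : ℝ → ℝ × ℝ → ℝ × ℝ := fun t y => (y.2, ((n + 1) * t * y.2 + (n - 1) * y.1
    - κ * (1 - t ^ 2) * y.2 + κ * t * y.1 - c) / (1 - t ^ 2)) with hF
  have hpos : ∀ t ∈ Ioo (-r) r, 1 - r ^ 2 ≤ 1 - t ^ 2 := fun t ht => by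
    nlinarith [ht.1, ht.2]
  have hR : 0 < 1 - r ^ 2 := by nlinarith
  set K : ℝ := 1 + ((n + 1) + |(n : ℝ) - 1| + |κ| + |κ|) / (1 - r ^ 2) with hK
  have hn0 : (0 : ℝ) ≤ n := by positivity
  have hK0 : 0 ≤ K := by positivity
  have hlip : ∀ t ∈ Ioo (-r) r, LipschitzOnWith K.toNNReal (F t) univ := by
    intro t ht
    refine LipschitzOnWith.of_dist_le_mul fun y _ z _ => ?_
    rw [Real.coe_toNNReal _ hK0, Prod.dist_eq]
    have e1 : dist y.1 z.1 ≤ dist y z := le_max_left _ _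
    have e2 : dist y.2 z.2 ≤ dist y z := le_max_right _ _
    have hd : 0 ≤ dist y z := dist_nonneg
    have hpt := hpos t ht
    have htpos : 0 < 1 - t ^ 2 := hR.trans_le hpt
    have ht1 : |t| ≤ 1 := (abs_lt.2 ht).le.trans hr1.le
    have ht2 : |1 - t ^ 2| ≤ 1 := by rw [abs_of_pos htpos]; nlinarith
    refine max_le ?_ ?_
    · simp only [hF]
      calc dist y.2 z.2 ≤ 1 * dist y z := by simpa using e2
        _ ≤ K * dist y z := by
          gcongr
          rw [hK]
          have : 0 ≤ ((n + 1) + |(n : ℝ) - 1| + |κ| + |κ|) / (1 - r ^ 2) := by positivity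
          linarith
    · simp only [hF]
      rw [Real.dist_eq] at e1 e2 ⊢
      rw [← sub_div, abs_div, abs_of_pos htpos]
      have hnum : |(n + 1) * t * y.2 + (n - 1) * y.1 - κ * (1 - t ^ 2) * y.2 + κ * t * y.1 - c -
          ((n + 1) * t * z.2 + (n - 1) * z.1 - κ * (1 - t ^ 2) * z.2 + κ * t * z.1 - c)|
          ≤ ((n + 1) + |(n : ℝ) - 1| + |κ| + |κ|) * dist y z := by
        have : (n + 1) * t * y.2 + (n - 1) * y.1 - κ * (1 - t ^ 2) * y.2 + κ * t * y.1 - c -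
          ((n + 1) * t * z.2 + (n - 1) * z.1 - κ * (1 - t ^ 2) * z.2 + κ * t * z.1 - c)
          = (n + 1) * t * (y.2 - z.2) + (n - 1) * (y.1 - z.1)
            + -(κ * (1 - t ^ 2) * (y.2 - z.2)) + κ * t * (y.1 - z.1) := by ring
        rw [this]
        refine (abs_add_le _ _).trans ?_
        refine (add_le_add_left ((abs_add_le _ _).trans
          (add_le_add_left (abs_add_le _ _) _)) _).trans ?_
        rw [abs_neg]
        simp only [abs_mul]
        rw [abs_of_nonneg (by positivity : (0 : ℝ) ≤ (n : ℝ) + 1)]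
        calc _ ≤ ((n : ℝ) + 1) * 1 * dist y z + |(n : ℝ) - 1| * dist y z
              + |κ| * 1 * dist y z + |κ| * 1 * dist y z := by gcongr
          _ = _ := by ring
      calc _ ≤ ((n + 1) + |(n : ℝ) - 1| + |κ| + |κ|) * dist y z / (1 - r ^ 2) := by gcongr
        _ ≤ K * dist y z := by
          rw [hK, mul_div_right_comm]
          exact mul_le_mul_of_nonneg_right (le_add_of_nonneg_left zero_le_one) hd
  have hsol : ∀ w : ℝ → ℝ, ContDiffOn ℝ ((⊤ : ℕ∞) : WithTop ℕ∞) w (Ioo (-1) 1) →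
      (∀ μ ∈ Ioo (-1 : ℝ) 1, SolvesRadial n κ c w μ) → ∀ t ∈ Ioo (-r) r,
      HasDerivAt (fun t => (w t, deriv w t)) (F t (w t, deriv w t)) t ∧
        (w t, deriv w t) ∈ (univ : Set (ℝ × ℝ)) := by
    intro w hw sw t ht
    refine ⟨?_, mem_univ _⟩
    have hw' := ((contDiffOn_infty_iff_deriv_of_isOpen isOpen_Ioo).1 hw).2
    refine ((hw.hasDerivAt_of_mem_Ioo (hsub ht)).prodMk
      (hw'.hasDerivAt_of_mem_Ioo (hsub ht))).congr_deriv ?_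
    have htpos : 1 - t ^ 2 ≠ 0 := (hR.trans_le (hpos t ht)).ne'
    have := sw t (hsub ht)
    simp only [SolvesRadial] at this
    simp only [hF, Prod.mk.injEq, true_and]
    rw [eq_div_iff htpos]
    linear_combination this
  have := ODE_solution_unique_of_mem_Ioo hlip (t₀ := 0) ⟨by linarith, hr0⟩
    (hsol u hu su) (hsol v hv sv) (by simp [h0, h1]) (abs_lt.1 hr)
  exact (Prod.mk.inj this).1

/-- The solution of the equation for `h` that is regular at `μ = 1`, obtained by the symmetry
`(μ, κ) ↦ (-μ, -κ)`. -/
def rightSolution (n : ℕ) (κ c s μ : ℝ) : ℝ := leftSolution n (-κ) c s (-μ)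

lemma contDiffOn_rightSolution (n : ℕ) (κ c s : ℝ) (hn : 1 ≤ n) :
    ContDiffOn ℝ ((⊤ : ℕ∞) : WithTop ℕ∞) (rightSolution n κ c s) (Ioo (-1) 3) :=
  (contDiffOn_leftSolution n (-κ) c s hn).comp contDiff_neg.contDiffOn
    fun μ hμ => ⟨by linarith [hμ.2], by linarith [hμ.1]⟩

lemma solvesRadial_rightSolution (n : ℕ) (κ c s : ℝ) (hn : 1 ≤ n) {μ : ℝ}
    (hμ : μ ∈ Ioo (-1 : ℝ) 3) : SolvesRadial n κ c (rightSolution n κ c s) μ := by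
  have hμ' : -μ ∈ Ioo (-3 : ℝ) 1 := ⟨by linarith [hμ.2], by linarith [hμ.1]⟩
  have h := solvesRadial_leftSolution n (-κ) c s hn hμ'
  have d1 : deriv (rightSolution n κ c s) = fun t => -deriv (leftSolution n (-κ) c s) (-t) :=
    funext fun t => deriv_comp_neg (leftSolution n (-κ) c s) t
  have d2 : deriv (deriv (rightSolution n κ c s)) μ
      = deriv (deriv (leftSolution n (-κ) c s)) (-μ) := by
    rw [d1]
    simp only [deriv.fun_neg, deriv_comp_neg, neg_neg]
  simp only [SolvesRadial] at h ⊢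
  rw [d2, d1, rightSolution]
  linear_combination h

/-- Two solutions, regular at one end each, that have the same Cauchy data at `0` are the
restrictions of a solution that is smooth up to both ends. -/
lemma exists_glue {n : ℕ} {κ c : ℝ} {u v : ℝ → ℝ}
    (hu : ContDiffOn ℝ ((⊤ : ℕ∞) : WithTop ℕ∞) u (Ioo (-3) 1))
    (hv : ContDiffOn ℝ ((⊤ : ℕ∞) : WithTop ℕ∞) v (Ioo (-1) 3))
    (su : ∀ μ ∈ Ioo (-3 : ℝ) 1, SolvesRadial n κ c u μ)
    (sv : ∀ μ ∈ Ioo (-1 : ℝ) 3, SolvesRadial n κ c v μ)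
    (h0 : u 0 = v 0) (h1 : deriv u 0 = deriv v 0) :
    ∃ h : ℝ → ℝ, ContDiffOn ℝ ((⊤ : ℕ∞) : WithTop ℕ∞) h (Ioo (-3) 3) ∧
      EqOn h u (Ioo (-3) 1) ∧ EqOn h v (Ioo (-1) 3) ∧
      ∀ μ ∈ Ioo (-1 : ℝ) 1, SolvesRadial n κ c h μ := by
  have hl : Ioo (-1 : ℝ) 1 ⊆ Ioo (-3) 1 := Ioo_subset_Ioo (by norm_num) le_rfl
  have hr : Ioo (-1 : ℝ) 1 ⊆ Ioo (-1) 3 := Ioo_subset_Ioo le_rfl (by norm_num)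
  have huv : EqOn u v (Ioo (-1) 1) := SolvesRadial.eqOn (hu.mono hl) (hv.mono hr)
    (fun μ hμ => su μ (hl hμ)) (fun μ hμ => sv μ (hr hμ)) h0 h1
  set h : ℝ → ℝ := fun μ => if μ < 0 then u μ else v μ with hh
  have e1 : EqOn h u (Ioo (-3) 1) := by
    intro μ hμ
    by_cases hm : μ < 0
    · simp [hh, hm]
    · simp only [hh, hm, if_false]
      exact (huv ⟨by linarith, hμ.2⟩).symm
  have e2 : EqOn h v (Ioo (-1) 3) := by
    intro μ hμ
    by_cases hm : μ < 0
    · simp only [hh, hm, if_true]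
      exact huv ⟨hμ.1, by linarith⟩
    · simp [hh, hm]
  refine ⟨h, ?_, e1, e2, ?_⟩
  · have hun : Ioo (-3 : ℝ) 3 = Ioo (-3) 1 ∪ Ioo (-1) 3 := by
      rw [Ioo_union_Ioo (by norm_num) (by norm_num)]; norm_num
    rw [hun]
    exact (hu.congr e1).union_of_isOpen (hv.congr e2) isOpen_Ioo isOpen_Ioo
  · intro μ hμ
    exact (su μ (hl hμ)).congr (eventuallyEq_of_mem (isOpen_Ioo.mem_nhds (hl hμ)) e1).symm

/-- Shooting from both ends: the Cauchy data at `0` of the two homogeneous solutions that are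
regular at one end are linearly independent, because the homogeneous problem has no nonzero solution
that is regular at both ends; so two inhomogeneous solutions can be matched at `0`. -/
lemma exists_solvesRadial {n : ℕ} (hn : 2 ≤ n) (κ : ℝ) :
    ∃ h : ℝ → ℝ, ContDiffOn ℝ ((⊤ : ℕ∞) : WithTop ℕ∞) h (Ioo (-3) 3) ∧
      ∀ μ ∈ Ioo (-1 : ℝ) 1, SolvesRadial n κ 1 h μ := by
  have hn1 : 1 ≤ n := by omega
  -- `y` and `z` solve the homogeneous equation, `p` and `q` the inhomogeneous one.
  set y := leftSolution n κ 0 1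
  set z := rightSolution n κ 0 1
  set p := leftSolution n κ 1 0
  set q := rightSolution n κ 1 0
  have cy := contDiffOn_leftSolution n κ 0 1 hn1
  have cz := contDiffOn_rightSolution n κ 0 1 hn1
  have cp := contDiffOn_leftSolution n κ 1 0 hn1
  have cq := contDiffOn_rightSolution n κ 1 0 hn1
  have m1 : (0 : ℝ) ∈ Ioo (-3 : ℝ) 1 := by norm_num
  have m2 : (0 : ℝ) ∈ Ioo (-1 : ℝ) 3 := by norm_num
  have dy := cy.hasDerivAt_of_mem_Ioo m1
  have dz := cz.hasDerivAt_of_mem_Ioo m2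
  have dp := cp.hasDerivAt_of_mem_Ioo m1
  have dq := cq.hasDerivAt_of_mem_Ioo m2
  have sy := fun μ hμ => solvesRadial_leftSolution n κ 0 1 hn1 (μ := μ) hμ
  have sz := fun μ hμ => solvesRadial_rightSolution n κ 0 1 hn1 (μ := μ) hμ
  have sp := fun μ hμ => solvesRadial_leftSolution n κ 1 0 hn1 (μ := μ) hμ
  have sq := fun μ hμ => solvesRadial_rightSolution n κ 1 0 hn1 (μ := μ) hμ
  have hindep : ∀ α β : ℝ, α * y 0 = β * z 0 → α * deriv y 0 = β * deriv z 0 →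
      α = 0 ∧ β = 0 := by
    intro α β e0 e1
    obtain ⟨h, hh, eu, ev, hs⟩ := exists_glue (n := n) (κ := κ) (c := 0)
      (u := fun x => α * y x + 0 * y x) (v := fun x => β * z x + 0 * z x)
      ((contDiffOn_const.mul cy).add (contDiffOn_const.mul cy))
      ((contDiffOn_const.mul cz).add (contDiffOn_const.mul cz))
      (fun μ hμ => by
        simpa using SolvesRadial.linearCombination cy cy hμ (sy μ hμ) (sy μ hμ) α 0)
      (fun μ hμ => by
        simpa using SolvesRadial.linearCombination cz cz hμ (sz μ hμ) (sz μ hμ) β 0)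
      (by simpa using e0)
      (by
        refine ((dy.const_mul α).add (dy.const_mul 0)).deriv.trans
          (Eq.trans ?_ ((dz.const_mul β).add (dz.const_mul 0)).deriv.symm)
        rw [zero_mul, zero_mul, add_zero, add_zero]
        exact e1)
    have h0 := eq_zero_of_solvesRadial_zero hn hh hs
    have a1 := h0 (left_mem_Icc.2 (by norm_num : (-1 : ℝ) ≤ 1))
    have a2 := h0 (right_mem_Icc.2 (by norm_num : (-1 : ℝ) ≤ 1))
    rw [eu ⟨by norm_num, by norm_num⟩] at a1
    rw [ev ⟨by norm_num, by norm_num⟩] at a2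
    have b1 : y (-1) = 1 := leftSolution_neg_one n κ 0 1
    have b2 : z 1 = 1 := leftSolution_neg_one n (-κ) 0 1
    simp only [b1, b2] at a1 a2
    exact ⟨by simpa using a1, by simpa using a2⟩
  -- If the determinant vanished, `(z 0, y 0)` and `(z' 0, y' 0)` would be relations between the
  -- Cauchy data.
  have hdet : y 0 * deriv z 0 - deriv y 0 * z 0 ≠ 0 := by
    intro hdet
    obtain ⟨h1, h2⟩ := hindep (z 0) (y 0) (by ring) (by linarith)
    obtain ⟨h3, h4⟩ := hindep (deriv z 0) (deriv y 0) (by linarith) (by ring)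
    have := hindep 1 0 (by simp [h2]) (by simp [h4])
    exact one_ne_zero this.1
  set Δ := y 0 * deriv z 0 - deriv y 0 * z 0 with hΔ
  -- Cramer's rule for `p + α y = q + β z` to first order at `0`.
  set α := ((q 0 - p 0) * deriv z 0 - (deriv q 0 - deriv p 0) * z 0) / Δ with hα
  set β := ((q 0 - p 0) * deriv y 0 - (deriv q 0 - deriv p 0) * y 0) / Δ with hβ
  obtain ⟨h, hh, -, -, hs⟩ := exists_glue (n := n) (κ := κ) (c := 1)
      (u := fun x => 1 * p x + α * y x) (v := fun x => 1 * q x + β * z x)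
      ((contDiffOn_const.mul cp).add (contDiffOn_const.mul cy))
      ((contDiffOn_const.mul cq).add (contDiffOn_const.mul cz))
      (fun μ hμ => by
        simpa using SolvesRadial.linearCombination cp cy hμ (sp μ hμ) (sy μ hμ) 1 α)
      (fun μ hμ => by
        simpa using SolvesRadial.linearCombination cq cz hμ (sq μ hμ) (sz μ hμ) 1 β)
      (by rw [hα, hβ]; field_simp; rw [hΔ]; ring)
      (by
        refine ((dp.const_mul 1).add (dy.const_mul α)).deriv.trans
          (Eq.trans ?_ ((dq.const_mul 1).add (dz.const_mul β)).deriv.symm)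
        change 1 * deriv p 0 + α * deriv y 0 = 1 * deriv q 0 + β * deriv z 0
        rw [hα, hβ]
        field_simp
        rw [hΔ]
        ring)
  exact ⟨h, hh, hs⟩

/-! ### Positivity and the explicit formulas in dimension two -/

/-- The maximum principle: at an interior minimum with `g ≤ 0` the equation would give `g'' < 0`. -/
lemma angular_pos {n : ℕ} (hn : 2 ≤ n) {κ : ℝ} {h : ℝ → ℝ}
    (hh : ContDiffOn ℝ ((⊤ : ℕ∞) : WithTop ℕ∞) h (Ioo (-3) 3))
    (hsol : ∀ μ ∈ Ioo (-1 : ℝ) 1, SolvesRadial n κ 1 h μ) {θ : ℝ} (hθ : θ ∈ Ioo 0 Real.pi) :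
    0 < angular h θ := by
  have hn2 : (2 : ℝ) ≤ n := by exact_mod_cast hn
  set g := angular h with hg
  have hgs : ContDiff ℝ ((⊤ : ℕ∞) : WithTop ℕ∞) g := contDiff_angular hh
  have hno : ∀ x ∈ Ioo 0 Real.pi, IsMinOn g (Icc 0 Real.pi) x → ¬ g x ≤ 0 := by
    intro x hx hmin hx0
    have hs := sin_pos_of_mem hx
    have hloc : IsLocalMin g x := hmin.isLocalMin (Icc_mem_nhds hx.1 hx.2)
    have hg' : deriv g x = 0 := hloc.deriv_eq_zero
    have hw : 0 < ellWeight n κ x := mul_pos (pow_pos hs _) (Real.exp_pos _)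
    have hwd : DifferentiableAt ℝ (ellWeight n κ) x := by
      unfold ellWeight; fun_prop
    have hdd : DifferentiableAt ℝ (deriv g) x :=
      ((contDiff_infty_iff_deriv.1 hgs).2).differentiable (by simp) x
    have e1 := (hwd.hasDerivAt.mul hdd.hasDerivAt).unique
      (hasDerivAt_weight_mul_deriv hn hh hsol hx)
    rw [hg', mul_zero, zero_add] at e1
    have e2 := mul_left_cancel₀ hw.ne' e1
    have hneg : deriv (deriv g) x < 0 := by
      rw [e2]
      have : ((n : ℝ) - 2) / Real.sin x ^ 2 * angular h x ≤ 0 :=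
        mul_nonpos_of_nonneg_of_nonpos (div_nonneg (by linarith) (by positivity)) hx0
      linarith
    have hmax := isLocalMax_of_deriv_deriv_neg hneg hg' hgs.continuous.continuousAt
    have hconst : g =ᶠ[𝓝 x] fun _ => g x := by
      filter_upwards [hloc, hmax] with t h1 h2 using le_antisymm h2 h1
    rw [hconst.deriv.deriv_eq] at hneg
    simp at hneg
  by_contra hle
  rw [not_lt] at hle
  obtain ⟨x, hx, hmin⟩ := isCompact_Icc.exists_isMinOn (nonempty_Icc.2 Real.pi_pos.le)
    (hgs.continuous.continuousOn (s := Icc 0 Real.pi))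
  have hxθ : g x ≤ g θ := hmin (Ioo_subset_Icc_self hθ)
  by_cases hx0 : x ∈ Ioo 0 Real.pi
  · exact hno x hx0 hmin (hxθ.trans hle)
  · -- The minimum is attained at an end, hence equal to `0`, hence attained at `θ` as well.
    have hgx : g x = 0 := by
      have : x = 0 ∨ x = Real.pi := by
        by_contra hne
        rw [not_or] at hne
        exact hx0 ⟨lt_of_le_of_ne hx.1 (Ne.symm hne.1), lt_of_le_of_ne hx.2 hne.2⟩
      rcases this with rfl | rfl <;> simp [hg, angular]
    refine hno θ hθ (fun t ht => ?_) hle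
    have : g x ≤ g t := hmin ht
    simp only [mem_ofPred_eq]
    linarith

/-- In dimension two, `w d'` is constant for the difference `d` of two solutions. -/
lemma eqOn_zero_of_hasDerivAt_weight {κ : ℝ} {d d' : ℝ → ℝ} (hc : ContinuousOn d (Icc 0 Real.pi))
    (hd : ∀ θ ∈ Ioo 0 Real.pi, HasDerivAt d (d' θ) θ)
    (hw : ∀ θ ∈ Ioo 0 Real.pi, HasDerivAt (fun θ => Real.exp (κ * Real.cos θ) * d' θ) 0 θ)
    (h0 : d 0 = 0) (h1 : d Real.pi = 0) : EqOn d 0 (Icc 0 Real.pi) := by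
  obtain ⟨ξ, hξ, hξ0⟩ := exists_hasDerivAt_eq_zero Real.pi_pos hc (h0.trans h1.symm) hd
  have hz : ∀ θ ∈ Ioo 0 Real.pi, d' θ = 0 := by
    intro θ hθ
    have := isOpen_Ioo.is_const_of_deriv_eq_zero (convex_Ioo 0 Real.pi).isPreconnected
      (fun x hx => (hw x hx).differentiableAt.differentiableWithinAt)
      (fun x hx => (hw x hx).deriv) hθ hξ
    simpa [hξ0] using this
  have hcl : Icc 0 Real.pi ⊆ closure (Ioo 0 Real.pi) := by rw [closure_Ioo Real.pi_pos.ne]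
  have hconst : EqOn d (fun _ => d ξ) (Icc 0 Real.pi) := by
    refine EqOn.of_subset_closure (fun θ hθ => ?_) hc continuousOn_const Ioo_subset_Icc_self hcl
    exact isOpen_Ioo.is_const_of_deriv_eq_zero (convex_Ioo 0 Real.pi).isPreconnected
      (fun x hx => (hd x hx).differentiableAt.differentiableWithinAt)
      (fun x hx => (hd x hx).deriv.trans (hz x hx)) hθ hξ
  intro θ hθ
  rw [hconst hθ, ← hconst (left_mem_Icc.2 Real.pi_pos.le), h0]
  rfl

lemma angular_eq_of_two_of_ne_zero {κ : ℝ} (hκ : κ ≠ 0) {h : ℝ → ℝ}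
    (hh : ContDiffOn ℝ ((⊤ : ℕ∞) : WithTop ℕ∞) h (Ioo (-3) 3))
    (hsol : ∀ μ ∈ Ioo (-1 : ℝ) 1, SolvesRadial 2 κ 1 h μ) {θ : ℝ} (hθ : θ ∈ Icc 0 Real.pi) :
    angular h θ = θ / κ - Real.pi / κ *
      ((∫ φ in (0 : ℝ)..θ, Real.exp (-κ * Real.cos φ)) /
        ∫ φ in (0 : ℝ)..Real.pi, Real.exp (-κ * Real.cos φ)) := by
  set E : ℝ → ℝ := fun θ => ∫ φ in (0 : ℝ)..θ, Real.exp (-κ * Real.cos φ) with hE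
  have hcont : Continuous fun φ => Real.exp (-κ * Real.cos φ) := by fun_prop
  have hEd : ∀ θ, HasDerivAt E (Real.exp (-κ * Real.cos θ)) θ := fun θ =>
    hcont.integral_hasStrictDerivAt 0 θ |>.hasDerivAt
  have hEpos : 0 < E Real.pi := intervalIntegral.intervalIntegral_pos_of_pos
    (hcont.intervalIntegrable _ _) (fun _ => Real.exp_pos _) Real.pi_pos
  have hgs := contDiff_angular hh
  have hgd : ∀ θ, HasDerivAt (angular h) (deriv (angular h) θ) θ := fun θ =>
    (hgs.differentiable (by simp) θ).hasDerivAt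
  have hd : ∀ θ, HasDerivAt (fun θ => angular h θ - (θ / κ - Real.pi / κ * (E θ / E Real.pi)))
      (deriv (angular h) θ - (1 / κ - Real.pi / κ * (Real.exp (-κ * Real.cos θ) / E Real.pi))) θ :=
    fun θ => (hgd θ).sub (((hasDerivAt_id θ).div_const κ).sub
      (((hEd θ).div_const _).const_mul _))
  have hz := eqOn_zero_of_hasDerivAt_weight (κ := κ)
    (d := fun θ => angular h θ - (θ / κ - Real.pi / κ * (E θ / E Real.pi)))
    (fun θ _ => (hd θ).continuousAt.continuousWithinAt) (fun θ _ => hd θ) (fun θ hθ => ?_)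
    (by simp [angular, hE]) (by simp [angular, hEpos.ne']) hθ
  · exact sub_eq_zero.1 hz
  · have h1 := hasDerivAt_weight_mul_deriv le_rfl hh hsol hθ
    have h2 : HasDerivAt (fun θ => Real.exp (κ * Real.cos θ) / κ)
        (Real.exp (κ * Real.cos θ) * (κ * -Real.sin θ) / κ) θ :=
      (((Real.hasDerivAt_cos θ).const_mul κ).exp).div_const κ
    have h3 := (h1.sub h2).add_const (Real.pi / κ / E Real.pi)
    convert! h3 using 1
    · ext t
      have : Real.exp (-κ * Real.cos t) = (Real.exp (κ * Real.cos t))⁻¹ := by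
        rw [← Real.exp_neg]; congr 1; ring
      have hne := (Real.exp_pos (κ * Real.cos t)).ne'
      simp only [ellWeight, this, Pi.sub_apply]
      field_simp
      ring
    · simp only [ellWeight]
      field_simp
      norm_num

lemma angular_eq_sin_of_two {h : ℝ → ℝ}
    (hh : ContDiffOn ℝ ((⊤ : ℕ∞) : WithTop ℕ∞) h (Ioo (-3) 3))
    (hsol : ∀ μ ∈ Ioo (-1 : ℝ) 1, SolvesRadial 2 0 1 h μ) {θ : ℝ} (hθ : θ ∈ Icc 0 Real.pi) :
    angular h θ = Real.sin θ := by
  have hgs := contDiff_angular hh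
  have hd : ∀ θ, HasDerivAt (fun θ => angular h θ - Real.sin θ)
      (deriv (angular h) θ - Real.cos θ) θ := fun θ =>
    (hgs.differentiable (by simp) θ).hasDerivAt.sub (Real.hasDerivAt_sin θ)
  have hz := eqOn_zero_of_hasDerivAt_weight (κ := 0) (d := fun θ => angular h θ - Real.sin θ)
    (fun θ _ => (hd θ).continuousAt.continuousWithinAt) (fun θ _ => hd θ) (fun θ hθ => ?_)
    (by simp [angular]) (by simp [angular]) hθ
  · exact sub_eq_zero.1 hz
  · have h1 := (hasDerivAt_weight_mul_deriv le_rfl hh hsol hθ).sub (Real.hasDerivAt_cos θ)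
    convert! h1 using 1
    · ext t
      simp [ellWeight]
    · simp [ellWeight]

/-! ### Calculus on the sphere -/

/-- Maps of class `C^∞` on the unit sphere, with values in a normed space. -/
def SphereSmooth {n : ℕ} {F : Type*} [NormedAddCommGroup F] [NormedSpace ℝ F]
    (X : Sph n → F) : Prop :=
  ContDiffOn ℝ ((⊤ : ℕ∞) : WithTop ℕ∞) (sphExt X) {0}ᶜ

section Calculus

variable {n : ℕ}

lemma Sph.norm_coe (ω : Sph n) : ‖(ω : Euc n)‖ = 1 := norm_eq_of_mem_sphere ω

lemma Sph.coe_ne_zero (ω : Sph n) : (ω : Euc n) ≠ 0 := by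
  intro h
  have := ω.norm_coe
  simp [h] at this

lemma Sph.inner_self (ω : Sph n) : inner ℝ (ω : Euc n) (ω : Euc n) = 1 := by
  rw [real_inner_self_eq_norm_sq, ω.norm_coe, one_pow]

lemma Sph.abs_inner_le (ω η : Sph n) : |inner ℝ (ω : Euc n) (η : Euc n)| ≤ 1 := by
  simpa [ω.norm_coe, η.norm_coe] using abs_real_inner_le_norm (ω : Euc n) (η : Euc n)

/-- The radial projection of a nonzero vector to the sphere. -/
def radialProj (x : Euc n) (hx : x ≠ 0) : Sph n := ⟨‖x‖⁻¹ • x, by simp [norm_smul, hx]⟩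

lemma sphExt_of_ne {G : Type*} [Zero G] {X : Sph n → G} {x : Euc n} (hx : x ≠ 0) :
    sphExt X x = X (radialProj x hx) := by
  simp [sphExt, hx, radialProj]

lemma radialProj_coe (ω : Sph n) : radialProj (ω : Euc n) ω.coe_ne_zero = ω := by
  ext1
  simp [radialProj, ω.norm_coe]

lemma sphExt_coe {G : Type*} [Zero G] (X : Sph n → G) (ω : Sph n) : sphExt X (ω : Euc n) = X ω := by
  rw [sphExt_of_ne ω.coe_ne_zero, radialProj_coe]

lemma sphExt_smul {G : Type*} [Zero G] {X : Sph n → G} {c : ℝ} (hc : 0 < c) (x : Euc n) :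
    sphExt X (c • x) = sphExt X x := by
  by_cases hx : x = 0
  · simp [hx]
  · have hcx : c • x ≠ 0 := smul_ne_zero hc.ne' hx
    rw [sphExt_of_ne hx, sphExt_of_ne hcx]
    congr 1
    ext1
    simp only [radialProj, norm_smul, Real.norm_of_nonneg hc.le, smul_smul]
    congr 1
    field_simp

/-- An identity between functions on the sphere extends to `ℝⁿ ∖ {0}`. -/
lemma sphExt_eventuallyEq {G : Type*} [Zero G] {X : Sph n → G} {Y : Euc n → G}
    (h : ∀ (x : Euc n) (hx : x ≠ 0), X (radialProj x hx) = Y x) {x : Euc n} (hx : x ≠ 0) :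
    sphExt X =ᶠ[𝓝 x] Y :=
  eventuallyEq_of_mem (isOpen_compl_singleton.mem_nhds hx) fun y hy => by
    rw [sphExt_of_ne hy, h y hy]

variable {F : Type*} [NormedAddCommGroup F] [NormedSpace ℝ F]

lemma SphereSmooth.contDiffAt {X : Sph n → F} (hX : SphereSmooth X) {x : Euc n} (hx : x ≠ 0) :
    ContDiffAt ℝ ((⊤ : ℕ∞) : WithTop ℕ∞) (sphExt X) x :=
  ContDiffOn.contDiffAt hX (isOpen_compl_singleton.mem_nhds hx)

lemma SphereSmooth.hasFDerivAt {X : Sph n → F} (hX : SphereSmooth X) {x : Euc n} (hx : x ≠ 0) :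
    HasFDerivAt (sphExt X) (fderiv ℝ (sphExt X) x) x :=
  ((hX.contDiffAt hx).differentiableAt (by simp)).hasFDerivAt

lemma SphereSmooth.continuous {X : Sph n → F} (hX : SphereSmooth X) : Continuous X := by
  have h : X = fun ω : Sph n => sphExt X (ω : Euc n) := funext fun ω => (sphExt_coe X ω).symm
  rw [h]
  exact ContinuousOn.comp_continuous hX.continuousOn continuous_subtype_val
    fun ω => ω.coe_ne_zero

lemma SphereSmooth.congr {X : Sph n → F} {Y : Euc n → F}
    (hY : ContDiffOn ℝ ((⊤ : ℕ∞) : WithTop ℕ∞) Y {0}ᶜ)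
    (h : ∀ (x : Euc n) (hx : x ≠ 0), X (radialProj x hx) = Y x) : SphereSmooth X :=
  ContDiffOn.congr hY fun x hx => by rw [sphExt_of_ne hx, h x hx]

lemma SphereSmooth.smul {f : Sph n → ℝ} {X : Sph n → F} (hf : SphSmooth f)
    (hX : SphereSmooth X) : SphereSmooth fun ω => f ω • X ω :=
  SphereSmooth.congr (ContDiffOn.smul hf hX) fun x hx => by simp [sphExt_of_ne hx]

lemma SphereSmooth.add {X Y : Sph n → F} (hX : SphereSmooth X) (hY : SphereSmooth Y) :
    SphereSmooth fun ω => X ω + Y ω :=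
  SphereSmooth.congr (ContDiffOn.add hX hY) fun x hx => by simp [sphExt_of_ne hx]

lemma SphereSmooth.const (v : F) : SphereSmooth fun _ : Sph n => v :=
  SphereSmooth.congr contDiffOn_const fun _ _ => rfl

lemma SphSmooth.mul {f g : Sph n → ℝ} (hf : SphSmooth f) (hg : SphSmooth g) :
    SphSmooth fun ω => f ω * g ω := SphereSmooth.smul hf hg

lemma SphSmooth.comp {f : Sph n → ℝ} (hf : SphSmooth f) {q : ℝ → ℝ} {s : Set ℝ}
    (hq : ContDiffOn ℝ ((⊤ : ℕ∞) : WithTop ℕ∞) q s) (hs : ∀ ω, f ω ∈ s) :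
    SphSmooth fun ω => q (f ω) :=
  SphereSmooth.congr (hq.comp hf fun x hx => by rw [sphExt_of_ne hx]; exact hs _)
    fun x hx => by simp [sphExt_of_ne hx]

/-- The restriction to the sphere of a smooth map of the ambient space. -/
lemma ContDiff.sphereSmooth {Φ : Euc n → F} (hΦ : ContDiff ℝ ((⊤ : ℕ∞) : WithTop ℕ∞) Φ) :
    SphereSmooth fun ω : Sph n => Φ (ω : Euc n) := by
  refine SphereSmooth.congr (Y := fun x => Φ (‖x‖⁻¹ • x)) ?_ fun x hx => rfl
  refine hΦ.comp_contDiffOn ?_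
  refine ContDiffOn.smul (ContDiffOn.inv ?_ fun x hx => norm_ne_zero_iff.2 hx) contDiffOn_id
  exact fun x hx => (contDiffAt_norm ℝ hx).contDiffWithinAt

/-- Homogeneity of degree `-1` of the derivative of the extension. -/
lemma fderiv_sphExt_eq_smul (X : Sph n → F) {x : Euc n} (hx : x ≠ 0) :
    fderiv ℝ (sphExt X) x = ‖x‖⁻¹ • fderiv ℝ (sphExt X) (radialProj x hx : Euc n) := by
  have h : sphExt X = fun y => sphExt X (‖x‖⁻¹ • y) :=
    funext fun y => (sphExt_smul (inv_pos.2 (norm_pos_iff.2 hx)) y).symm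
  conv_lhs => rw [h]
  rw [fderiv_comp_smul]
  rfl

lemma fderiv_sphExt_self {X : Sph n → F} (hX : SphereSmooth X) {x : Euc n} (hx : x ≠ 0) :
    fderiv ℝ (sphExt X) x x = 0 := by
  have h1 : HasDerivAt (fun t : ℝ => t • x) x 1 := by
    simpa using (hasDerivAt_id (1 : ℝ)).smul_const x
  have h2 : HasDerivAt (fun t : ℝ => sphExt X (t • x)) (fderiv ℝ (sphExt X) x x) 1 := by
    have := hX.hasFDerivAt hx
    rw [← one_smul ℝ x] at this
    simpa [Function.comp_def] using this.comp_hasDerivAt (1 : ℝ) h1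
  have h3 : (fun t : ℝ => sphExt X (t • x)) =ᶠ[𝓝 1] fun _ => sphExt X x :=
    eventuallyEq_of_mem (isOpen_Ioi.mem_nhds (show (0 : ℝ) < 1 by norm_num))
      fun t ht => sphExt_smul ht x
  exact h2.unique ((hasDerivAt_const (1 : ℝ) (sphExt X x)).congr_of_eventuallyEq h3)

/-! ### The tangential gradient -/

lemma inner_sphGrad (f : Sph n → ℝ) (ω : Sph n) (v : Euc n) :
    inner ℝ (sphGrad f ω) v = fderiv ℝ (sphExt f) (ω : Euc n) v := by
  rw [sphGrad, ← toDual_gradient, InnerProductSpace.toDual_apply_apply]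

lemma inner_sphGrad_self {f : Sph n → ℝ} (hf : SphSmooth f) (ω : Sph n) :
    inner ℝ (sphGrad f ω) (ω : Euc n) = 0 := by
  rw [inner_sphGrad]
  exact fderiv_sphExt_self hf ω.coe_ne_zero

lemma sphGrad_eq_of_hasFDerivAt {f : Sph n → ℝ} {ω : Sph n} {L : Euc n →L[ℝ] ℝ} {v : Euc n}
    (h : HasFDerivAt (sphExt f) L (ω : Euc n)) (hv : ∀ y, L y = inner ℝ v y) :
    sphGrad f ω = v := by
  refine ext_inner_right ℝ fun y => ?_
  rw [inner_sphGrad, h.fderiv, hv]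

lemma sphereSmooth_sphGrad {f : Sph n → ℝ} (hf : SphSmooth f) : SphereSmooth (sphGrad f) := by
  have h1 : ContDiffOn ℝ ((⊤ : ℕ∞) : WithTop ℕ∞) (fderiv ℝ (sphExt f)) {0}ᶜ :=
    ((contDiffOn_infty_iff_fderiv_of_isOpen isOpen_compl_singleton).1 hf).2
  have h2 : ContDiffOn ℝ ((⊤ : ℕ∞) : WithTop ℕ∞)
      (fun x => ‖x‖ • (InnerProductSpace.toDual ℝ (Euc n)).symm (fderiv ℝ (sphExt f) x))
      {0}ᶜ := by
    refine ContDiffOn.smul (fun x hx => (contDiffAt_norm ℝ hx).contDiffWithinAt) ?_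
    exact (InnerProductSpace.toDual ℝ (Euc n)).symm.toContinuousLinearEquiv.contDiff.comp_contDiffOn
      h1
  refine SphereSmooth.congr h2 fun x hx => ?_
  rw [fderiv_sphExt_eq_smul f hx, map_smul, smul_smul, mul_inv_cancel₀ (norm_ne_zero_iff.2 hx),
    one_smul]
  rfl

lemma sphGrad_mul {f g : Sph n → ℝ} (hf : SphSmooth f) (hg : SphSmooth g) (ω : Sph n) :
    sphGrad (fun ω => f ω * g ω) ω = f ω • sphGrad g ω + g ω • sphGrad f ω := by
  have h := (SphereSmooth.hasFDerivAt hf ω.coe_ne_zero).mul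
    (SphereSmooth.hasFDerivAt hg ω.coe_ne_zero)
  refine sphGrad_eq_of_hasFDerivAt (h.congr_of_eventuallyEq (sphExt_eventuallyEq
    (fun x hx => ?_) ω.coe_ne_zero)) fun y => ?_
  · simp [sphExt_of_ne hx]
  · simp [sphExt_coe, inner_add_left, inner_smul_left, inner_sphGrad]

lemma sphGrad_add {f g : Sph n → ℝ} (hf : SphSmooth f) (hg : SphSmooth g) (ω : Sph n) :
    sphGrad (fun ω => f ω + g ω) ω = sphGrad f ω + sphGrad g ω := by
  have h := (SphereSmooth.hasFDerivAt hf ω.coe_ne_zero).add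
    (SphereSmooth.hasFDerivAt hg ω.coe_ne_zero)
  refine sphGrad_eq_of_hasFDerivAt (h.congr_of_eventuallyEq (sphExt_eventuallyEq
    (fun x hx => ?_) ω.coe_ne_zero)) fun y => ?_
  · simp [sphExt_of_ne hx]
  · simp [inner_add_left, inner_sphGrad]

lemma sphGrad_const (c : ℝ) (ω : Sph n) : sphGrad (fun _ => c) ω = 0 :=
  sphGrad_eq_of_hasFDerivAt ((hasFDerivAt_const c (ω : Euc n)).congr_of_eventuallyEq
    (sphExt_eventuallyEq (fun _ _ => rfl) ω.coe_ne_zero)) (by simp)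

lemma sphGrad_const_mul {f : Sph n → ℝ} (hf : SphSmooth f) (c : ℝ) (ω : Sph n) :
    sphGrad (fun ω => c * f ω) ω = c • sphGrad f ω := by
  rw [sphGrad_mul (SphereSmooth.const c) hf, sphGrad_const, smul_zero, add_zero]

lemma sphGrad_comp {f : Sph n → ℝ} (hf : SphSmooth f) {q : ℝ → ℝ} {q' : ℝ} {ω : Sph n}
    (hq : HasDerivAt q q' (f ω)) : sphGrad (fun ω => q (f ω)) ω = q' • sphGrad f ω := by
  have h := HasDerivAt.comp_hasFDerivAt (ω : Euc n) (h₂ := q) (h₂' := q') (by rwa [sphExt_coe])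
    (SphereSmooth.hasFDerivAt hf ω.coe_ne_zero)
  refine sphGrad_eq_of_hasFDerivAt (h.congr_of_eventuallyEq (sphExt_eventuallyEq
    (fun x hx => ?_) ω.coe_ne_zero)) fun y => ?_
  · simp [sphExt_of_ne hx]
  · simp [inner_smul_left, inner_sphGrad]

/-- The orthogonal projection to the tangent space, as a continuous linear map. -/
def tangCLM (ω : Sph n) : Euc n →L[ℝ] Euc n :=
  ContinuousLinearMap.id ℝ (Euc n) - (innerSL ℝ (ω : Euc n)).smulRight (ω : Euc n)

lemma tangCLM_apply (ω : Sph n) (v : Euc n) : tangCLM ω v = tangProj ω v := by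
  simp [tangCLM, tangProj, real_inner_comm]

lemma inner_tangProj_left (ω : Sph n) (v w : Euc n) :
    inner ℝ (tangProj ω v) w = inner ℝ v w - inner ℝ v (ω : Euc n) * inner ℝ (ω : Euc n) w := by
  simp [tangProj, inner_sub_left, inner_smul_left]

lemma inner_tangProj_self (ω : Sph n) (v : Euc n) : inner ℝ (tangProj ω v) (ω : Euc n) = 0 := by
  rw [inner_tangProj_left, ω.inner_self]; ring

lemma inner_tangProj_comm (ω : Sph n) (v w : Euc n) :
    inner ℝ (tangProj ω v) w = inner ℝ v (tangProj ω w) := by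
  rw [inner_tangProj_left, real_inner_comm (tangProj ω w) v, inner_tangProj_left,
    real_inner_comm w v, real_inner_comm (ω : Euc n) w, real_inner_comm v (ω : Euc n)]
  ring

lemma hasFDerivAt_normalize (ω : Sph n) :
    HasFDerivAt (fun x : Euc n => ‖x‖⁻¹ • x) (tangCLM ω) (ω : Euc n) := by
  have h1 : HasFDerivAt (fun x : Euc n => ‖x‖) (innerSL ℝ (ω : Euc n)) (ω : Euc n) := by
    have := (hasStrictFDerivAt_norm_sq (ω : Euc n)).hasFDerivAt.sqrt (by simp)
    refine (this.congr_fderiv ?_).congr_of_eventuallyEq (Eventually.of_forall fun x => ?_)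
    · ext y; simp [ω.norm_coe]
    · simp
  have h2 := (hasDerivAt_inv (norm_ne_zero_iff.2 ω.coe_ne_zero)).comp_hasFDerivAt (ω : Euc n) h1
  refine (h2.smul (hasFDerivAt_id (ω : Euc n))).congr_fderiv ?_
  ext y
  simp [ω.norm_coe, tangCLM]
  ring

lemma hasFDerivAt_sphExt_restrict {Φ : Euc n → F} {Φ' : Euc n →L[ℝ] F} {ω : Sph n}
    (hΦ : HasFDerivAt Φ Φ' (ω : Euc n)) :
    HasFDerivAt (sphExt fun ω : Sph n => Φ (ω : Euc n)) (Φ'.comp (tangCLM ω)) (ω : Euc n) := by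
  have h : HasFDerivAt (fun x : Euc n => Φ (‖x‖⁻¹ • x)) (Φ'.comp (tangCLM ω)) (ω : Euc n) := by
    refine HasFDerivAt.comp (ω : Euc n) ?_ (hasFDerivAt_normalize ω)
    simpa [ω.norm_coe] using hΦ
  exact h.congr_of_eventuallyEq (sphExt_eventuallyEq (fun _ _ => rfl) ω.coe_ne_zero)

lemma sphSmooth_inner (v : Euc n) : SphSmooth fun ω : Sph n => inner ℝ v (ω : Euc n) :=
  ContDiff.sphereSmooth (Φ := fun x => inner ℝ v x) (contDiff_const.inner ℝ contDiff_id)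

lemma sphGrad_inner (v : Euc n) (ω : Sph n) :
    sphGrad (fun ω : Sph n => inner ℝ v (ω : Euc n)) ω = tangProj ω v := by
  refine sphGrad_eq_of_hasFDerivAt (hasFDerivAt_sphExt_restrict
    (Φ := fun x => inner ℝ v x) (innerSL ℝ v).hasFDerivAt) fun y => ?_
  simp [tangCLM_apply, inner_tangProj_comm]

lemma sphereSmooth_tangProj (v : Euc n) : SphereSmooth fun ω : Sph n => tangProj ω v :=
  ContDiff.sphereSmooth (Φ := fun x => v - (inner ℝ v x : ℝ) • x)
    (contDiff_const.sub ((contDiff_const.inner ℝ contDiff_id).smul contDiff_id))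

/-! ### The divergence -/

lemma trace_smulRight_clm (L : Euc n →L[ℝ] ℝ) (v : Euc n) :
    LinearMap.trace ℝ (Euc n) (L.smulRight v).toLinearMap = L v :=
  LinearMap.trace_smulRight L.toLinearMap v

lemma trace_tangCLM (ω : Sph n) :
    LinearMap.trace ℝ (Euc n) (tangCLM ω).toLinearMap = (n : ℝ) - 1 := by
  rw [tangCLM, ContinuousLinearMap.toLinearMap_sub, map_sub, trace_smulRight_clm]
  simp [ω.norm_coe]

lemma sphDiv_eq_of_hasFDerivAt {X : Sph n → Euc n} {ω : Sph n} {L : Euc n →L[ℝ] Euc n}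
    (h : HasFDerivAt (sphExt X) L (ω : Euc n)) :
    sphDiv X ω = LinearMap.trace ℝ (Euc n) L.toLinearMap := by
  rw [sphDiv, h.fderiv]

lemma sphDiv_add {X Y : Sph n → Euc n} (hX : SphereSmooth X) (hY : SphereSmooth Y) (ω : Sph n) :
    sphDiv (fun ω => X ω + Y ω) ω = sphDiv X ω + sphDiv Y ω := by
  have h := (hX.hasFDerivAt ω.coe_ne_zero).add (hY.hasFDerivAt ω.coe_ne_zero)
  rw [sphDiv_eq_of_hasFDerivAt (h.congr_of_eventuallyEq (sphExt_eventuallyEq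
    (fun x hx => ?_) ω.coe_ne_zero)), ContinuousLinearMap.toLinearMap_add, map_add]
  · rfl
  · simp [sphExt_of_ne hx]

lemma sphDiv_smul {f : Sph n → ℝ} {X : Sph n → Euc n} (hf : SphSmooth f) (hX : SphereSmooth X)
    (ω : Sph n) :
    sphDiv (fun ω => f ω • X ω) ω = f ω * sphDiv X ω + inner ℝ (sphGrad f ω) (X ω) := by
  have h := (SphereSmooth.hasFDerivAt hf ω.coe_ne_zero).smul (hX.hasFDerivAt ω.coe_ne_zero)
  rw [sphDiv_eq_of_hasFDerivAt (h.congr_of_eventuallyEq (sphExt_eventuallyEq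
    (fun x hx => ?_) ω.coe_ne_zero)), ContinuousLinearMap.toLinearMap_add, map_add,
    trace_smulRight_clm, sphExt_coe, sphExt_coe, inner_sphGrad]
  · simp [sphDiv]
  · simp [sphExt_of_ne hx]

lemma sphDiv_tangProj (v : Euc n) (ω : Sph n) :
    sphDiv (fun ω => tangProj ω v) ω = -((n : ℝ) - 1) * inner ℝ v (ω : Euc n) := by
  have h1 : HasFDerivAt (fun x : Euc n => v - (inner ℝ v x : ℝ) • x)
      (-((inner ℝ v (ω : Euc n) : ℝ) • ContinuousLinearMap.id ℝ (Euc n) +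
        (innerSL ℝ v).smulRight (ω : Euc n))) (ω : Euc n) :=
    ((innerSL ℝ v).hasFDerivAt.smul (hasFDerivAt_id (ω : Euc n))).const_sub v
  have h2 := hasFDerivAt_sphExt_restrict h1
  have h3 : (-((inner ℝ v (ω : Euc n) : ℝ) • ContinuousLinearMap.id ℝ (Euc n) +
        (innerSL ℝ v).smulRight (ω : Euc n))).comp (tangCLM ω) =
      -((inner ℝ v (ω : Euc n) : ℝ) • tangCLM ω
        + ((innerSL ℝ v).comp (tangCLM ω)).smulRight (ω : Euc n)) := by
    ext y; simp
  rw [sphDiv_eq_of_hasFDerivAt (X := fun ω => tangProj ω v) h2, h3,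
    ContinuousLinearMap.toLinearMap_neg, map_neg, ContinuousLinearMap.toLinearMap_add, map_add,
    trace_smulRight_clm, ContinuousLinearMap.toLinearMap_smul, map_smul, trace_tangCLM]
  have : tangProj ω (ω : Euc n) = 0 := by simp [tangProj, ω.norm_coe]
  simp [tangCLM_apply, this]
  ring

lemma continuous_trace_toLinearMap :
    Continuous fun L : Euc n →L[ℝ] Euc n => LinearMap.trace ℝ (Euc n) L.toLinearMap :=
  LinearMap.continuous_of_finiteDimensional
    ((LinearMap.trace ℝ (Euc n)).comp (ContinuousLinearMap.coeLM ℝ))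

lemma continuous_sphDiv {X : Sph n → Euc n} (hX : SphereSmooth X) : Continuous (sphDiv X) := by
  have h1 : ContinuousOn (fderiv ℝ (sphExt X)) {0}ᶜ :=
    (((contDiffOn_infty_iff_fderiv_of_isOpen isOpen_compl_singleton).1 hX).2).continuousOn
  exact continuous_trace_toLinearMap.comp
    (h1.comp_continuous continuous_subtype_val fun ω => ω.coe_ne_zero)

end Calculus

/-! ### The divergence theorem on the sphere -/

section DivergenceTheorem

variable {n : ℕ}

/-- Integration in polar coordinates of a product of a radial and an angular function. -/
lemma integral_radial_mul_sphExt (ρ : ℝ → ℝ) (G : Sph n → ℝ) :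
    ∫ x : Euc n, ρ ‖x‖ * sphExt G x = (∫ ω, G ω ∂surfaceMeasure n) *
      ∫ r : Ioi (0 : ℝ), ρ r ∂Measure.volumeIoiPow (Module.finrank ℝ (Euc n) - 1) := by
  rcases Nat.eq_zero_or_pos n with h0 | h0
  · subst h0
    have : IsEmpty (Sph 0) := ⟨fun ω => ω.coe_ne_zero (Subsingleton.elim _ _)⟩
    have h : ∀ x : Euc 0, sphExt G x = 0 := fun x => by
      rw [Subsingleton.elim x 0]; simp [sphExt]
    simp [h, Measure.eq_zero_of_isEmpty]
  have : Nonempty (Fin n) := ⟨⟨0, h0⟩⟩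
  have hmp := (volume : Measure (Euc n)).measurePreserving_homeomorphUnitSphereProd
  have h1 := hmp.integral_comp (Homeomorph.measurableEmbedding _)
    (fun p : Sph n × Ioi (0 : ℝ) => G p.1 * ρ p.2)
  rw [integral_prod_mul (μ := surfaceMeasure n) G (fun r : Ioi (0 : ℝ) => ρ r)] at h1
  rw [← h1, ← setIntegral_univ (μ := Measure.comap _ _)]
  have h2 : ∫ x : Euc n, ρ ‖x‖ * sphExt G x = ∫ x in ({0}ᶜ : Set (Euc n)), ρ ‖x‖ * sphExt G x := by
    rw [restrict_compl_singleton]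
  rw [h2, setIntegral_univ, ← integral_subtype_comap (measurableSet_singleton _).compl]
  refine integral_congr_ae (Eventually.of_forall fun x => ?_)
  have hx : (x : Euc n) ≠ 0 := x.2
  beta_reduce
  rw [sphExt_of_ne hx, mul_comm]
  congr 2
  · ext1
    simp [radialProj]
  · simp

lemma Continuous.integrable_sphere {F : Type*} [NormedAddCommGroup F] {X : Sph n → F}
    (hX : Continuous X) : Integrable X (surfaceMeasure n) :=
  hX.integrable_of_hasCompactSupport (HasCompactSupport.of_compactSpace X)

lemma Continuous.memLp_sphere {F : Type*} [NormedAddCommGroup F] {X : Sph n → F}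
    (hX : Continuous X) : MemLp X 2 (surfaceMeasure n) :=
  hX.memLp_of_hasCompactSupport (HasCompactSupport.of_compactSpace X)

/-- The integral of the divergence of a compactly supported vector field of `ℝⁿ` is zero. -/
lemma integral_trace_fderiv_eq_zero {W : Euc n → Euc n} (hW : ContDiff ℝ 1 W)
    (hc : HasCompactSupport W) :
    ∫ x, LinearMap.trace ℝ (Euc n) (fderiv ℝ W x).toLinearMap = 0 := by
  have hd : ∀ x, HasFDerivAt W (fderiv ℝ W x) x := fun x =>
    (hW.differentiable (by simp) x).hasFDerivAt
  have key : ∀ e : Euc n, Integrable (fun x => inner ℝ e (fderiv ℝ W x e)) ∧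
      ∫ x, inner ℝ e (fderiv ℝ W x e) = 0 := by
    intro e
    have hg : ∀ x, HasFDerivAt (fun x => inner ℝ e (W x)) ((innerSL ℝ e).comp (fderiv ℝ W x)) x :=
      fun x => (innerSL ℝ e).hasFDerivAt.comp x (hd x)
    have hg1 : ∀ x, fderiv ℝ (fun x => inner ℝ e (W x)) x e = inner ℝ e (fderiv ℝ W x e) :=
      fun x => by rw [(hg x).fderiv]; rfl
    have hI : Integrable fun x => inner ℝ e (fderiv ℝ W x e) := by
      refine Continuous.integrable_of_hasCompactSupport ?_ ?_
      · have := hW.continuous_fderiv (by simp)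
        fun_prop
      · refine (hc.fderiv (𝕜 := ℝ)).mono fun x hx => ?_
        contrapose! hx
        simp only [Function.mem_support, not_not] at hx ⊢
        simp [hx]
    have hI0 : Integrable fun x => inner ℝ e (W x) := by
      refine Continuous.integrable_of_hasCompactSupport (by have := hW.continuous; fun_prop) ?_
      refine hc.mono fun x hx => ?_
      contrapose! hx
      simp only [Function.mem_support, not_not] at hx ⊢
      simp [hx]
    have := integral_mul_fderiv_eq_neg_fderiv_mul_of_integrable (μ := (volume : Measure (Euc n)))
      (f := fun _ => (1 : ℝ)) (g := fun x => inner ℝ e (W x)) (v := e)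
      (by simp) (by simpa [hg1] using hI) (by simpa using hI0)
      (fun x _ => differentiableAt_const _) (fun x _ => (hg x).differentiableAt)
    refine ⟨hI, ?_⟩
    simpa [hg1] using this
  have htr : ∀ x, LinearMap.trace ℝ (Euc n) (fderiv ℝ W x).toLinearMap =
      ∑ i, inner ℝ (EuclideanSpace.basisFun (Fin n) ℝ i)
        (fderiv ℝ W x (EuclideanSpace.basisFun (Fin n) ℝ i)) := fun x =>
    LinearMap.trace_eq_sum_inner _ (EuclideanSpace.basisFun (Fin n) ℝ)
  simp_rw [htr]
  rw [integral_finsetSum _ fun i _ => (key _).1]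
  exact Finset.sum_eq_zero fun i _ => (key _).2

/-- A smooth function on the line, supported near `2`, that cuts off the radius. -/
def radialBump : ContDiffBump (2 : ℝ) := ⟨1 / 2, 1, by norm_num, by norm_num⟩

lemma radialBump_eq_zero {t : ℝ} (ht : t ≤ 1) : radialBump t = 0 := by
  refine radialBump.zero_of_le_dist ?_
  rw [Real.dist_eq, abs_sub_comm]
  exact le_trans (by change (1 : ℝ) ≤ 2 - t; linarith) (le_abs_self _)

lemma radialBump_eq_zero' {t : ℝ} (ht : 3 ≤ t) : radialBump t = 0 := by
  refine radialBump.zero_of_le_dist ?_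
  rw [Real.dist_eq]
  exact le_trans (by change (1 : ℝ) ≤ t - 2; linarith) (le_abs_self _)

lemma norm_lt_of_radialBump_ne_zero {x : Euc n} (hx : radialBump (‖x‖ ^ 2) ≠ 0) : ‖x‖ < 2 := by
  by_contra h
  exact hx (radialBump_eq_zero' (by nlinarith))

lemma radialBump_eventually_zero : ∀ᶠ x : Euc n in 𝓝 0, radialBump (‖x‖ ^ 2) = 0 := by
  filter_upwards [Metric.ball_mem_nhds (0 : Euc n) one_pos] with x hx
  refine radialBump_eq_zero ?_
  rw [mem_ball_zero_iff] at hx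
  nlinarith [norm_nonneg x]

/-- The radial factor in the polar decomposition is not zero. -/
lemma integral_radialBump_ne_zero (hn : 0 < n) :
    ∫ r : Ioi (0 : ℝ), (radialBump ((r : ℝ) ^ 2) * (r : ℝ)⁻¹)
      ∂Measure.volumeIoiPow (Module.finrank ℝ (Euc n) - 1) ≠ 0 := by
  have h := integral_radial_mul_sphExt (n := n) (fun r => radialBump (r ^ 2) * r⁻¹) (fun _ => 1)
  intro h0
  rw [h0, mul_zero] at h
  have hfun : ∀ x : Euc n, radialBump (‖x‖ ^ 2) * ‖x‖⁻¹ * sphExt (fun _ : Sph n => (1 : ℝ)) x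
      = radialBump (‖x‖ ^ 2) * ‖x‖⁻¹ := by
    intro x
    by_cases hx : x = 0
    · simp [hx]
    · simp [sphExt_of_ne hx]
  simp_rw [hfun] at h
  have hcont : Continuous fun x : Euc n => radialBump (‖x‖ ^ 2) * ‖x‖⁻¹ := by
    rw [continuous_iff_continuousAt]
    intro x
    by_cases hx : x = 0
    · subst hx
      refine ContinuousAt.congr (f := fun _ => (0 : ℝ)) continuousAt_const ?_
      filter_upwards [radialBump_eventually_zero (n := n)] with y hy
      rw [hy, zero_mul]
    · have h1 : ContinuousAt (fun x : Euc n => radialBump (‖x‖ ^ 2)) x :=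
        (radialBump.continuous.comp (continuous_norm.pow 2)).continuousAt
      exact h1.mul (continuous_norm.continuousAt.inv₀ (norm_ne_zero_iff.2 hx))
  have hsupp : HasCompactSupport fun x : Euc n => radialBump (‖x‖ ^ 2) * ‖x‖⁻¹ := by
    refine HasCompactSupport.of_support_subset_isCompact (isCompact_closedBall (0 : Euc n) 2)
      fun x hx => ?_
    simp only [Function.mem_support] at hx
    exact mem_closedBall_zero_iff.2 (norm_lt_of_radialBump_ne_zero (left_ne_zero_of_mul hx)).le
  have hpos := hcont.integral_pos_of_hasCompactSupport_nonneg_nonzero (μ := volume) hsupp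
    (fun x => mul_nonneg radialBump.nonneg (inv_nonneg.2 (norm_nonneg x)))
    (x := EuclideanSpace.single ⟨0, hn⟩ (Real.sqrt 2)) (by
      have : ‖EuclideanSpace.single (⟨0, hn⟩ : Fin n) (Real.sqrt 2)‖ = Real.sqrt 2 := by
        simp
      rw [this, Real.sq_sqrt (by norm_num)]
      have h2 : radialBump (2 : ℝ) = 1 :=
        radialBump.one_of_mem_closedBall (Metric.mem_closedBall_self radialBump.rIn_pos.le)
      rw [h2]
      positivity)
  exact hpos.ne' h

/-- The divergence theorem: the divergence of a tangential vector field has zero integral. The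
divergence on `ℝⁿ` of the extended field, cut off by a function of `|x|²`, is a radial function
times the divergence on the sphere, because the field is orthogonal to the gradient
of the cut-off. -/
theorem integral_sphDiv_eq_zero {X : Sph n → Euc n} (hX : SphereSmooth X)
    (ht : ∀ ω, inner ℝ (X ω) (ω : Euc n) = 0) : ∫ ω, sphDiv X ω ∂surfaceMeasure n = 0 := by
  rcases Nat.eq_zero_or_pos n with h0 | h0
  · subst h0
    have : IsEmpty (Sph 0) := ⟨fun ω => ω.coe_ne_zero (Subsingleton.elim _ _)⟩
    simp [Measure.eq_zero_of_isEmpty]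
  set W : Euc n → Euc n := fun x => radialBump (‖x‖ ^ 2) • sphExt X x with hWdef
  have hbs : ContDiff ℝ 1 fun x : Euc n => radialBump (‖x‖ ^ 2) :=
    radialBump.contDiff.comp (contDiff_norm_sq ℝ)
  have hW : ContDiff ℝ 1 W := by
    rw [contDiff_iff_contDiffAt]
    intro x
    by_cases hx : x = 0
    · subst hx
      refine ContDiffAt.congr_of_eventuallyEq (f := fun _ => (0 : Euc n)) contDiffAt_const ?_
      filter_upwards [radialBump_eventually_zero (n := n)] with y hy
      rw [hWdef]
      simp only [hy, zero_smul]
    · exact hbs.contDiffAt.smul ((hX.contDiffAt hx).of_le (by simp))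
  have hc : HasCompactSupport W := by
    refine HasCompactSupport.of_support_subset_isCompact (isCompact_closedBall (0 : Euc n) 2)
      fun x hx => ?_
    simp only [Function.mem_support, hWdef] at hx
    exact mem_closedBall_zero_iff.2 (norm_lt_of_radialBump_ne_zero (left_ne_zero_of_smul hx)).le
  have hI := integral_trace_fderiv_eq_zero hW hc
  have htr : ∀ x : Euc n, x ≠ 0 → LinearMap.trace ℝ (Euc n) (fderiv ℝ W x).toLinearMap =
      radialBump (‖x‖ ^ 2) * ‖x‖⁻¹ * sphExt (sphDiv X) x := by
    intro x hx
    have hb : HasFDerivAt (fun x : Euc n => radialBump (‖x‖ ^ 2))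
        (deriv radialBump (‖x‖ ^ 2) • ((2 : ℝ) • innerSL ℝ x)) x := by
      have h1 : HasDerivAt radialBump (deriv radialBump (‖x‖ ^ 2)) (‖x‖ ^ 2) :=
        ((radialBump.contDiff (n := 1)).differentiable (by simp) _).hasDerivAt
      exact HasDerivAt.comp_hasFDerivAt (h₂ := radialBump) x h1
        (by
          have := (hasStrictFDerivAt_norm_sq x).hasFDerivAt
          rwa [← Nat.cast_smul_eq_nsmul ℝ, Nat.cast_ofNat] at this)
    have h2 : HasFDerivAt W _ x := hb.smul (hX.hasFDerivAt hx)
    rw [h2.fderiv, ContinuousLinearMap.toLinearMap_add, map_add, trace_smulRight_clm,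
      ContinuousLinearMap.toLinearMap_smul, map_smul, fderiv_sphExt_eq_smul X hx,
      ContinuousLinearMap.toLinearMap_smul, map_smul]
    have h3 : inner ℝ x (sphExt X x) = 0 := by
      have := ht (radialProj x hx)
      rw [← sphExt_of_ne (X := X) hx, real_inner_comm] at this
      simpa [radialProj, inner_smul_left, hx] using this
    simp only [_root_.smul_apply, innerSL_apply_apply, h3]
    rw [sphExt_of_ne hx, sphDiv]
    simp
    ring
  have hae : (fun x : Euc n => LinearMap.trace ℝ (Euc n) (fderiv ℝ W x).toLinearMap) =ᵐ[volume]
      fun x => radialBump (‖x‖ ^ 2) * ‖x‖⁻¹ * sphExt (sphDiv X) x := by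
    have : Nonempty (Fin n) := ⟨⟨0, h0⟩⟩
    have h1 : ∀ᵐ x : Euc n, x ≠ 0 := by
      simp [ae_iff, measure_singleton]
    filter_upwards [h1] with x hx using htr x hx
  rw [integral_congr_ae hae,
    integral_radial_mul_sphExt (fun r => radialBump (r ^ 2) * r⁻¹) (sphDiv X)] at hI
  exact (mul_eq_zero.1 hI).resolve_right (integral_radialBump_ne_zero h0)

/-- Green's formula. -/
lemma integral_sphDiv_mul {X : Sph n → Euc n} (hX : SphereSmooth X)
    (ht : ∀ ω, inner ℝ (X ω) (ω : Euc n) = 0) {u : Sph n → ℝ} (hu : SphSmooth u) :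
    ∫ ω, sphDiv X ω * u ω ∂surfaceMeasure n =
      -∫ ω, inner ℝ (X ω) (sphGrad u ω) ∂surfaceMeasure n := by
  have h := integral_sphDiv_eq_zero (X := fun ω => u ω • X ω) (SphereSmooth.smul hu hX)
    (fun ω => by rw [inner_smul_left, ht, mul_zero])
  simp_rw [sphDiv_smul hu hX] at h
  have hu' : Continuous u := SphereSmooth.continuous hu
  have I1 : Integrable (fun ω => u ω * sphDiv X ω) (surfaceMeasure n) :=
    (hu'.mul (continuous_sphDiv hX)).integrable_sphere
  have I2 : Integrable (fun ω => inner ℝ (sphGrad u ω) (X ω)) (surfaceMeasure n) :=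
    ((sphereSmooth_sphGrad hu).continuous.inner (𝕜 := ℝ) hX.continuous).integrable_sphere
  rw [integral_add I1 I2] at h
  simp_rw [real_inner_comm (sphGrad u _) (X _), mul_comm (sphDiv X _)]
  linarith

end DivergenceTheorem

/-! ### Functions whose weak gradient vanishes -/

section Constancy

variable {n : ℕ}

lemma integrable_mul_continuous {χ : Sph n → ℝ} (hχ : MemLp χ 2 (surfaceMeasure n))
    {p : Sph n → ℝ} (hp : Continuous p) : Integrable (fun ω => χ ω * p ω) (surfaceMeasure n) :=
  hχ.integrable_mul hp.memLp_sphere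

/-- The moments `∫ χ (v · ω) ^ d` vanish. They are related two by two by testing against the fields
`(v · ω) ^ d (Id - ω ⊗ ω) v`, with divergence
`d |v|² (v · ω) ^ (d - 1) - (d + n - 1) (v · ω) ^ (d + 1)`. -/
lemma integral_mul_inner_pow_eq_zero (hn : 2 ≤ n) {χ : Sph n → ℝ}
    (hχ : MemLp χ 2 (surfaceMeasure n)) (h1 : ∫ ω, χ ω ∂surfaceMeasure n = 0)
    (hdiv : ∀ X : Sph n → Euc n, SphereSmooth X → (∀ ω, inner ℝ (X ω) (ω : Euc n) = 0) →
      ∫ ω, χ ω * sphDiv X ω ∂surfaceMeasure n = 0) (v : Euc n) (d : ℕ) :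
    ∫ ω, χ ω * inner ℝ v (ω : Euc n) ^ d ∂surfaceMeasure n = 0 := by
  have hn' : (2 : ℝ) ≤ n := by exact_mod_cast hn
  have hs := sphSmooth_inner v
  have hpow : ∀ k : ℕ, SphSmooth fun ω : Sph n => inner ℝ v (ω : Euc n) ^ k := fun k =>
    SphSmooth.comp hs (q := fun t => t ^ k) (contDiff_id.pow k).contDiffOn (fun _ => mem_univ _)
  have hint : ∀ k : ℕ, Integrable (fun ω : Sph n => χ ω * inner ℝ v (ω : Euc n) ^ k)
      (surfaceMeasure n) := fun k =>
    integrable_mul_continuous hχ (SphereSmooth.continuous (hpow k))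
  have hX : ∀ k : ℕ, ∫ ω : Sph n, χ ω * sphDiv (fun ω : Sph n =>
      (inner ℝ v (ω : Euc n) ^ k : ℝ) • tangProj ω v) ω ∂surfaceMeasure n = 0 := fun k =>
    hdiv _ (SphereSmooth.smul (hpow k) (sphereSmooth_tangProj v))
      fun ω => by rw [inner_smul_left, inner_tangProj_self, mul_zero]
  have hgrad : ∀ (k : ℕ) (ω : Sph n), sphGrad (fun ω : Sph n => inner ℝ v (ω : Euc n) ^ k) ω
      = ((k : ℝ) * inner ℝ v (ω : Euc n) ^ (k - 1)) • tangProj ω v := fun k ω => by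
    rw [sphGrad_comp hs (q := fun t => t ^ k) (hasDerivAt_pow k _), sphGrad_inner]
  have hnorm : ∀ ω : Sph n, inner ℝ (tangProj ω v) (tangProj ω v)
      = ‖v‖ ^ 2 - inner ℝ v (ω : Euc n) ^ 2 := fun ω => by
    rw [← inner_tangProj_comm, inner_tangProj_left, inner_tangProj_self, inner_tangProj_left,
      real_inner_self_eq_norm_sq, real_inner_comm v (ω : Euc n)]
    ring
  have hdivX : ∀ (k : ℕ) (ω : Sph n), sphDiv (fun ω : Sph n =>
      (inner ℝ v (ω : Euc n) ^ k : ℝ) • tangProj ω v) ω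
      = (k : ℝ) * inner ℝ v (ω : Euc n) ^ (k - 1) * (‖v‖ ^ 2 - inner ℝ v (ω : Euc n) ^ 2)
        - ((n : ℝ) - 1) * inner ℝ v (ω : Euc n) ^ (k + 1) := fun k ω => by
    rw [sphDiv_smul (hpow k) (sphereSmooth_tangProj v), sphDiv_tangProj, hgrad, inner_smul_left,
      hnorm]
    simp only [conj_trivial]
    ring
  induction d using Nat.twoStepInduction with
  | zero => simpa using h1
  | one =>
    have h := hX 0
    simp_rw [hdivX] at h
    have e : ∀ ω : Sph n, χ ω * (((0 : ℕ) : ℝ) * inner ℝ v (ω : Euc n) ^ (0 - 1) *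
        (‖v‖ ^ 2 - inner ℝ v (ω : Euc n) ^ 2) - ((n : ℝ) - 1) * inner ℝ v (ω : Euc n) ^ (0 + 1))
        = -((n : ℝ) - 1) * (χ ω * inner ℝ v (ω : Euc n) ^ 1) := fun ω => by
      push_cast; ring
    simp_rw [e] at h
    rw [integral_const_mul] at h
    exact (mul_eq_zero.1 h).resolve_left (by linarith)
  | more d ih _ =>
    have h := hX (d + 1)
    simp_rw [hdivX] at h
    have e : ∀ ω : Sph n, χ ω * (((d + 1 : ℕ) : ℝ) * inner ℝ v (ω : Euc n) ^ (d + 1 - 1) *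
        (‖v‖ ^ 2 - inner ℝ v (ω : Euc n) ^ 2)
          - ((n : ℝ) - 1) * inner ℝ v (ω : Euc n) ^ (d + 1 + 1))
        = ((d + 1) * ‖v‖ ^ 2) * (χ ω * inner ℝ v (ω : Euc n) ^ d)
          - (d + n) * (χ ω * inner ℝ v (ω : Euc n) ^ (d + 2)) := fun ω => by
      rw [Nat.add_sub_cancel]
      push_cast; ring
    simp_rw [e] at h
    rw [integral_sub ((hint d).const_mul _) ((hint (d + 2)).const_mul _), integral_const_mul,
      integral_const_mul, ih, mul_zero, zero_sub, neg_eq_zero] at h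
    exact (mul_eq_zero.1 h).resolve_left (by positivity)

/-- Summation of the moments `∫ χ (v · ω) ^ k / k!`. -/
lemma integral_mul_exp_inner_eq_zero (hn : 2 ≤ n) {χ : Sph n → ℝ}
    (hχ : MemLp χ 2 (surfaceMeasure n)) (h1 : ∫ ω, χ ω ∂surfaceMeasure n = 0)
    (hdiv : ∀ X : Sph n → Euc n, SphereSmooth X → (∀ ω, inner ℝ (X ω) (ω : Euc n) = 0) →
      ∫ ω, χ ω * sphDiv X ω ∂surfaceMeasure n = 0) (v : Euc n) :
    ∫ ω, χ ω * Real.exp (inner ℝ v (ω : Euc n)) ∂surfaceMeasure n = 0 := by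
  have hχ1 : Integrable χ (surfaceMeasure n) := hχ.integrable (by norm_num)
  have hint : ∀ k : ℕ, Integrable (fun ω : Sph n =>
      χ ω * (inner ℝ v (ω : Euc n) ^ k / k.factorial)) (surfaceMeasure n) := fun k =>
    integrable_mul_continuous hχ (by fun_prop)
  have hsum : Summable fun k : ℕ => ∫ ω : Sph n,
      ‖χ ω * (inner ℝ v (ω : Euc n) ^ k / k.factorial)‖ ∂surfaceMeasure n := by
    refine Summable.of_nonneg_of_le (fun k => integral_nonneg fun ω => norm_nonneg _)
      (fun k => ?_) ((Real.summable_pow_div_factorial ‖v‖).mul_left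
        (∫ ω, ‖χ ω‖ ∂surfaceMeasure n))
    rw [← integral_mul_const]
    refine integral_mono (hint k).norm (hχ1.norm.mul_const _) fun ω => ?_
    simp only [norm_mul, norm_div, norm_pow, Real.norm_natCast]
    have : ‖(inner ℝ v (ω : Euc n) : ℝ)‖ ≤ ‖v‖ := by
      simpa [ω.norm_coe] using norm_inner_le_norm (𝕜 := ℝ) v (ω : Euc n)
    gcongr
  have h := hasSum_integral_of_summable_integral_norm hint hsum
  have hz : ∀ k : ℕ, ∫ ω : Sph n, χ ω * (inner ℝ v (ω : Euc n) ^ k / k.factorial)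
      ∂surfaceMeasure n = 0 := fun k => by
    simp_rw [← mul_div_assoc]
    rw [integral_div, integral_mul_inner_pow_eq_zero hn hχ h1 hdiv, zero_div]
  simp_rw [hz] at h
  have := h.unique hasSum_zero
  rw [← this]
  refine integral_congr_ae (Eventually.of_forall fun ω => ?_)
  beta_reduce
  rw [tsum_mul_left, Real.exp_eq_exp_ℝ, NormedSpace.exp_eq_tsum_div]

/-- The exponential of a linear form, as a continuous function on the sphere. -/
def expInner (v : Euc n) : C(Sph n, ℝ) := ⟨fun ω => Real.exp (inner ℝ v (ω : Euc n)), by fun_prop⟩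

/-- The exponentials of linear forms span a dense subspace of the continuous functions. -/
lemma span_expInner_dense :
    Dense (Submodule.span ℝ (range (expInner (n := n))) : Set C(Sph n, ℝ)) := by
  set A : Subalgebra ℝ C(Sph n, ℝ) := Algebra.adjoin ℝ (range (expInner (n := n))) with hA
  have hcl : ∀ p ∈ Submonoid.closure (range (expInner (n := n))),
      p ∈ range (expInner (n := n)) := by
    intro p hp
    induction hp using Submonoid.closure_induction with
    | mem x hx => exact hx
    | one => exact ⟨0, by ext ω; simp [expInner]⟩
    | mul x y _ _ hx hy =>
      obtain ⟨v, rfl⟩ := hx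
      obtain ⟨w, rfl⟩ := hy
      exact ⟨v + w, by ext ω; simp [expInner, inner_add_left, Real.exp_add]⟩
  have hspan : (A : Set C(Sph n, ℝ)) = Submodule.span ℝ (range (expInner (n := n))) := by
    have := Algebra.adjoin_eq_span_of_subset (R := ℝ) (s := range (expInner (n := n)))
      (fun p hp => Submodule.subset_span (hcl p hp))
    rw [← this]
    rfl
  have hsep : A.SeparatesPoints := by
    intro ω η hne
    refine ⟨_, ⟨expInner (ω : Euc n), Algebra.subset_adjoin ⟨_, rfl⟩, rfl⟩, ?_⟩
    simp only [expInner, ContinuousMap.coe_mk, ne_eq, Real.exp_eq_exp]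
    rw [ω.inner_self]
    intro h
    exact hne (Subtype.ext ((inner_eq_one_iff_of_norm_eq_one ω.norm_coe η.norm_coe).1 h.symm))
  have htop := ContinuousMap.subalgebra_topologicalClosure_eq_top_of_separatesPoints A hsep
  rw [← hspan, dense_iff_closure_eq, ← Subalgebra.topologicalClosure_coe, htop]
  rfl

/-- A square integrable function that is orthogonal to all divergences of tangential fields is
constant. -/
theorem exists_ae_eq_const_of_integral_mul_sphDiv (hn : 2 ≤ n) {χ : Sph n → ℝ}
    (hχ : MemLp χ 2 (surfaceMeasure n))
    (hdiv : ∀ X : Sph n → Euc n, SphereSmooth X → (∀ ω, inner ℝ (X ω) (ω : Euc n) = 0) →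
      ∫ ω, χ ω * sphDiv X ω ∂surfaceMeasure n = 0) :
    ∃ C : ℝ, χ =ᵐ[surfaceMeasure n] fun _ => C := by
  have hχ1 : Integrable χ (surfaceMeasure n) := hχ.integrable (by norm_num)
  have : Nonempty (Fin n) := ⟨⟨0, by omega⟩⟩
  have hμ : (surfaceMeasure n).real univ ≠ 0 := by
    rw [measureReal_ne_zero_iff, Ne, Measure.measure_univ_eq_zero]
    exact Measure.toSphere_ne_zero _
  set C := (∫ ω, χ ω ∂surfaceMeasure n) / (surfaceMeasure n).real univ with hC
  refine ⟨C, ?_⟩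
  set χ' : Sph n → ℝ := fun ω => χ ω - C with hχ'
  have hm : MemLp χ' 2 (surfaceMeasure n) := hχ.sub (memLp_const C)
  have h1 : ∫ ω, χ' ω ∂surfaceMeasure n = 0 := by
    rw [hχ', integral_sub hχ1 (integrable_const C), integral_const, hC, smul_eq_mul]
    field_simp
    ring
  have hd : ∀ X : Sph n → Euc n, SphereSmooth X → (∀ ω, inner ℝ (X ω) (ω : Euc n) = 0) →
      ∫ ω, χ' ω * sphDiv X ω ∂surfaceMeasure n = 0 := by
    intro X hX ht
    simp_rw [hχ', sub_mul]
    rw [integral_sub (integrable_mul_continuous hχ (continuous_sphDiv hX))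
      ((continuous_sphDiv hX).integrable_sphere.const_mul C), integral_const_mul, hdiv X hX ht,
      integral_sphDiv_eq_zero hX ht]
    ring
  have hexp := integral_mul_exp_inner_eq_zero hn hm h1 hd
  set Y := hm.toLp χ' with hY
  have hinner : ∀ p : C(Sph n, ℝ),
      inner ℝ Y (ContinuousMap.toLp 2 (surfaceMeasure n) ℝ p) =
        ∫ ω, χ' ω * p ω ∂surfaceMeasure n := by
    intro p
    rw [L2.inner_def]
    refine integral_congr_ae ?_
    filter_upwards [hm.coeFn_toLp, ContinuousMap.coeFn_toLp (p := 2) (surfaceMeasure n) (𝕜 := ℝ) p]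
      with ω h2 h3
    rw [h2, h3]
    simp [mul_comm]
  set T : C(Sph n, ℝ) →L[ℝ] ℝ :=
    (innerSL ℝ Y).comp (ContinuousMap.toLp 2 (surfaceMeasure n) ℝ) with hT
  have hT0 : ∀ p, T p = 0 := by
    have hspan : ∀ p ∈ Submodule.span ℝ (range (expInner (n := n))), T p = 0 := by
      intro p hp
      have hle : Submodule.span ℝ (range (expInner (n := n))) ≤ T.toLinearMap.ker := by
        rw [Submodule.span_le]
        rintro _ ⟨v, rfl⟩
        exact (hinner (expInner v)).trans (hexp v)
      exact hle hp
    have hclosed : IsClosed {p | T p = 0} := isClosed_singleton.preimage T.continuous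
    intro p
    exact hclosed.closure_subset_iff.2 hspan (span_expInner_dense p)
  have hY0 : inner ℝ Y Y = 0 := by
    have hdense := ContinuousMap.toLp_denseRange ℝ (surfaceMeasure n) ℝ (p := 2) (by norm_num)
    have hclosed : IsClosed {y | inner ℝ Y y = 0} :=
      isClosed_singleton.preimage (innerSL ℝ Y).continuous
    exact hclosed.closure_subset_iff.2 (by rintro _ ⟨p, rfl⟩; exact hT0 p) (hdense Y)
  have hYz : Y = 0 := inner_self_eq_zero.1 hY0
  have := hm.coeFn_toLp
  rw [← hY, hYz] at this
  filter_upwards [this, Lp.coeFn_zero ℝ 2 (surfaceMeasure n)] with ω h2 h3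
  rw [h3] at h2
  simp only [hχ', Pi.zero_apply] at h2
  linarith

end Constancy

/-! ### The operator `L_κΩ` and its adjoint -/

section Operator

variable {n : ℕ}

/-- The tangential field `∇_ω f - κ f (Id - ω ⊗ ω) Ω`, whose divergence is `-L_κΩ f`. -/
def fluxField (κ : ℝ) (Ω : Sph n) (f : Sph n → ℝ) (ω : Sph n) : Euc n :=
  sphGrad f ω + (-κ * f ω) • tangProj ω (Ω : Euc n)

lemma sphSmooth_const_mul {f : Sph n → ℝ} (hf : SphSmooth f) (c : ℝ) :
    SphSmooth fun ω => c * f ω :=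
  SphSmooth.mul (SphereSmooth.const c) hf

lemma SphSmooth.add {f g : Sph n → ℝ} (hf : SphSmooth f) (hg : SphSmooth g) :
    SphSmooth fun ω => f ω + g ω :=
  SphereSmooth.add (F := ℝ) hf hg

lemma sphereSmooth_fluxField (κ : ℝ) (Ω : Sph n) {f : Sph n → ℝ} (hf : SphSmooth f) :
    SphereSmooth (fluxField κ Ω f) :=
  (sphereSmooth_sphGrad hf).add
    (SphereSmooth.smul (sphSmooth_const_mul hf (-κ)) (sphereSmooth_tangProj _))

lemma inner_fluxField_self (κ : ℝ) (Ω : Sph n) {f : Sph n → ℝ} (hf : SphSmooth f) (ω : Sph n) :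
    inner ℝ (fluxField κ Ω f ω) (ω : Euc n) = 0 := by
  rw [fluxField, inner_add_left, inner_sphGrad_self hf, inner_smul_left, inner_tangProj_self]
  simp

lemma opL_eq_neg_sphDiv (κ : ℝ) (Ω : Sph n) {f : Sph n → ℝ} (hf : SphSmooth f) (ω : Sph n) :
    opL κ Ω f ω = -sphDiv (fluxField κ Ω f) ω := by
  have hf' := sphSmooth_const_mul hf (-κ)
  have hT := sphereSmooth_tangProj (n := n) (Ω : Euc n)
  have h1 : sphDiv (fluxField κ Ω f) ω = sphDiv (sphGrad f) ω
      + sphDiv (fun ω => (-κ * f ω) • tangProj ω (Ω : Euc n)) ω :=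
    sphDiv_add (sphereSmooth_sphGrad hf) (SphereSmooth.smul hf' hT) ω
  rw [h1, opL, sphLaplacian, sphDiv_smul hf' hT, sphDiv_smul hf hT, sphGrad_const_mul hf,
    inner_smul_left]
  simp only [conj_trivial]
  ring

lemma continuous_opL (κ : ℝ) (Ω : Sph n) {f : Sph n → ℝ} (hf : SphSmooth f) :
    Continuous (opL κ Ω f) := by
  rw [show opL κ Ω f = fun ω => -sphDiv (fluxField κ Ω f) ω from
    funext (opL_eq_neg_sphDiv κ Ω hf)]
  exact (continuous_sphDiv (sphereSmooth_fluxField κ Ω hf)).neg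

lemma integral_opL_mul (κ : ℝ) (Ω : Sph n) {f u : Sph n → ℝ} (hf : SphSmooth f)
    (hu : SphSmooth u) : ∫ ω, opL κ Ω f ω * u ω ∂surfaceMeasure n =
      ∫ ω, inner ℝ (fluxField κ Ω f ω) (sphGrad u ω) ∂surfaceMeasure n := by
  simp_rw [opL_eq_neg_sphDiv κ Ω hf, neg_mul]
  rw [integral_neg, integral_sphDiv_mul (sphereSmooth_fluxField κ Ω hf)
    (inner_fluxField_self κ Ω hf) hu, neg_neg]

lemma sphSmooth_exp (κ : ℝ) (Ω : Sph n) :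
    SphSmooth fun ω : Sph n => Real.exp (κ * inner ℝ (Ω : Euc n) (ω : Euc n)) :=
  SphSmooth.comp (sphSmooth_inner _) (q := fun t => Real.exp (κ * t))
    (contDiff_const.mul contDiff_id).exp.contDiffOn fun _ => mem_univ _

/-- The equilibrium `exp (κ ω · Ω)` symmetrizes the operator. -/
lemma fluxField_exp_mul (κ : ℝ) (Ω : Sph n) {φ : Sph n → ℝ} (hφ : SphSmooth φ) (ω : Sph n) :
    fluxField κ Ω (fun ω : Sph n => Real.exp (κ * inner ℝ (Ω : Euc n) (ω : Euc n)) * φ ω) ω =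
      Real.exp (κ * inner ℝ (Ω : Euc n) (ω : Euc n)) • sphGrad φ ω := by
  have hd : HasDerivAt (fun t => Real.exp (κ * t))
      (Real.exp (κ * inner ℝ (Ω : Euc n) (ω : Euc n)) * κ) (inner ℝ (Ω : Euc n) (ω : Euc n)) := by
    simpa using ((hasDerivAt_id (inner ℝ (Ω : Euc n) (ω : Euc n) : ℝ)).const_mul κ).exp
  rw [fluxField, sphGrad_mul (sphSmooth_exp κ Ω) hφ,
    sphGrad_comp (sphSmooth_inner (Ω : Euc n)) hd, sphGrad_inner]
  module

/-! ### Functions of class `H¹` -/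

lemma tendsto_integral_inner {E : Type*} [NormedAddCommGroup E] [InnerProductSpace ℝ E]
    {α : Type*} [MeasurableSpace α] {μ : Measure α} {u : ℕ → α → E} {ψ P : α → E}
    (hP : MemLp P 2 μ) (hu : ∀ k, MemLp (u k) 2 μ) (hψ : MemLp ψ 2 μ)
    (h : Tendsto (fun k => eLpNorm (fun x => u k x - ψ x) 2 μ) atTop (𝓝 0)) :
    Tendsto (fun k => ∫ x, inner ℝ (P x) (u k x) ∂μ) atTop (𝓝 (∫ x, inner ℝ (P x) (ψ x) ∂μ)) := by
  have hin : ∀ {v : α → E} (hv : MemLp v 2 μ),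
      inner ℝ (hP.toLp P) (hv.toLp v) = ∫ x, inner ℝ (P x) (v x) ∂μ := by
    intro v hv
    rw [L2.inner_def]
    refine integral_congr_ae ?_
    filter_upwards [hP.coeFn_toLp, hv.coeFn_toLp] with x h1 h2
    rw [h1, h2]
  simp_rw [← hin hψ, ← fun k => hin (hu k)]
  refine Tendsto.inner tendsto_const_nhds ?_
  exact (Lp.tendsto_Lp_iff_tendsto_eLpNorm'' u hu ψ hψ).2 h

/-- In the weak formulation of `L*_κΩ ψ`, the derivatives fall on the test function or on `ψ`. -/
lemma integral_opL_mul_of_tendsto (κ : ℝ) (Ω : Sph n) {ψ : Sph n → ℝ} {u : ℕ → Sph n → ℝ}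
    {G : Sph n → Euc n} (hψ : MemLp ψ 2 (surfaceMeasure n)) (hu : ∀ k, SphSmooth (u k))
    (hG : MemLp G 2 (surfaceMeasure n))
    (h1 : Tendsto (fun k => eLpNorm (fun ω => u k ω - ψ ω) 2 (surfaceMeasure n)) atTop (𝓝 0))
    (h2 : Tendsto (fun k => eLpNorm (fun ω => sphGrad (u k) ω - G ω) 2 (surfaceMeasure n))
      atTop (𝓝 0)) {f : Sph n → ℝ} (hf : SphSmooth f) :
    ∫ ω, opL κ Ω f ω * ψ ω ∂surfaceMeasure n =
      ∫ ω, inner ℝ (fluxField κ Ω f ω) (G ω) ∂surfaceMeasure n := by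
  have t1 := tendsto_integral_inner (continuous_opL κ Ω hf).memLp_sphere
    (fun k => (SphereSmooth.continuous (hu k)).memLp_sphere) hψ h1
  have t2 := tendsto_integral_inner (sphereSmooth_fluxField κ Ω hf).continuous.memLp_sphere
    (fun k => (sphereSmooth_sphGrad (hu k)).continuous.memLp_sphere) hG h2
  have e : ∀ x y : ℝ, inner ℝ x y = x * y := fun x y => by simp [mul_comm]
  simp_rw [e] at t1
  simp_rw [integral_opL_mul κ Ω hf (hu _)] at t1
  exact tendsto_nhds_unique t1 t2

/-- The constants are the only `H¹` functions in the kernel of `L*_κΩ`: the weighted energy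
`∫ exp (κ ω · Ω) |∇_ω ψ|²` vanishes. -/
lemma ae_eq_const_of_integral_opL_mul_eq_zero (hn : 2 ≤ n) (κ : ℝ) (Ω : Sph n) {ψ : Sph n → ℝ}
    (hψ : MemH1Sph ψ)
    (h0 : ∀ f : Sph n → ℝ, SphSmooth f → ∫ ω, opL κ Ω f ω * ψ ω ∂surfaceMeasure n = 0) :
    ∃ C : ℝ, ψ =ᵐ[surfaceMeasure n] fun _ => C := by
  obtain ⟨hψ2, u, G, hu, hG, h1, h2⟩ := hψ
  set e : Sph n → ℝ := fun ω => Real.exp (κ * inner ℝ (Ω : Euc n) (ω : Euc n)) with he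
  have hec : Continuous e := SphereSmooth.continuous (sphSmooth_exp κ Ω)
  have heG : MemLp (fun ω => e ω • G ω) 2 (surfaceMeasure n) := by
    obtain ⟨M, hM⟩ := isCompact_univ.exists_bound_of_continuousOn hec.continuousOn
    refine hG.of_le_mul (c := M) (hec.aestronglyMeasurable.smul hG.1)
      (Eventually.of_forall fun ω => ?_)
    rw [norm_smul]
    exact mul_le_mul_of_nonneg_right (hM ω (mem_univ _)) (norm_nonneg _)
  have hz : ∀ k, ∫ ω, inner ℝ (e ω • G ω) (sphGrad (u k) ω) ∂surfaceMeasure n = 0 := by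
    intro k
    have h3 := h0 _ ((sphSmooth_exp κ Ω).mul (hu k))
    rw [integral_opL_mul_of_tendsto κ Ω hψ2 hu hG h1 h2 ((sphSmooth_exp κ Ω).mul (hu k))] at h3
    rw [← h3]
    refine integral_congr_ae (Eventually.of_forall fun ω => ?_)
    beta_reduce
    rw [fluxField_exp_mul κ Ω (hu k), inner_smul_left, inner_smul_left, real_inner_comm]
  have hlim := tendsto_integral_inner heG
    (fun k => (sphereSmooth_sphGrad (hu k)).continuous.memLp_sphere) hG h2
  simp_rw [hz] at hlim
  have henergy := (tendsto_nhds_unique tendsto_const_nhds hlim).symm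
  have hI : Integrable (fun ω => inner ℝ (e ω • G ω) (G ω)) (surfaceMeasure n) := by
    refine (heG.norm.integrable_mul hG.norm).mono (heG.1.inner hG.1)
      (Eventually.of_forall fun ω => ?_)
    simpa using norm_inner_le_norm (𝕜 := ℝ) (e ω • G ω) (G ω)
  have hnonneg : 0 ≤ fun ω => inner ℝ (e ω • G ω) (G ω) := fun ω => by
    simp only [Pi.zero_apply, inner_smul_left, conj_trivial, real_inner_self_eq_norm_sq]
    exact mul_nonneg (Real.exp_pos _).le (sq_nonneg _)
  have hG0 : G =ᵐ[surfaceMeasure n] 0 := by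
    filter_upwards [(integral_eq_zero_iff_of_nonneg hnonneg hI).1 henergy] with ω hω
    simp only [Pi.zero_apply, inner_smul_left, conj_trivial] at hω
    exact inner_self_eq_zero.1 ((mul_eq_zero.1 hω).resolve_left (Real.exp_pos _).ne')
  refine exists_ae_eq_const_of_integral_mul_sphDiv hn hψ2 fun X hX ht => ?_
  have t1 := tendsto_integral_inner (continuous_sphDiv hX).memLp_sphere
    (fun k => (SphereSmooth.continuous (hu k)).memLp_sphere) hψ2 h1
  have t2 := (tendsto_integral_inner hX.continuous.memLp_sphere
    (fun k => (sphereSmooth_sphGrad (hu k)).continuous.memLp_sphere) hG h2).neg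
  have hr : ∀ x y : ℝ, inner ℝ x y = x * y := fun x y => by simp [mul_comm]
  simp_rw [hr] at t1
  simp_rw [integral_sphDiv_mul hX ht (hu _)] at t1
  simp_rw [mul_comm (ψ _)]
  rw [tendsto_nhds_unique t1 t2, neg_eq_zero]
  refine integral_eq_zero_of_ae ?_
  filter_upwards [hG0] with ω hω
  rw [hω]
  simp

/-! ### The solutions `h (ω · Ω) A · ω` -/

lemma Sph.inner_mem (Ω ω : Sph n) : inner ℝ (Ω : Euc n) (ω : Euc n) ∈ Ioo (-3 : ℝ) 3 := by
  have := abs_le.1 (Ω.abs_inner_le ω)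
  exact ⟨by linarith [this.1], by linarith [this.2]⟩

/-- The function `h (ω · Ω) A · ω`. -/
def invariantOf (h : ℝ → ℝ) (Ω : Sph n) (A : Euc n) (ω : Sph n) : ℝ :=
  h (inner ℝ (Ω : Euc n) (ω : Euc n)) * inner ℝ A (ω : Euc n)

variable {h : ℝ → ℝ}

lemma sphSmooth_comp_inner (hh : ContDiffOn ℝ ((⊤ : ℕ∞) : WithTop ℕ∞) h (Ioo (-3) 3))
    (Ω : Sph n) : SphSmooth fun ω : Sph n => h (inner ℝ (Ω : Euc n) (ω : Euc n)) :=
  SphSmooth.comp (sphSmooth_inner _) hh fun ω => Ω.inner_mem ω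

lemma sphSmooth_invariantOf (hh : ContDiffOn ℝ ((⊤ : ℕ∞) : WithTop ℕ∞) h (Ioo (-3) 3))
    (Ω : Sph n) (A : Euc n) : SphSmooth (invariantOf h Ω A) :=
  (sphSmooth_comp_inner hh Ω).mul (sphSmooth_inner A)

lemma inner_tangProj_tangProj (ω : Sph n) (v w : Euc n) :
    inner ℝ (tangProj ω v) (tangProj ω w) =
      inner ℝ v w - inner ℝ v (ω : Euc n) * inner ℝ w (ω : Euc n) := by
  rw [← inner_tangProj_comm, inner_tangProj_left, inner_tangProj_self, inner_tangProj_left,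
    real_inner_comm w (ω : Euc n)]
  ring

/-- If `A ⟂ Ω`, then `A · ω` vanishes at the poles `ω = ±Ω`. -/
lemma inner_eq_zero_or_mem_Ioo {Ω : Sph n} {A : Euc n} (hA : inner ℝ A (Ω : Euc n) = 0)
    (ω : Sph n) : inner ℝ A (ω : Euc n) = 0 ∨
      inner ℝ (Ω : Euc n) (ω : Euc n) ∈ Ioo (-1 : ℝ) 1 := by
  by_cases hm : inner ℝ (Ω : Euc n) (ω : Euc n) ^ 2 = 1
  · left
    have h1 : inner ℝ (tangProj ω (Ω : Euc n)) (tangProj ω (Ω : Euc n)) = 0 := by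
      rw [inner_tangProj_tangProj, Ω.inner_self, ← pow_two, hm, sub_self]
    have h2 := inner_tangProj_left ω (Ω : Euc n) A
    rw [inner_self_eq_zero.1 h1, inner_zero_left, real_inner_comm, hA,
      real_inner_comm A (ω : Euc n)] at h2
    have h3 : inner ℝ (Ω : Euc n) (ω : Euc n) ≠ 0 := fun h => by rw [h] at hm; norm_num at hm
    have h4 : inner ℝ (Ω : Euc n) (ω : Euc n) * inner ℝ A (ω : Euc n) = 0 := by linarith
    exact (mul_eq_zero.1 h4).resolve_left h3
  · right
    have h1 := Ω.abs_inner_le ω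
    refine abs_lt.1 (lt_of_le_of_ne h1 fun h => hm ?_)
    rw [← sq_abs, h, one_pow]

lemma sphGrad_invariantOf (hh : ContDiffOn ℝ ((⊤ : ℕ∞) : WithTop ℕ∞) h (Ioo (-3) 3))
    (Ω : Sph n) (A : Euc n) (ω : Sph n) :
    sphGrad (invariantOf h Ω A) ω = h (inner ℝ (Ω : Euc n) (ω : Euc n)) • tangProj ω A +
      (deriv h (inner ℝ (Ω : Euc n) (ω : Euc n)) * inner ℝ A (ω : Euc n)) •
        tangProj ω (Ω : Euc n) := by
  have h1 := sphGrad_mul (sphSmooth_comp_inner hh Ω) (sphSmooth_inner A) ω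
  rw [sphGrad_comp (sphSmooth_inner _) (hh.hasDerivAt_of_mem_Ioo (Ω.inner_mem ω)), sphGrad_inner,
    sphGrad_inner] at h1
  refine Eq.trans h1 ?_
  module

/-- The equation for `h` is the equation `L*_κΩ ψ = A · ω` for `ψ = h (ω · Ω) A · ω`. -/
lemma sphDiv_exp_smul_sphGrad_invariantOf {κ : ℝ}
    (hh : ContDiffOn ℝ ((⊤ : ℕ∞) : WithTop ℕ∞) h (Ioo (-3) 3))
    (hsol : ∀ μ ∈ Ioo (-1 : ℝ) 1, SolvesRadial n κ 1 h μ) {Ω : Sph n} {A : Euc n}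
    (hA : inner ℝ A (Ω : Euc n) = 0) (ω : Sph n) :
    sphDiv (fun ω : Sph n => Real.exp (κ * inner ℝ (Ω : Euc n) (ω : Euc n)) •
      sphGrad (invariantOf h Ω A) ω) ω =
      -(Real.exp (κ * inner ℝ (Ω : Euc n) (ω : Euc n)) * inner ℝ A (ω : Euc n)) := by
  have hh' := contDiffOn_deriv hh
  have hexp : ContDiffOn ℝ ((⊤ : ℕ∞) : WithTop ℕ∞) (fun t => Real.exp (κ * t)) (Ioo (-3) 3) :=
    (contDiff_const.mul contDiff_id).exp.contDiffOn
  set q₀ : ℝ → ℝ := fun t => Real.exp (κ * t) * h t with hq₀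
  set q₁ : ℝ → ℝ := fun t => Real.exp (κ * t) * deriv h t with hq₁
  have c₀ : ContDiffOn ℝ ((⊤ : ℕ∞) : WithTop ℕ∞) q₀ (Ioo (-3) 3) := hexp.mul hh
  have c₁ : ContDiffOn ℝ ((⊤ : ℕ∞) : WithTop ℕ∞) q₁ (Ioo (-3) 3) := hexp.mul hh'
  have hX : (fun ω : Sph n => Real.exp (κ * inner ℝ (Ω : Euc n) (ω : Euc n)) •
      sphGrad (invariantOf h Ω A) ω) = fun ω : Sph n =>
      q₀ (inner ℝ (Ω : Euc n) (ω : Euc n)) • tangProj ω A +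
      (q₁ (inner ℝ (Ω : Euc n) (ω : Euc n)) * inner ℝ A (ω : Euc n)) •
        tangProj ω (Ω : Euc n) := by
    ext1 ω
    rw [sphGrad_invariantOf hh, hq₀, hq₁]
    module
  have s₀ := sphSmooth_comp_inner c₀ Ω
  have s₁ := sphSmooth_comp_inner c₁ Ω
  have sA := sphSmooth_inner (n := n) A
  have s₁A := s₁.mul sA
  have tA := sphereSmooth_tangProj (n := n) A
  have tΩ := sphereSmooth_tangProj (n := n) (Ω : Euc n)
  rw [hX, sphDiv_add (SphereSmooth.smul s₀ tA) (SphereSmooth.smul s₁A tΩ), sphDiv_smul s₀ tA,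
    sphDiv_smul s₁A tΩ, sphDiv_tangProj, sphDiv_tangProj, sphGrad_mul s₁ sA, sphGrad_inner]
  set μ : ℝ := inner ℝ (Ω : Euc n) (ω : Euc n) with hμ
  have hmem : μ ∈ Ioo (-3 : ℝ) 3 := Ω.inner_mem ω
  have de : HasDerivAt (fun t => Real.exp (κ * t)) (Real.exp (κ * μ) * κ) μ := by
    simpa using ((hasDerivAt_id μ).const_mul κ).exp
  have d₀ : HasDerivAt q₀ (Real.exp (κ * μ) * κ * h μ + Real.exp (κ * μ) * deriv h μ) μ :=
    de.mul (hh.hasDerivAt_of_mem_Ioo hmem)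
  have d₁ : HasDerivAt q₁
      (Real.exp (κ * μ) * κ * deriv h μ + Real.exp (κ * μ) * deriv (deriv h) μ) μ :=
    de.mul (hh'.hasDerivAt_of_mem_Ioo hmem)
  rw [sphGrad_comp (sphSmooth_inner (Ω : Euc n)) d₀, sphGrad_comp (sphSmooth_inner (Ω : Euc n)) d₁,
    sphGrad_inner]
  simp only [inner_add_left, inner_smul_left, conj_trivial, inner_tangProj_tangProj,
    Ω.inner_self, hA, real_inner_comm A (Ω : Euc n), ← hμ, hq₀, hq₁]
  rcases inner_eq_zero_or_mem_Ioo hA ω with ha | hm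
  · rw [ha]; ring
  · have hode := hsol μ hm
    simp only [SolvesRadial] at hode
    linear_combination (Real.exp (κ * μ) * inner ℝ A (ω : Euc n)) * hode

/-- In the weak sense, `L*_κΩ` maps `h (ω · Ω) A · ω` to `A · ω`. -/
lemma integral_opL_mul_invariantOf {κ : ℝ}
    (hh : ContDiffOn ℝ ((⊤ : ℕ∞) : WithTop ℕ∞) h (Ioo (-3) 3))
    (hsol : ∀ μ ∈ Ioo (-1 : ℝ) 1, SolvesRadial n κ 1 h μ) {Ω : Sph n} {A : Euc n}
    (hA : inner ℝ A (Ω : Euc n) = 0) {f : Sph n → ℝ} (hf : SphSmooth f) :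
    ∫ ω, opL κ Ω f ω * invariantOf h Ω A ω ∂surfaceMeasure n =
      ∫ ω, f ω * inner ℝ A (ω : Euc n) ∂surfaceMeasure n := by
  set e : Sph n → ℝ := fun ω => Real.exp (κ * inner ℝ (Ω : Euc n) (ω : Euc n)) with he
  set φ : Sph n → ℝ := fun ω => Real.exp (-κ * inner ℝ (Ω : Euc n) (ω : Euc n)) * f ω with hφ
  have hφs : SphSmooth φ := (sphSmooth_exp (-κ) Ω).mul hf
  have hinv : ∀ ω, e ω * Real.exp (-κ * inner ℝ (Ω : Euc n) (ω : Euc n)) = 1 := fun ω => by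
    rw [he, ← Real.exp_add]; simp
  have hfe : f = fun ω => e ω * φ ω := by
    ext ω
    rw [hφ, ← mul_assoc, hinv, one_mul]
  have sψ := sphSmooth_invariantOf hh Ω A
  have hX : SphereSmooth fun ω => e ω • sphGrad (invariantOf h Ω A) ω :=
    SphereSmooth.smul (sphSmooth_exp κ Ω) (sphereSmooth_sphGrad sψ)
  have hG := integral_sphDiv_mul hX
    (fun ω => by rw [inner_smul_left, inner_sphGrad_self sψ, mul_zero]) hφs
  rw [integral_opL_mul κ Ω hf sψ]
  have h1 : ∀ ω, inner ℝ (fluxField κ Ω f ω) (sphGrad (invariantOf h Ω A) ω)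
      = inner ℝ (e ω • sphGrad (invariantOf h Ω A) ω) (sphGrad φ ω) := fun ω => by
    conv_lhs => rw [hfe]
    rw [fluxField_exp_mul κ Ω hφs, inner_smul_left, inner_smul_left,
      real_inner_comm (sphGrad φ ω) (sphGrad (invariantOf h Ω A) ω)]
  simp_rw [h1]
  rw [← neg_eq_iff_eq_neg.2 hG, ← integral_neg]
  refine integral_congr_ae (Eventually.of_forall fun ω => ?_)
  beta_reduce
  rw [sphDiv_exp_smul_sphGrad_invariantOf hh hsol hA]
  have : f ω = e ω * φ ω := congrFun hfe ω
  rw [this]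
  ring

end Operator

/-! ### The elliptic problem on `(0, π)` -/

/-- The function `h` is recovered from its angular profile `sin θ h (cos θ)`. -/
lemma hOf_angular (h : ℝ → ℝ) {μ : ℝ} (hμ : μ ∈ Ioo (-1 : ℝ) 1) : hOf (angular h) μ = h μ := by
  have hp : 0 < 1 - μ ^ 2 := by nlinarith [hμ.1, hμ.2]
  rw [hOf, angular, Real.cos_arccos hμ.1.le hμ.2.le, Real.sin_arccos, Real.sqrt_eq_rpow,
    ← mul_assoc, ← Real.rpow_add hp]
  norm_num

lemma hOf_angular_pos {n : ℕ} (hn : 2 ≤ n) {κ : ℝ} {h : ℝ → ℝ}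
    (hh : ContDiffOn ℝ ((⊤ : ℕ∞) : WithTop ℕ∞) h (Ioo (-3) 3))
    (hsol : ∀ μ ∈ Ioo (-1 : ℝ) 1, SolvesRadial n κ 1 h μ) {μ : ℝ} (hμ : μ ∈ Ioo (-1 : ℝ) 1) :
    0 < hOf (angular h) μ := by
  refine mul_pos (Real.rpow_pos_of_pos (by nlinarith [hμ.1, hμ.2]) _) (angular_pos hn hh hsol ?_)
  exact ⟨Real.arccos_pos.2 hμ.2, lt_of_le_of_ne (Real.arccos_le_pi _)
    fun h => hμ.1.not_ge (Real.arccos_eq_pi.1 h)⟩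

lemma isEllipticSolution_angular {n : ℕ} (hn : 2 ≤ n) {κ : ℝ} {h : ℝ → ℝ}
    (hh : ContDiffOn ℝ ((⊤ : ℕ∞) : WithTop ℕ∞) h (Ioo (-3) 3))
    (hsol : ∀ μ ∈ Ioo (-1 : ℝ) 1, SolvesRadial n κ 1 h μ) :
    IsEllipticSolution n κ (angular h) :=
  ⟨memV_angular hn hh, fun φ hφ => by
    have := integral_ellIntegrand_angular hn hh hsol hφ
    rwa [one_mul] at this⟩

/-- The bilinear form of the elliptic problem is coercive on `V`. -/
lemma IsEllipticSolution.eqOn {n : ℕ} (hn : 2 ≤ n) {κ : ℝ} {g₁ g₂ : ℝ → ℝ}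
    (h₁ : IsEllipticSolution n κ g₁) (h₂ : IsEllipticSolution n κ g₂) :
    EqOn g₁ g₂ (Ioo 0 Real.pi) := by
  have hd := h₁.1.sub h₂.1
  have e₁ := intervalIntegrable_ellIntegrand hn κ h₁.1 hd
  have e₂ := intervalIntegrable_ellIntegrand hn κ h₂.1 hd
  have h0 : ∫ θ in (0 : ℝ)..Real.pi, ellIntegrand n κ (fun θ => g₁ θ - g₂ θ)
      (fun θ => g₁ θ - g₂ θ) θ = 0 := by
    have hsub : (∫ θ in (0 : ℝ)..Real.pi, ellIntegrand n κ g₁ (fun θ => g₁ θ - g₂ θ) θ)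
        - ∫ θ in (0 : ℝ)..Real.pi, ellIntegrand n κ g₂ (fun θ => g₁ θ - g₂ θ) θ = 0 :=
      sub_eq_zero.2 ((h₁.2 _ hd).trans (h₂.2 _ hd).symm)
    rw [← intervalIntegral.integral_sub e₁ e₂] at hsub
    refine Eq.trans ?_ hsub
    rw [intervalIntegral.integral_of_le Real.pi_pos.le,
      intervalIntegral.integral_of_le Real.pi_pos.le, integral_Ioc_eq_integral_Ioo,
      integral_Ioc_eq_integral_Ioo]
    refine integral_congr_ae ?_
    filter_upwards [h₁.1.ae_differentiableAt, h₂.1.ae_differentiableAt] with θ d₁ d₂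
    simp only [ellIntegrand]
    rw [show deriv (fun θ => g₁ θ - g₂ θ) θ = deriv g₁ θ - deriv g₂ θ from deriv_fun_sub d₁.1 d₂.1]
    ring
  intro θ hθ
  exact sub_eq_zero.1 (hd.eqOn_zero hn κ h0 hθ)

/-! ### The generalized collisional invariants -/

section Invariants

variable {n : ℕ}

lemma MemH1Sph.congr {ψ χ : Sph n → ℝ} (hψ : MemH1Sph ψ) (h : ψ =ᵐ[surfaceMeasure n] χ) :
    MemH1Sph χ := by
  obtain ⟨hψ2, u, G, hu, hG, h1, h2⟩ := hψ
  refine ⟨hψ2.ae_eq h, u, G, hu, hG, ?_, h2⟩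
  refine h1.congr fun k => eLpNorm_congr_ae ?_
  filter_upwards [h] with ω hω
  rw [hω]

lemma MemH1Sph.add {ψ v : Sph n → ℝ} (hψ : MemH1Sph ψ) (hv : SphSmooth v) :
    MemH1Sph fun ω => ψ ω + v ω := by
  obtain ⟨hψ2, u, G, hu, hG, h1, h2⟩ := hψ
  refine ⟨hψ2.add (SphereSmooth.continuous hv).memLp_sphere, fun k ω => u k ω + v ω,
    fun ω => G ω + sphGrad v ω, fun k => (hu k).add hv,
    hG.add (sphereSmooth_sphGrad hv).continuous.memLp_sphere, ?_, ?_⟩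
  · simpa only [add_sub_add_right_eq_sub] using h1
  · simpa only [sphGrad_add (hu _) hv, add_sub_add_right_eq_sub] using h2

lemma SphSmooth.memH1Sph {v : Sph n → ℝ} (hv : SphSmooth v) : MemH1Sph v :=
  ⟨(SphereSmooth.continuous hv).memLp_sphere, fun _ => v, sphGrad v, fun _ => hv,
    (sphereSmooth_sphGrad hv).continuous.memLp_sphere, by simp, by simp⟩

lemma integrable_inner_of_memLp {X G : Sph n → Euc n} (hX : Continuous X)
    (hG : MemLp G 2 (surfaceMeasure n)) :
    Integrable (fun ω => inner ℝ (X ω) (G ω)) (surfaceMeasure n) := by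
  have hX2 : MemLp X 2 (surfaceMeasure n) := hX.memLp_sphere
  refine (hX2.norm.integrable_mul hG.norm).mono (hX2.1.inner hG.1)
    (Eventually.of_forall fun ω => ?_)
  simpa using norm_inner_le_norm (𝕜 := ℝ) (X ω) (G ω)

lemma fluxField_add (κ : ℝ) (Ω : Sph n) {f g : Sph n → ℝ} (hf : SphSmooth f) (hg : SphSmooth g)
    (ω : Sph n) :
    fluxField κ Ω (f + g) ω = fluxField κ Ω f ω + fluxField κ Ω g ω := by
  have := sphGrad_add hf hg ω
  simp only [fluxField, Pi.add_apply]
  rw [show sphGrad (f + g) ω = _ from this]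
  module

lemma fluxField_smul (κ : ℝ) (Ω : Sph n) {f : Sph n → ℝ} (hf : SphSmooth f) (c : ℝ)
    (ω : Sph n) : fluxField κ Ω (c • f) ω = c • fluxField κ Ω f ω := by
  have := sphGrad_const_mul hf c ω
  simp only [fluxField, Pi.smul_apply, smul_eq_mul]
  rw [show sphGrad (c • f) ω = _ from this]
  module

/-- The space `C^∞` of the sphere. -/
def smoothFunctions (n : ℕ) : Submodule ℝ (Sph n → ℝ) where
  carrier := {f | SphSmooth f}
  add_mem' hf hg := SphSmooth.add hf hg
  zero_mem' := SphereSmooth.const (0 : ℝ)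
  smul_mem' c _ hf := sphSmooth_const_mul hf c

/-- The linear form `f ↦ ∫ ⟨∇_ω f - κ f (Id - ω ⊗ ω) Ω, G⟩`, which is `f ↦ ∫ L_κΩ (f) ψ` if `G` is
the tangential gradient of `ψ`. -/
def weakForm (κ : ℝ) (Ω : Sph n) {G : Sph n → Euc n} (hG : MemLp G 2 (surfaceMeasure n)) :
    smoothFunctions n →ₗ[ℝ] ℝ where
  toFun f := ∫ ω, inner ℝ (fluxField κ Ω f.1 ω) (G ω) ∂surfaceMeasure n
  map_add' f g := by
    simp only [Submodule.coe_add, fluxField_add κ Ω f.2 g.2, inner_add_left]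
    exact integral_add
      (integrable_inner_of_memLp (sphereSmooth_fluxField κ Ω f.2).continuous hG)
      (integrable_inner_of_memLp (sphereSmooth_fluxField κ Ω g.2).continuous hG)
  map_smul' c f := by
    simp only [Submodule.coe_smul, fluxField_smul κ Ω f.2, inner_smul_left, conj_trivial,
      RingHom.id_apply, smul_eq_mul, integral_const_mul]

lemma integrable_smul_coe {f : Sph n → ℝ} (hf : SphSmooth f) :
    Integrable (fun ω : Sph n => f ω • (ω : Euc n)) (surfaceMeasure n) :=
  ((SphereSmooth.continuous hf).smul continuous_subtype_val).integrable_sphere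

/-- The linear constraint `f ↦ (Id - Ω ⊗ Ω) j_f`. -/
def transverseFlux (Ω : Sph n) : smoothFunctions n →ₗ[ℝ] Euc n where
  toFun f := tangProj Ω (flux f.1)
  map_add' f g := by
    have : flux (f.1 + g.1) = flux f.1 + flux g.1 := by
      simp only [flux, Pi.add_apply, add_smul]
      exact integral_add (integrable_smul_coe f.2) (integrable_smul_coe g.2)
    simp only [Submodule.coe_add, this, tangProj, inner_add_left]
    module
  map_smul' c f := by
    have : flux (c • f.1) = c • flux f.1 := by
      simp only [flux, Pi.smul_apply, smul_assoc, integral_smul]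
    simp only [Submodule.coe_smul, this, tangProj, inner_smul_left, conj_trivial,
      RingHom.id_apply]
    module

lemma inner_flux (A : Euc n) {f : Sph n → ℝ} (hf : SphSmooth f) :
    inner ℝ A (flux f) = ∫ ω, f ω * inner ℝ A (ω : Euc n) ∂surfaceMeasure n := by
  rw [flux, ← integral_inner (integrable_smul_coe hf)]
  simp_rw [inner_smul_right]

lemma integral_opL (κ : ℝ) (Ω : Sph n) {f : Sph n → ℝ} (hf : SphSmooth f) :
    ∫ ω, opL κ Ω f ω ∂surfaceMeasure n = 0 := by
  simp_rw [opL_eq_neg_sphDiv κ Ω hf]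
  rw [integral_neg, integral_sphDiv_eq_zero (sphereSmooth_fluxField κ Ω hf)
    (inner_fluxField_self κ Ω hf), neg_zero]

/-- A linear form that vanishes on the kernel of the linear constraint factors through it; hence
`ψ` is a generalized collisional invariant if and only if `L*_κΩ ψ = A · ω` for some `A ⟂ Ω`, and
this equation is solved up to constants by `h (ω · Ω) A · ω`. -/
theorem memH1Sph_and_integral_eq_zero_iff (hn : 2 ≤ n) {κ : ℝ} {h : ℝ → ℝ}
    (hh : ContDiffOn ℝ ((⊤ : ℕ∞) : WithTop ℕ∞) h (Ioo (-3) 3))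
    (hsol : ∀ μ ∈ Ioo (-1 : ℝ) 1, SolvesRadial n κ 1 h μ) (Ω : Sph n) (ψ : Sph n → ℝ) :
    (MemH1Sph ψ ∧ ∀ f : Sph n → ℝ, SphSmooth f → tangProj Ω (flux f) = 0 →
      ∫ ω, opL κ Ω f ω * ψ ω ∂surfaceMeasure n = 0) ↔
    ∃ (C : ℝ) (A : Euc n), inner ℝ A (Ω : Euc n) = 0 ∧
      ψ =ᵐ[surfaceMeasure n] fun ω => C + invariantOf h Ω A ω := by
  constructor
  · rintro ⟨hψ, hker⟩
    obtain ⟨hψ2, u, G, hu, hG, h1, h2⟩ := id hψ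
    have hweak : ∀ f : smoothFunctions n,
        weakForm κ Ω hG f = ∫ ω, opL κ Ω f.1 ω * ψ ω ∂surfaceMeasure n := fun f =>
      (integral_opL_mul_of_tendsto κ Ω hψ2 hu hG h1 h2 f.2).symm
    have hmem : weakForm κ Ω hG ∈ LinearMap.range (transverseFlux Ω).dualMap := by
      rw [LinearMap.range_dualMap_eq_dualAnnihilator_ker, Submodule.mem_dualAnnihilator]
      intro f hf
      rw [hweak]
      exact hker f.1 f.2 hf
    obtain ⟨l, hl⟩ := hmem
    set A₀ : Euc n := (InnerProductSpace.toDual ℝ (Euc n)).symm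
      (LinearMap.toContinuousLinearMap l) with hA₀
    set A := tangProj Ω A₀ with hA
    have hAΩ : inner ℝ A (Ω : Euc n) = 0 := inner_tangProj_self Ω A₀
    have hv := sphSmooth_invariantOf hh Ω A
    have hv' := sphSmooth_const_mul hv (-1)
    obtain ⟨C, hC⟩ := ae_eq_const_of_integral_opL_mul_eq_zero hn κ Ω (hψ.add hv') fun f hf => by
      have i1 : Integrable (fun ω => opL κ Ω f ω * ψ ω) (surfaceMeasure n) := by
        simpa only [mul_comm] using integrable_mul_continuous hψ2 (continuous_opL κ Ω hf)
      have i2 : Integrable (fun ω => opL κ Ω f ω * invariantOf h Ω A ω) (surfaceMeasure n) :=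
        ((continuous_opL κ Ω hf).mul (SphereSmooth.continuous hv)).integrable_sphere
      have e : ∫ ω, opL κ Ω f ω * ψ ω ∂surfaceMeasure n =
          ∫ ω, opL κ Ω f ω * invariantOf h Ω A ω ∂surfaceMeasure n := by
        rw [integral_opL_mul_invariantOf hh hsol hAΩ hf, ← inner_flux A hf, hA,
          inner_tangProj_comm, hA₀, InnerProductSpace.toDual_symm_apply]
        exact ((LinearMap.congr_fun hl ⟨f, hf⟩).trans (hweak ⟨f, hf⟩)).symm
      calc ∫ ω, opL κ Ω f ω * (ψ ω + -1 * invariantOf h Ω A ω) ∂surfaceMeasure n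
          = ∫ ω, (opL κ Ω f ω * ψ ω - opL κ Ω f ω * invariantOf h Ω A ω) ∂surfaceMeasure n := by
            congr 1; ext ω; ring
        _ = 0 := by rw [integral_sub i1 i2, e, sub_self]
    refine ⟨C, A, hAΩ, ?_⟩
    filter_upwards [hC] with ω hω
    linarith
  · rintro ⟨C, A, hA, hψ⟩
    have hv := sphSmooth_invariantOf hh Ω A
    refine ⟨(SphSmooth.memH1Sph (SphSmooth.add (SphereSmooth.const C) hv)).congr hψ.symm,
      fun f hf hflux => ?_⟩
    have hop := continuous_opL κ Ω hf
    have e : ∫ ω, opL κ Ω f ω * ψ ω ∂surfaceMeasure n =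
        ∫ ω, (opL κ Ω f ω * C + opL κ Ω f ω * invariantOf h Ω A ω) ∂surfaceMeasure n := by
      refine integral_congr_ae ?_
      filter_upwards [hψ] with ω hω
      rw [hω]; ring
    have i1 : Integrable (fun ω => opL κ Ω f ω * C) (surfaceMeasure n) :=
      (hop.mul continuous_const).integrable_sphere
    have i2 : Integrable (fun ω => opL κ Ω f ω * invariantOf h Ω A ω) (surfaceMeasure n) :=
      (hop.mul (SphereSmooth.continuous hv)).integrable_sphere
    rw [e, integral_add i1 i2, integral_mul_const,
      integral_opL κ Ω hf, integral_opL_mul_invariantOf hh hsol hA hf, ← inner_flux A hf,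
      sub_eq_zero.1 hflux, inner_smul_right, hA]
    ring

/-- The linear map `(C, A) ↦ C + h (ω · Ω) A · ω`. -/
def invariantMap {h : ℝ → ℝ} (hh : ContDiffOn ℝ ((⊤ : ℕ∞) : WithTop ℕ∞) h (Ioo (-3) 3))
    (Ω : Sph n) :
    ℝ × (Submodule.span ℝ {(Ω : Euc n)})ᗮ →ₗ[ℝ] Lp ℝ 2 (surfaceMeasure n) where
  toFun p := MemLp.toLp (fun ω => p.1 + invariantOf h Ω p.2 ω) (Continuous.memLp_sphere
    (continuous_const.add (SphereSmooth.continuous (sphSmooth_invariantOf hh Ω p.2))))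
  map_add' p q := by
    rw [← MemLp.toLp_add]
    congr 1
    ext ω
    simp only [invariantOf, Prod.fst_add, Prod.snd_add, Submodule.coe_add, inner_add_left,
      Pi.add_apply]
    ring
  map_smul' c p := by
    rw [RingHom.id_apply, ← MemLp.toLp_const_smul]
    congr 1
    ext ω
    simp only [invariantOf, Prod.smul_fst, Prod.smul_snd, Submodule.coe_smul, inner_smul_left,
      Pi.smul_apply, smul_eq_mul, conj_trivial]
    ring

lemma coeFn_invariantMap {h : ℝ → ℝ}
    (hh : ContDiffOn ℝ ((⊤ : ℕ∞) : WithTop ℕ∞) h (Ioo (-3) 3)) (Ω : Sph n)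
    (p : ℝ × (Submodule.span ℝ {(Ω : Euc n)})ᗮ) :
    invariantMap hh Ω p =ᵐ[surfaceMeasure n] fun ω => p.1 + invariantOf h Ω p.2 ω :=
  MemLp.coeFn_toLp (Continuous.memLp_sphere (continuous_const.add
    (SphereSmooth.continuous (sphSmooth_invariantOf hh Ω p.2))))

/-- Evaluation at `Ω` gives `C`, and evaluation at `A / |A|` gives `C + h 0 |A|`. -/
lemma invariantMap_injective {h : ℝ → ℝ}
    (hh : ContDiffOn ℝ ((⊤ : ℕ∞) : WithTop ℕ∞) h (Ioo (-3) 3)) (h0 : h 0 ≠ 0) (Ω : Sph n) :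
    Function.Injective (invariantMap hh Ω) := by
  rw [← LinearMap.ker_eq_bot, LinearMap.ker_eq_bot']
  rintro ⟨C, A, hA⟩ hp
  have hc : Continuous fun ω => C + invariantOf h Ω A ω :=
    continuous_const.add (SphereSmooth.continuous (sphSmooth_invariantOf hh Ω A))
  have hae : (fun ω => C + invariantOf h Ω A ω) =ᵐ[surfaceMeasure n] fun _ => 0 := by
    have h1 : MemLp.toLp _ hc.memLp_sphere = 0 := hp
    filter_upwards [hc.memLp_sphere.coeFn_toLp, h1 ▸ Lp.coeFn_zero ℝ 2 (surfaceMeasure n)]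
      with ω e1 e2
    rw [← e1, e2]; rfl
  have hz := congrFun (Continuous.ae_eq_iff_eq (surfaceMeasure n) hc continuous_const |>.1 hae)
  have hΩA : inner ℝ (Ω : Euc n) A = 0 := Submodule.mem_orthogonal_singleton_iff_inner_right.1 hA
  have hC : C = 0 := by
    have := hz Ω
    simpa [invariantOf, real_inner_comm (Ω : Euc n) A, hΩA] using this
  have hA0 : A = 0 := by
    by_contra hne
    have hne' : ‖A‖ ≠ 0 := norm_ne_zero_iff.2 hne
    have := hz ⟨‖A‖⁻¹ • A, by simp [norm_smul, hne']⟩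
    simp [invariantOf, inner_smul_right, hΩA, hC, h0, hne] at this
  subst hC
  subst hA0
  rfl

lemma finrank_range_invariantMap {h : ℝ → ℝ}
    (hh : ContDiffOn ℝ ((⊤ : ℕ∞) : WithTop ℕ∞) h (Ioo (-3) 3)) (h0 : h 0 ≠ 0) (Ω : Sph n) :
    Module.finrank ℝ (LinearMap.range (invariantMap hh Ω)) = n := by
  rw [LinearMap.finrank_range_of_inj (invariantMap_injective hh h0 Ω), Module.finrank_prod,
    Module.finrank_self]
  have h1 := Submodule.finrank_add_finrank_orthogonal (Submodule.span ℝ {(Ω : Euc n)})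
  rwa [finrank_span_singleton Ω.coe_ne_zero, finrank_euclideanSpace_fin] at h1

end Invariants

end

theorem mainTheorem2 (n : ℕ) (hn : 2 ≤ n) (κ : ℝ) :
    ∃ g : ℝ → ℝ,
      IsEllipticSolution n κ g ∧
      (∀ g' : ℝ → ℝ, IsEllipticSolution n κ g' → Set.EqOn g' g (Set.Ioo 0 Real.pi)) ∧
      (∀ θ ∈ Set.Ioo 0 Real.pi, 0 < g θ) ∧
      (∀ μ ∈ Set.Ioo (-1 : ℝ) 1, 0 < hOf g μ) ∧
      (n = 2 → κ ≠ 0 → ∀ θ ∈ Set.Icc 0 Real.pi,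
        g θ = θ / κ - Real.pi / κ *
          ((∫ φ in (0 : ℝ)..θ, Real.exp (-κ * Real.cos φ)) /
            ∫ φ in (0 : ℝ)..Real.pi, Real.exp (-κ * Real.cos φ))) ∧
      (n = 2 → κ = 0 → ∀ θ ∈ Set.Icc 0 Real.pi, g θ = Real.sin θ) ∧
      ∀ Ω : Sph n,
        (∀ ψ : MeasureTheory.Lp ℝ 2 (surfaceMeasure n),
          ψ ∈ genCollInvariants n κ Ω ↔
            ∃ (C : ℝ) (A : Euc n), inner ℝ A (Ω : Euc n) = 0 ∧
              ∀ᵐ ω ∂(surfaceMeasure n),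
                ψ ω = C + hOf g (inner ℝ (ω : Euc n) (Ω : Euc n)) * inner ℝ A (ω : Euc n)) ∧
        ∃ W : Submodule ℝ (MeasureTheory.Lp ℝ 2 (surfaceMeasure n)),
          (W : Set (MeasureTheory.Lp ℝ 2 (surfaceMeasure n))) = genCollInvariants n κ Ω ∧
          Module.finrank ℝ W = n := by
  obtain ⟨h, hh, hsol⟩ := exists_solvesRadial hn κ
  have hpos : ∀ μ ∈ Ioo (-1 : ℝ) 1, 0 < hOf (angular h) μ := fun μ hμ =>
    hOf_angular_pos hn hh hsol hμ
  refine ⟨angular h, isEllipticSolution_angular hn hh hsol,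
    fun g' hg' => hg'.eqOn hn (isEllipticSolution_angular hn hh hsol),
    fun θ hθ => angular_pos hn hh hsol hθ, hpos, ?_, ?_, fun Ω => ⟨fun ψ => ?_, ?_⟩⟩
  · rintro rfl hκ θ hθ
    exact angular_eq_of_two_of_ne_zero hκ hh hsol hθ
  · rintro rfl rfl θ hθ
    exact angular_eq_sin_of_two hh hsol hθ
  · refine (memH1Sph_and_integral_eq_zero_iff hn hh hsol Ω ψ).trans
      (exists_congr fun C => exists_congr fun A => and_congr_right fun hA => ?_)
    -- Where `ω = ±Ω`, the value of `hOf` is irrelevant, because `A · ω = 0`.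
    have hinv : ∀ ω : Sph n, hOf (angular h) (inner ℝ (ω : Euc n) (Ω : Euc n)) *
        inner ℝ A (ω : Euc n) = invariantOf h Ω A ω := fun ω => by
      rw [invariantOf, real_inner_comm (Ω : Euc n) (ω : Euc n)]
      rcases inner_eq_zero_or_mem_Ioo hA ω with h0 | hm
      · rw [h0, mul_zero, mul_zero]
      · rw [hOf_angular h hm]
    simp_rw [hinv]
    rfl
  · have h0 : h 0 ≠ 0 := by
      have h0m : (0 : ℝ) ∈ Ioo (-1 : ℝ) 1 := by norm_num
      rw [← hOf_angular h h0m]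
      exact (hpos 0 h0m).ne'
    refine ⟨LinearMap.range (invariantMap hh Ω), ?_, finrank_range_invariantMap hh h0 Ω⟩
    ext ψ
    refine Iff.trans ?_ (memH1Sph_and_integral_eq_zero_iff hn hh hsol Ω ψ).symm
    constructor
    · rintro ⟨⟨C, A, hA⟩, rfl⟩
      exact ⟨C, A, Submodule.mem_orthogonal_singleton_iff_inner_left.1 hA,
        coeFn_invariantMap hh Ω _⟩
    · rintro ⟨C, A, hA, hψ⟩
      refine ⟨(C, ⟨A, Submodule.mem_orthogonal_singleton_iff_inner_left.2 hA⟩), Lp.ext ?_⟩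
      exact (coeFn_invariantMap hh Ω _).trans hψ.symm
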